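/- Let $\mathrm{CZF}_{Exp}$ be the theory, in intuitionistic first-order logic with equality over the language $\{\in\}$, with the axioms Extensionality, Pairing, Union, Infinity ($\exists x\forall u[u\in x\leftrightarrow(u=\emptyset\vee\exists v\in x\; u=v\cup\{v\})]$), Set Induction (for all formulas), Separation for bounded formulas, Strong Collection (for all formulas), and Exponentiation (for all sets $x,y$ the functions from $x$ to $y$ form a set); that is, Constructive Zermelo–Fraenkel set theory CZF with Subset Collection replaced by Exponentiation. A Dedekind real is a set $S\subseteq\mathbb Q$ such that (boundedness) some rational is in $S$ and some rational is not in $S$, (openness) $\forall r\in S\,\exists r'\in S\; r<r'$, and (locatedness) for all rationals $r<s$, $r\in S$ or $s\notin S$. A fundamental sequence is a sequence $(r_n)_{n\in\mathbb N}$ of rationals together with a modulus $f:\mathbb N\to\mathbb N$ such that $|r_m-r_n|<2^{-k}$ for all $k$ and all $m,n\ge f(k)$; a Cauchy real is an equivalence class of fundamental sequences under the relation $\forall k\,\exists n\,\forall m\ge n\;|r_m-s_m|<2^{-k}$. Theorem. There is a Kripke model $M$ such that at every node of $M$ all axioms of $\mathrm{CZF}_{Exp}$ hold, the Cauchy reals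 form a set, and the Dedekind reals do not form a set, i.e. the negation of the sentence $\exists z\,\forall S\,[S\in z\leftrightarrow S\text{ is a Dedekind real}]$ holds. Moreover, $\mathrm{CZF}_{Exp}$ proves that the Cauchy reals form a set, whereas $\mathrm{CZF}_{Exp}$ does not prove that the Dedekind reals form a set. -/

import Mathlib

/-! Intuitionistic first-order logic with equality over the language `{∈}`, Kripke models,
the axioms of CZF with Exponentiation in place of Subset Collection, and the set-theoretic
formulas that define the rational numbers, the Cauchy reals and the Dedekind reals. -/

namespace CZF

universe u v

/-- Formulas of the language of set theory. Variables are de Bruijn indices: under a quantifier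
the index `0` is the newly bound variable and the old index `i` becomes `i + 1`. -/
inductive Fml : Type
  | bot : Fml
  | eq : ℕ → ℕ → Fml
  | mem : ℕ → ℕ → Fml
  | conj : Fml → Fml → Fml
  | disj : Fml → Fml → Fml
  | imp : Fml → Fml → Fml
  | all : Fml → Fml
  | ex : Fml → Fml

/-- The effect of a renaming of variables below one quantifier. -/
def lift (ξ : ℕ → ℕ) : ℕ → ℕ
  | 0 => 0
  | n + 1 => ξ n + 1

namespace Fml

/-- Simultaneous renaming of the free variables. All terms are variables, so this is
capture-avoiding substitution. -/
def rename : (ℕ → ℕ) → Fml → Fml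
  | _, bot => bot
  | ξ, eq i j => eq (ξ i) (ξ j)
  | ξ, mem i j => mem (ξ i) (ξ j)
  | ξ, conj φ ψ => conj (rename ξ φ) (rename ξ ψ)
  | ξ, disj φ ψ => disj (rename ξ φ) (rename ξ ψ)
  | ξ, imp φ ψ => imp (rename ξ φ) (rename ξ ψ)
  | ξ, all φ => all (rename (lift ξ) φ)
  | ξ, ex φ => ex (rename (lift ξ) φ)

/-- `φ` with all free variables shifted by one. -/
def shift (φ : Fml) : Fml := φ.rename Nat.succ

/-- Renaming that sends the variable `0` to `i` and the parameter `n + 1` to `n + k`. -/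
def sub1 (i k : ℕ) : ℕ → ℕ
  | 0 => i
  | n + 1 => n + k

/-- Renaming that sends the variable `0` to `i`, the variable `1` to `j` and the parameter
`n + 2` to `n + k`. -/
def sub2 (i j k : ℕ) : ℕ → ℕ
  | 0 => i
  | 1 => j
  | n + 2 => n + k

/-- The instance of `φ` (the body of a quantifier) at the variable `t`. -/
def inst (φ : Fml) (t : ℕ) : Fml := φ.rename (sub1 t 0)

/-- Negation. -/
def neg (φ : Fml) : Fml := imp φ bot

/-- Equivalence. -/
def iff (φ ψ : Fml) : Fml := conj (imp φ ψ) (imp ψ φ)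

/-- `∀ x ∈ y, φ`; in `φ` the variable `x` has index `0`. -/
def ball (y : ℕ) (φ : Fml) : Fml := all (imp (mem 0 (y + 1)) φ)

/-- `∃ x ∈ y, φ`; in `φ` the variable `x` has index `0`. -/
def bex (y : ℕ) (φ : Fml) : Fml := ex (conj (mem 0 (y + 1)) φ)

/-- Bounded (restricted) formulas. -/
inductive Bounded : Fml → Prop
  | bot : Bounded bot
  | eq (i j : ℕ) : Bounded (eq i j)
  | mem (i j : ℕ) : Bounded (mem i j)
  | conj {φ ψ : Fml} : Bounded φ → Bounded ψ → Bounded (conj φ ψ)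
  | disj {φ ψ : Fml} : Bounded φ → Bounded ψ → Bounded (disj φ ψ)
  | imp {φ ψ : Fml} : Bounded φ → Bounded ψ → Bounded (imp φ ψ)
  | ball (y : ℕ) {φ : Fml} : Bounded φ → Bounded (ball y φ)
  | bex (y : ℕ) {φ : Fml} : Bounded φ → Bounded (bex y φ)

end Fml

open Fml

/-- Natural deduction for intuitionistic first-order logic with equality. `Derives T Γ φ` says
that `φ` follows from the non-logical axioms `T` and the open assumptions `Γ`. The eigenvariable
condition concerns `Γ` only, so a free variable of an axiom is read as universally quantified. -/
inductive Derives (T : Set Fml) : List Fml → Fml → Prop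
  | ax {Γ : List Fml} {φ : Fml} : φ ∈ T → Derives T Γ φ
  | hyp {Γ : List Fml} {φ : Fml} : φ ∈ Γ → Derives T Γ φ
  | botE {Γ : List Fml} {φ : Fml} : Derives T Γ bot → Derives T Γ φ
  | conjI {Γ : List Fml} {φ ψ : Fml} :
      Derives T Γ φ → Derives T Γ ψ → Derives T Γ (conj φ ψ)
  | conjE₁ {Γ : List Fml} {φ ψ : Fml} : Derives T Γ (conj φ ψ) → Derives T Γ φ
  | conjE₂ {Γ : List Fml} {φ ψ : Fml} : Derives T Γ (conj φ ψ) → Derives T Γ ψ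
  | disjI₁ {Γ : List Fml} {φ ψ : Fml} : Derives T Γ φ → Derives T Γ (disj φ ψ)
  | disjI₂ {Γ : List Fml} {φ ψ : Fml} : Derives T Γ ψ → Derives T Γ (disj φ ψ)
  | disjE {Γ : List Fml} {φ ψ χ : Fml} :
      Derives T Γ (disj φ ψ) → Derives T (φ :: Γ) χ → Derives T (ψ :: Γ) χ → Derives T Γ χ
  | impI {Γ : List Fml} {φ ψ : Fml} : Derives T (φ :: Γ) ψ → Derives T Γ (imp φ ψ)
  | impE {Γ : List Fml} {φ ψ : Fml} :
      Derives T Γ (imp φ ψ) → Derives T Γ φ → Derives T Γ ψ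
  | allI {Γ : List Fml} {φ : Fml} : Derives T (Γ.map shift) φ → Derives T Γ (all φ)
  | allE {Γ : List Fml} {φ : Fml} (t : ℕ) : Derives T Γ (all φ) → Derives T Γ (φ.inst t)
  | exI {Γ : List Fml} {φ : Fml} (t : ℕ) : Derives T Γ (φ.inst t) → Derives T Γ (ex φ)
  | exE {Γ : List Fml} {φ χ : Fml} :
      Derives T Γ (ex φ) → Derives T (φ :: Γ.map shift) χ.shift → Derives T Γ χ
  | eqRefl {Γ : List Fml} (t : ℕ) : Derives T Γ (eq t t)
  | eqSubst {Γ : List Fml} {φ : Fml} (s t : ℕ) :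
      Derives T Γ (eq s t) → Derives T Γ (φ.inst s) → Derives T Γ (φ.inst t)

/-- `T` proves `φ`. -/
def Proves (T : Set Fml) (φ : Fml) : Prop := Derives T [] φ

/-- Kripke models for the language `{∈}`: a nonempty partial order of nodes, a nonempty domain at
each node, coherent transition functions, and a membership relation at each node which the
transition functions preserve. Equality at a node is equality of elements of its domain. -/
structure KripkeModel where
  /-- nodes -/
  Node : Type u
  [order : PartialOrder Node]
  [node_nonempty : Nonempty Node]
  /-- the domain at a node -/
  Dom : Node → Type v
  [dom_nonempty : ∀ p, Nonempty (Dom p)]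
  /-- transition functions -/
  map : ∀ {p q : Node}, p ≤ q → Dom p → Dom q
  map_refl : ∀ (p : Node) (x : Dom p), map (le_refl p) x = x
  map_map : ∀ {p q r : Node} (h : p ≤ q) (k : q ≤ r) (x : Dom p),
    map k (map h x) = map (h.trans k) x
  /-- membership at a node -/
  Mem : ∀ p : Node, Dom p → Dom p → Prop
  mem_map : ∀ {p q : Node} (h : p ≤ q) (x y : Dom p), Mem p x y → Mem q (map h x) (map h y)

attribute [instance] KripkeModel.order KripkeModel.node_nonempty KripkeModel.dom_nonempty

/-- Extension of an assignment by a value for the variable `0`. -/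
def extend {D : Type v} (d : D) (e : ℕ → D) : ℕ → D
  | 0 => d
  | n + 1 => e n

namespace KripkeModel

/-- Satisfaction at a node. -/
def Sat (M : KripkeModel.{u, v}) : Fml → (p : M.Node) → (ℕ → M.Dom p) → Prop
  | bot, _, _ => False
  | eq i j, _, e => e i = e j
  | mem i j, p, e => M.Mem p (e i) (e j)
  | conj φ ψ, p, e => M.Sat φ p e ∧ M.Sat ψ p e
  | disj φ ψ, p, e => M.Sat φ p e ∨ M.Sat ψ p e
  | imp φ ψ, p, e => ∀ (q : M.Node) (h : p ≤ q),
      M.Sat φ q (fun n => M.map h (e n)) → M.Sat ψ q (fun n => M.map h (e n))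
  | all φ, p, e => ∀ (q : M.Node) (h : p ≤ q) (d : M.Dom q),
      M.Sat φ q (extend d (fun n => M.map h (e n)))
  | ex φ, p, e => ∃ d : M.Dom p, M.Sat φ p (extend d e)

/-- `M ⊨ φ`: the formula holds at every node (under every assignment). -/
def Models (M : KripkeModel.{u, v}) (φ : Fml) : Prop :=
  ∀ (p : M.Node) (e : ℕ → M.Dom p), M.Sat φ p e

end KripkeModel

/-! ### Basic set-theoretic formulas (arguments are variables) -/

/-- `x ⊆ y` -/
def isSubset (x y : ℕ) : Fml := ball x (mem 0 (y + 1))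

/-- `x = ∅` -/
def isEmpty (x : ℕ) : Fml := ball x bot

/-- `y = x ∪ {x}` -/
def isSucc (y x : ℕ) : Fml :=
  conj (mem x y) (conj (isSubset x y) (ball y (disj (mem 0 (x + 1)) (eq 0 (x + 1)))))

/-- `z = {x, y}` -/
def isUPair (z x y : ℕ) : Fml :=
  conj (mem x z) (conj (mem y z) (ball z (disj (eq 0 (x + 1)) (eq 0 (y + 1)))))

/-- `p = ⟨x, y⟩ = {{x, x}, {x, y}}` -/
def isPair (p x y : ℕ) : Fml :=
  conj (bex p (isUPair 0 (x + 1) (x + 1)))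
    (conj (bex p (isUPair 0 (x + 1) (y + 1)))
      (ball p (disj (isUPair 0 (x + 1) (x + 1)) (isUPair 0 (x + 1) (y + 1)))))

/-- `t = ⟨⟨a, b⟩, d⟩`; the inner pair is an element of an element of `t`. -/
def isTriple (t a b d : ℕ) : Fml :=
  bex t (bex 0 (conj (isPair 0 (a + 2) (b + 2)) (isPair (t + 2) 0 (d + 2))))

/-- `⟨x, y⟩ ∈ f` -/
def app (f x y : ℕ) : Fml := bex f (isPair 0 (x + 1) (y + 1))

/-- `f` is a function with domain `A` and range contained in `B`. -/
def isFun (f A B : ℕ) : Fml :=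
  conj (ball f (bex (A + 1) (bex (B + 2) (isPair 2 1 0))))
    (conj (ball A (bex (B + 1) (app (f + 2) 1 0)))
      (ball A (ball (B + 1) (ball (B + 2)
        (imp (conj (app (f + 3) 2 1) (app (f + 3) 2 0)) (eq 1 0))))))

/-- `∀ u, u ∈ w ↔ (∅ = u ∨ ∃ v ∈ w, u = v + 1)` -/
def isOmega (w : ℕ) : Fml :=
  all (iff (mem 0 (w + 1)) (disj (isEmpty 0) (bex (w + 1) (isSucc 1 0))))

/-! ### The axioms of CZF with Exponentiation instead of Subset Collection -/

/-- `∀ x y, (∀ z, z ∈ x ↔ z ∈ y) → x = y` -/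
def extensionality : Fml := all (all (imp (all (iff (mem 0 2) (mem 0 1))) (eq 1 0)))

/-- `∀ x y, ∃ z, ∀ u, u ∈ z ↔ u = x ∨ u = y` -/
def pairing : Fml := all (all (ex (all (iff (mem 0 1) (disj (eq 0 3) (eq 0 2))))))

/-- `∀ x, ∃ z, ∀ u, u ∈ z ↔ ∃ y ∈ x, u ∈ y` -/
def union : Fml := all (ex (all (iff (mem 0 1) (bex 2 (mem 1 0)))))

/-- `∃ x, ∀ u, u ∈ x ↔ (∅ = u ∨ ∃ v ∈ x, u = v + 1)` -/
def infinity : Fml := ex (isOmega 0)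

/-- `(∀ x, (∀ y ∈ x, φ(y)) → φ(x)) → ∀ x, φ(x)`, where `x` is the variable `0` of `φ`. -/
def setInduction (φ : Fml) : Fml :=
  imp (all (imp (ball 0 (φ.rename (sub1 0 2))) φ)) (all φ)

/-- `∀ a, ∃ b, ∀ x, x ∈ b ↔ x ∈ a ∧ φ(x)`, where `x` is the variable `0` of `φ`. -/
def separation (φ : Fml) : Fml :=
  all (ex (all (iff (mem 0 1) (conj (mem 0 2) (φ.rename (sub1 0 3))))))

/-- `∀ a, (∀ x ∈ a, ∃ y, φ(x,y)) →
∃ b, (∀ x ∈ a, ∃ y ∈ b, φ(x,y)) ∧ (∀ y ∈ b, ∃ x ∈ a, φ(x,y))`,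
where `y` is the variable `0` and `x` the variable `1` of `φ`. -/
def strongCollection (φ : Fml) : Fml :=
  all (imp (ball 0 (ex (φ.rename (sub2 0 1 3))))
    (ex (conj (ball 1 (bex 1 (φ.rename (sub2 0 1 4))))
      (ball 0 (bex 2 (φ.rename (sub2 1 0 4)))))))

/-- For all `x`, `y` the functions from `x` to `y` form a set. -/
def exponentiation : Fml := all (all (ex (all (iff (mem 0 1) (isFun 0 3 2)))))

/-- The theory CZF with Subset Collection replaced by Exponentiation. -/
inductive CZFExp : Set Fml
  | extensionality : CZFExp extensionality
  | pairing : CZFExp pairing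
  | union : CZFExp union
  | infinity : CZFExp infinity
  | setInduction (φ : Fml) : CZFExp (setInduction φ)
  | boundedSeparation (φ : Fml) : Bounded φ → CZFExp (separation φ)
  | strongCollection (φ : Fml) : CZFExp (strongCollection φ)
  | exponentiation : CZFExp exponentiation

/-! ### Arithmetic of the natural numbers, `w` being (the variable for) `ω` -/

/-- `h(b) = c` for a function `h : ω → ω` with `base (h(0))` and `step (h(i)) (h(i+1))` for all
`i`. The first argument of `base` and `step` is the number of quantifiers they stand under. -/
def isRec (w b c : ℕ) (base : ℕ → ℕ → Fml) (step : ℕ → ℕ → ℕ → Fml) : Fml :=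
  ex (conj (isFun 0 (w + 1) (w + 1))
    (conj (bex (w + 1) (bex (w + 2) (conj (isEmpty 1) (conj (app 2 1 0) (base 3 0)))))
      (conj (ball (w + 1) (ball (w + 2) (ball (w + 3) (ball (w + 4)
          (imp (conj (isSucc 2 3) (conj (app 4 3 1) (app 4 2 0))) (step 5 1 0))))))
        (app 0 (b + 1) (c + 1)))))

/-- `a + b = c` -/
def isAdd (w a b c : ℕ) : Fml :=
  isRec w b c (fun k x => eq x (a + k)) (fun _ x y => isSucc y x)

/-- `a · b = c` -/
def isMul (w a b c : ℕ) : Fml :=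
  isRec w b c (fun _ x => isEmpty x) (fun k x y => isAdd (w + k) x (a + k) y)

/-- `2 ^ b = c` -/
def isPow2 (w b c : ℕ) : Fml :=
  isRec w b c (fun _ x => bex x (conj (isEmpty 0) (isSucc (x + 1) 0)))
    (fun k x y => isAdd (w + k) x x y)

/-- `a · b + c · d = m` -/
def isMulAddMul (w a b c d m : ℕ) : Fml :=
  bex w (bex (w + 1) (conj (isMul (w + 2) (a + 2) (b + 2) 1)
    (conj (isMul (w + 2) (c + 2) (d + 2) 0) (isAdd (w + 2) 1 0 (m + 2)))))

/-- `m ≤ n` for natural numbers -/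
def natLe (m n : ℕ) : Fml := disj (mem m n) (eq m n)

/-! ### The rational numbers
A rational is the equivalence class of the triples `⟨⟨a, b⟩, d⟩` of naturals, `d ≠ 0`, that
represent the fraction `(a - b) / d`. -/

/-- `(a - b) / d = (a' - b') / d'`, that is, `a d' + b' d = a' d + b d'`. -/
def fracEq (w a b d a' b' d' : ℕ) : Fml :=
  bex w (conj (isMulAddMul (w + 1) (a + 1) (d' + 1) (b' + 1) (d + 1) 0)
    (isMulAddMul (w + 1) (a' + 1) (d + 1) (b + 1) (d' + 1) 0))

/-- `q` is the equivalence class of `(a - b) / d`. -/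
def isFracClass (w q a b d : ℕ) : Fml :=
  all (iff (mem 0 (q + 1))
    (bex (w + 1) (bex (w + 2) (bex (w + 3)
      (conj (neg (isEmpty 0)) (conj (isTriple 3 2 1 0)
        (fracEq (w + 4) (a + 4) (b + 4) (d + 4) 2 1 0)))))))

/-- `Q` is the set of rational numbers. -/
def isRationals (w Q : ℕ) : Fml :=
  all (iff (mem 0 (Q + 1))
    (bex (w + 1) (bex (w + 2) (bex (w + 3)
      (conj (neg (isEmpty 0)) (isFracClass (w + 4) 3 2 1 0))))))

/-- `⟨⟨a, b⟩, d⟩ ∈ q` -/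
def hasRep (q a b d : ℕ) : Fml := bex q (isTriple 0 (a + 1) (b + 1) (d + 1))

/-- There are representatives `(a - b) / d` of `q` and `(a' - b') / d'` of `q'` which satisfy `φ`;
in `φ` the indices of `a, b, d, a', b', d'` are `5, 4, 3, 2, 1, 0`. -/
def withReps (w q q' : ℕ) (φ : Fml) : Fml :=
  bex w (bex (w + 1) (bex (w + 2) (bex (w + 3) (bex (w + 4) (bex (w + 5)
    (conj (hasRep (q + 6) 5 4 3) (conj (hasRep (q' + 6) 2 1 0) φ)))))))

/-- `q < q'` for rationals: `a d' + b' d < a' d + b d'`. -/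
def ratLt (w q q' : ℕ) : Fml :=
  withReps w q q' (bex (w + 6) (bex (w + 7)
    (conj (isMulAddMul (w + 8) 7 2 3 5 1) (conj (isMulAddMul (w + 8) 4 5 6 2 0) (mem 1 0)))))

/-- `t · u < t · v + d · d'` for natural numbers -/
def mulLt (w t u v d d' : ℕ) : Fml :=
  bex w (bex (w + 1) (conj (isMul (w + 2) (t + 2) (u + 2) 1)
    (conj (isMulAddMul (w + 2) (t + 2) (v + 2) (d + 2) (d' + 2) 0) (mem 1 0))))

/-- `|q - q'| < 1 / 2 ^ k` for rationals: with `u = a d' + b' d` and `v = a' d + b d'` this says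
`2 ^ k u < 2 ^ k v + d d'` and `2 ^ k v < 2 ^ k u + d d'`. -/
def ratClose (w k q q' : ℕ) : Fml :=
  withReps w q q' (bex (w + 6) (bex (w + 7) (bex (w + 8)
    (conj (isMulAddMul (w + 9) 8 3 4 6 2) (conj (isMulAddMul (w + 9) 5 6 7 3 1)
      (conj (isPow2 (w + 9) (k + 9) 0)
        (conj (mulLt (w + 9) 0 2 1 6 3) (mulLt (w + 9) 0 1 2 6 3))))))))

/-! ### Cauchy reals and Dedekind reals -/

/-- `|r(m) - s(n)| < 1 / 2 ^ k` for sequences `r, s : ω → Q` -/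
def seqClose (w Q k r m s n : ℕ) : Fml :=
  bex Q (bex (Q + 1) (conj (app (r + 2) (m + 2) 1) (conj (app (s + 2) (n + 2) 0)
    (ratClose (w + 2) (k + 2) 1 0))))

/-- `x = ⟨r, f⟩` is a fundamental sequence: `r : ω → Q` and `f : ω → ω` is a modulus, that is,
`|r(m) - r(n)| < 1 / 2 ^ k` for all `k` and all `m, n ≥ f(k)`. -/
def isFundSeq (w Q x : ℕ) : Fml :=
  ex (ex (conj (isPair (x + 2) 1 0)
    (conj (isFun 1 (w + 2) (Q + 2)) (conj (isFun 0 (w + 2) (w + 2))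
      (ball (w + 2) (ball (w + 3) (ball (w + 4) (ball (w + 5)
        (imp (conj (app 4 3 0) (conj (natLe 0 2) (natLe 0 1)))
          (seqClose (w + 6) (Q + 6) 3 5 2 5 1))))))))))

/-- The fundamental sequences `x = ⟨r, f⟩` and `y = ⟨s, g⟩` coincide: for every `k` there is `n`
such that `|r(m) - s(m)| < 1 / 2 ^ k` for all `m ≥ n`. -/
def coincide (w Q x y : ℕ) : Fml :=
  ex (ex (ex (ex (conj (isPair (x + 4) 3 2) (conj (isPair (y + 4) 1 0)
    (ball (w + 4) (bex (w + 5) (ball (w + 6) (imp (natLe 1 0)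
      (seqClose (w + 7) (Q + 7) 2 6 0 4 0))))))))))

/-- `C` is a Cauchy real: the equivalence class of some fundamental sequence. -/
def isCauchyReal (C : ℕ) : Fml :=
  ex (ex (conj (isOmega 1) (conj (isRationals 1 0)
    (ex (conj (isFundSeq 2 1 0)
      (all (iff (mem 0 (C + 4)) (conj (isFundSeq 3 2 0) (coincide 3 2 0 1)))))))))

/-- `S` is a Dedekind real: `S ⊆ Q`, and `S` is bounded, open and located. -/
def isDedekindReal (S : ℕ) : Fml :=
  ex (ex (conj (isOmega 1) (conj (isRationals 1 0) (conj (isSubset (S + 2) 0)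
    (conj (conj (bex 0 (mem 0 (S + 3))) (bex 0 (neg (mem 0 (S + 3)))))
      (conj (ball (S + 2) (bex (S + 3) (ratLt 3 1 0)))
        (ball 0 (ball 1 (imp (ratLt 3 1 0)
          (disj (mem 1 (S + 4)) (neg (mem 0 (S + 4)))))))))))))

/-- The sentence "the Cauchy reals form a set". -/
def cauchyRealsFormSet : Fml := ex (all (iff (mem 0 1) (isCauchyReal 0)))

/-- The sentence "the Dedekind reals form a set". -/
def dedekindRealsFormSet : Fml := ex (all (iff (mem 0 1) (isDedekindReal 0)))

end CZF

namespace CZF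

open Fml

/-! ### Renaming and free variables -/

/-! The model is built around a moving real number. A name is a set that depends on the point: its
varying elements belong to it over open sets, and when the point settles at `r` the name turns into
an ordinary set, possibly gaining the elements of `st r`. `Force` is the topological interpretation
over ℝ with one further demand: implications and universal statements must also survive settling.
After settling all parameters are constant names (`check`) and a new point begins to move. For
constant parameters, formulas whose universal quantifiers are all bounded are absolute
(`force_check`).

All axioms of the theory are forced (`valid_CZFExp`); Exponentiation is the delicate one. While the
point moves, a function between two names is determined by a family of open sets and a record of its
settled values, so there are only set-many of them (`exists_eqv_relName`). After settling, a
function between constant sets is locally constant because intervals are connected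
(`eqv_check_settle`), so the classical function set suffices. The cut of the moving point,
`genericReal`, is a Dedekind real that is not locally constant. A set of all Dedekind reals would
settle to a constant set, whose members are all locally constant, and the cut of the newly moving
point would be missing from it (`not_force_dedekindRealsFormSet`).

Forcing is sound for derivations (`Derives.force`), which gives the unprovability at once. The
Kripke model comes from completeness (`exists_countermodel`), applied to the consistent theory of
all forced formulas.

That the Cauchy reals form a set is checked in an arbitrary Kripke model of the axioms.
Exponentiation confines the quantifiers over functions to sets, so the arithmetical formulas are
"small", that is, usable in Separation. Fundamental sequences are separated from a product of two
function sets, and their equivalence classes are gathered with Strong Collection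
(`definesSet_isCauchyReal`). Completeness turns this into a derivation. -/

theorem lift_id : lift id = id := by
  funext n; cases n <;> rfl

theorem lift_comp (ξ η : ℕ → ℕ) : lift (ξ ∘ η) = lift ξ ∘ lift η := by
  funext n; cases n <;> rfl

theorem rename_id (φ : Fml) : φ.rename id = φ := by
  induction φ with
  | bot => rfl
  | eq i j => rfl
  | mem i j => rfl
  | conj φ ψ h₁ h₂ => simp only [rename, h₁, h₂]
  | disj φ ψ h₁ h₂ => simp only [rename, h₁, h₂]
  | imp φ ψ h₁ h₂ => simp only [rename, h₁, h₂]
  | all φ h => simp only [rename, lift_id, h]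
  | ex φ h => simp only [rename, lift_id, h]

theorem rename_rename (φ : Fml) (ξ η : ℕ → ℕ) :
    (φ.rename η).rename ξ = φ.rename (ξ ∘ η) := by
  induction φ generalizing ξ η with
  | bot => rfl
  | eq i j => rfl
  | mem i j => rfl
  | conj φ ψ h₁ h₂ => simp only [rename, h₁, h₂]
  | disj φ ψ h₁ h₂ => simp only [rename, h₁, h₂]
  | imp φ ψ h₁ h₂ => simp only [rename, h₁, h₂]
  | all φ h => simp only [rename, lift_comp, h]
  | ex φ h => simp only [rename, lift_comp, h]

namespace Fml

/-- The free variables of a formula. -/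
def fv : Fml → Set ℕ
  | bot => ∅
  | eq i j => {i, j}
  | mem i j => {i, j}
  | conj φ ψ => fv φ ∪ fv ψ
  | disj φ ψ => fv φ ∪ fv ψ
  | imp φ ψ => fv φ ∪ fv ψ
  | all φ => Nat.succ ⁻¹' fv φ
  | ex φ => Nat.succ ⁻¹' fv φ

theorem finite_fv (φ : Fml) : φ.fv.Finite := by
  induction φ with
  | bot => exact Set.finite_empty
  | eq i j => exact Set.toFinite {i, j}
  | mem i j => exact Set.toFinite {i, j}
  | conj φ ψ h₁ h₂ => exact h₁.union h₂
  | disj φ ψ h₁ h₂ => exact h₁.union h₂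
  | imp φ ψ h₁ h₂ => exact h₁.union h₂
  | all φ h => exact h.preimage Nat.succ_injective.injOn
  | ex φ h => exact h.preimage Nat.succ_injective.injOn

theorem rename_congr {φ : Fml} {ξ η : ℕ → ℕ} (h : Set.EqOn ξ η φ.fv) :
    φ.rename ξ = φ.rename η := by
  induction φ generalizing ξ η with
  | bot => rfl
  | eq i j => simp only [rename, h (Or.inl rfl : i ∈ fv (eq i j)), h (Or.inr rfl : j ∈ fv (eq i j))]
  | mem i j =>
    simp only [rename, h (Or.inl rfl : i ∈ fv (mem i j)), h (Or.inr rfl : j ∈ fv (mem i j))]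
  | conj φ ψ h₁ h₂ =>
    simp only [rename, h₁ (h.mono Set.subset_union_left), h₂ (h.mono Set.subset_union_right)]
  | disj φ ψ h₁ h₂ =>
    simp only [rename, h₁ (h.mono Set.subset_union_left), h₂ (h.mono Set.subset_union_right)]
  | imp φ ψ h₁ h₂ =>
    simp only [rename, h₁ (h.mono Set.subset_union_left), h₂ (h.mono Set.subset_union_right)]
  | all φ ih =>
    simp only [rename]
    rw [ih (ξ := lift ξ) (η := lift η)]
    rintro (_ | n) hn
    · rfl
    · exact congrArg Nat.succ (h hn)
  | ex φ ih =>
    simp only [rename]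
    rw [ih (ξ := lift ξ) (η := lift η)]
    rintro (_ | n) hn
    · rfl
    · exact congrArg Nat.succ (h hn)

theorem fv_rename_lift_aux {φ : Fml} {ξ : ℕ → ℕ}
    (h : (φ.rename (lift ξ)).fv ⊆ lift ξ '' φ.fv) :
    Nat.succ ⁻¹' (φ.rename (lift ξ)).fv ⊆ ξ '' (Nat.succ ⁻¹' φ.fv) := by
  intro n hn
  obtain ⟨m, hm, hmn⟩ := h hn
  cases m with
  | zero => exact absurd hmn (Nat.succ_ne_zero n).symm
  | succ m => exact ⟨m, hm, Nat.succ_injective hmn⟩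

theorem fv_rename (φ : Fml) (ξ : ℕ → ℕ) : (φ.rename ξ).fv ⊆ ξ '' φ.fv := by
  induction φ generalizing ξ with
  | bot => exact Set.empty_subset _
  | eq i j => simp only [rename, fv, Set.image_pair]; exact subset_rfl
  | mem i j => simp only [rename, fv, Set.image_pair]; exact subset_rfl
  | conj φ ψ h₁ h₂ =>
    simp only [rename, fv, Set.image_union]; exact Set.union_subset_union (h₁ ξ) (h₂ ξ)
  | disj φ ψ h₁ h₂ =>
    simp only [rename, fv, Set.image_union]; exact Set.union_subset_union (h₁ ξ) (h₂ ξ)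
  | imp φ ψ h₁ h₂ =>
    simp only [rename, fv, Set.image_union]; exact Set.union_subset_union (h₁ ξ) (h₂ ξ)
  | all φ h => exact fv_rename_lift_aux (h _)
  | ex φ h => exact fv_rename_lift_aux (h _)

end Fml

theorem shift_rename (φ : Fml) (ξ : ℕ → ℕ) :
    φ.shift.rename (lift ξ) = (φ.rename ξ).shift := by
  simp only [shift, rename_rename]; rfl

theorem inst_rename (φ : Fml) (ξ : ℕ → ℕ) (t : ℕ) :
    (φ.inst t).rename ξ = (φ.rename (lift ξ)).inst (ξ t) := by
  simp only [inst, rename_rename]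
  congr 1; funext n; cases n <;> rfl

theorem rename_extend (φ : Fml) (ξ : ℕ → ℕ) (t : ℕ) :
    φ.rename (extend t ξ) = (φ.rename (lift ξ)).inst t := by
  simp only [inst, rename_rename]
  congr 1; funext n; cases n <;> rfl

/-! ### Structural rules -/

namespace Derives

variable {T : Set Fml}

theorem weaken {Γ Δ : List Fml} {φ : Fml} (h : Derives T Γ φ) (hs : Γ ⊆ Δ) : Derives T Δ φ := by
  induction h generalizing Δ with
  | ax h => exact ax h
  | hyp h => exact hyp (hs h)
  | botE _ ih => exact botE (ih hs)
  | conjI _ _ h₁ h₂ => exact conjI (h₁ hs) (h₂ hs)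
  | conjE₁ _ ih => exact conjE₁ (ih hs)
  | conjE₂ _ ih => exact conjE₂ (ih hs)
  | disjI₁ _ ih => exact disjI₁ (ih hs)
  | disjI₂ _ ih => exact disjI₂ (ih hs)
  | disjE _ _ _ h₁ h₂ h₃ =>
    exact disjE (h₁ hs) (h₂ (List.cons_subset_cons _ hs)) (h₃ (List.cons_subset_cons _ hs))
  | impI _ ih => exact impI (ih (List.cons_subset_cons _ hs))
  | impE _ _ h₁ h₂ => exact impE (h₁ hs) (h₂ hs)
  | allI _ ih => exact allI (ih (List.map_subset _ hs))
  | allE t _ ih => exact allE t (ih hs)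
  | exI t _ ih => exact exI t (ih hs)
  | exE _ _ h₁ h₂ => exact exE (h₁ hs) (h₂ (List.cons_subset_cons _ (List.map_subset _ hs)))
  | eqRefl t => exact eqRefl t
  | eqSubst s t _ _ h₁ h₂ => exact eqSubst s t (h₁ hs) (h₂ hs)

theorem map_shift_rename (Γ : List Fml) (ξ : ℕ → ℕ) :
    (Γ.map shift).map (rename (lift ξ)) = (Γ.map (rename ξ)).map shift := by
  simp only [List.map_map]
  exact List.map_congr_left fun φ _ => shift_rename φ ξ

/-- Free variables of axioms count as universally quantified, so the axioms are renamed along with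
the assumptions. This is the reason for requiring `T` to be closed under renaming, here and in
everything built on it. -/
theorem rename_vars (hT : ∀ φ ∈ T, ∀ ξ, φ.rename ξ ∈ T) {Γ : List Fml} {φ : Fml}
    (h : Derives T Γ φ) (ξ : ℕ → ℕ) : Derives T (Γ.map (rename ξ)) (φ.rename ξ) := by
  induction h generalizing ξ with
  | ax h => exact ax (hT _ h ξ)
  | hyp h => exact hyp (List.mem_map_of_mem h)
  | botE _ ih => exact botE (ih ξ)
  | conjI _ _ h₁ h₂ => exact conjI (h₁ ξ) (h₂ ξ)
  | conjE₁ _ ih => exact conjE₁ (ih ξ)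
  | conjE₂ _ ih => exact conjE₂ (ih ξ)
  | disjI₁ _ ih => exact disjI₁ (ih ξ)
  | disjI₂ _ ih => exact disjI₂ (ih ξ)
  | disjE _ _ _ h₁ h₂ h₃ => exact disjE (h₁ ξ) (h₂ ξ) (h₃ ξ)
  | impI _ ih => exact impI (ih ξ)
  | impE _ _ h₁ h₂ => exact impE (h₁ ξ) (h₂ ξ)
  | allI _ ih => exact allI (map_shift_rename _ ξ ▸ ih (lift ξ))
  | allE t _ ih => exact inst_rename _ ξ t ▸ allE (ξ t) (ih ξ)
  | exI t _ ih => exact exI (ξ t) (inst_rename _ ξ t ▸ ih ξ)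
  | exE _ _ h₁ h₂ =>
    refine exE (h₁ ξ) ?_
    have := h₂ (lift ξ)
    rwa [List.map_cons, map_shift_rename, shift_rename] at this
  | eqRefl t => exact eqRefl _
  | eqSubst s t _ _ h₁ h₂ =>
    rw [inst_rename]
    exact eqSubst (ξ s) (ξ t) (h₁ ξ) (inst_rename _ ξ s ▸ h₂ ξ)

/-- Renaming that turns the variable `c` into the bound variable `0`. -/
def unfresh (c : ℕ) : ℕ → ℕ := fun v => if v = c then 0 else v + 1

theorem rename_unfresh {φ : Fml} {c : ℕ} (hc : c ∉ φ.fv) : φ.rename (unfresh c) = φ.shift :=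
  rename_congr fun v hv => if_neg fun (h : v = c) => hc (h ▸ hv)

theorem inst_rename_unfresh {φ : Fml} {c : ℕ} (hc : c ∉ (ex φ).fv) :
    (φ.inst c).rename (unfresh c) = φ := by
  rw [inst, rename_rename]
  conv_rhs => rw [← rename_id φ]
  refine rename_congr ?_
  rintro (_ | n) hn
  · simp [sub1, unfresh]
  · have : n ≠ c := fun h => hc (h ▸ hn)
    simp [sub1, unfresh, this]

theorem map_rename_unfresh {Γ : List Fml} {c : ℕ} (hc : ∀ φ ∈ Γ, c ∉ φ.fv) :
    Γ.map (rename (unfresh c)) = Γ.map shift :=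
  List.map_congr_left fun φ h => rename_unfresh (hc φ h)

/-- The primitive rule `allI` abstracts the variable `0` over a shifted context. Renaming by
`unfresh` sends a named eigenvariable to `0` and shifts all others, which gives the usual rule. -/
theorem all_of_fresh (hT : ∀ φ ∈ T, ∀ ξ, φ.rename ξ ∈ T) {Γ : List Fml} {φ : Fml} {c : ℕ}
    (h : Derives T Γ (φ.inst c)) (hΓ : ∀ ψ ∈ Γ, c ∉ ψ.fv) (hc : c ∉ (all φ).fv) :
    Derives T Γ (all φ) := by
  have := h.rename_vars hT (unfresh c)
  rw [map_rename_unfresh hΓ, inst_rename_unfresh hc] at this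
  exact allI this

theorem ex_elim_fresh (hT : ∀ φ ∈ T, ∀ ξ, φ.rename ξ ∈ T) {Γ : List Fml} {φ χ : Fml} {c : ℕ}
    (h : Derives T (φ.inst c :: Γ) χ) (he : Derives T Γ (ex φ)) (hΓ : ∀ ψ ∈ Γ, c ∉ ψ.fv)
    (hc : c ∉ (ex φ).fv) (hχ : c ∉ χ.fv) : Derives T Γ χ := by
  have := h.rename_vars hT (unfresh c)
  rw [List.map_cons, map_rename_unfresh hΓ, inst_rename_unfresh hc, rename_unfresh hχ] at this
  exact exE he this

theorem eq_symm {Γ : List Fml} {s t : ℕ} (h : Derives T Γ (eq s t)) : Derives T Γ (eq t s) :=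
  eqSubst (φ := eq 0 (s + 1)) s t h (eqRefl s)

theorem eq_trans {Γ : List Fml} {s t r : ℕ} (h : Derives T Γ (eq s t))
    (h' : Derives T Γ (eq t r)) : Derives T Γ (eq s r) :=
  eqSubst (φ := eq (s + 1) 0) t r h' h

theorem mem_congr {Γ : List Fml} {s t s' t' : ℕ} (h : Derives T Γ (eq s s'))
    (h' : Derives T Γ (eq t t')) (hm : Derives T Γ (mem s t)) : Derives T Γ (mem s' t') :=
  eqSubst (φ := mem (s' + 1) 0) t t' h' (eqSubst (φ := mem 0 (t + 1)) s s' h hm)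

end Derives

/-- Derivability from a set of assumptions. -/
def DerivesFrom (T Δ : Set Fml) (φ : Fml) : Prop :=
  ∃ Γ : List Fml, (∀ ψ ∈ Γ, ψ ∈ Δ) ∧ Derives T Γ φ

namespace DerivesFrom

variable {T Δ : Set Fml}

theorem mono {Δ' : Set Fml} {φ : Fml} (h : DerivesFrom T Δ φ) (hs : Δ ⊆ Δ') :
    DerivesFrom T Δ' φ := by
  obtain ⟨Γ, hΓ, h⟩ := h
  exact ⟨Γ, fun ψ hψ => hs (hΓ ψ hψ), h⟩

theorem of_mem {φ : Fml} (h : φ ∈ Δ) : DerivesFrom T Δ φ :=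
  ⟨[φ], by simpa using h, .hyp (by simp)⟩

theorem of_derives {φ : Fml} (h : Derives T [] φ) : DerivesFrom T Δ φ :=
  ⟨[], by simp, h⟩

theorem impI {φ ψ : Fml} (h : DerivesFrom T (insert φ Δ) ψ) : DerivesFrom T Δ (imp φ ψ) := by
  classical
  obtain ⟨Γ, hΓ, h⟩ := h
  refine ⟨Γ.filter (· ≠ φ), fun χ hχ => ?_, .impI (h.weaken fun χ hχ => ?_)⟩
  · rw [List.mem_filter] at hχ
    exact (hΓ χ hχ.1).resolve_left (by simpa using hχ.2)
  · by_cases hc : χ = φ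
    · simp [hc]
    · simp [hχ, hc]

/-- Pooling the finitely many assumptions of two derivations carries every two-premise rule that
discharges nothing over from `Derives` to `DerivesFrom`. -/
theorem lift₂ {φ ψ χ : Fml} (h₁ : DerivesFrom T Δ φ) (h₂ : DerivesFrom T Δ ψ)
    (h : ∀ Γ, Derives T Γ φ → Derives T Γ ψ → Derives T Γ χ) : DerivesFrom T Δ χ := by
  obtain ⟨Γ₁, hΓ₁, h₁⟩ := h₁
  obtain ⟨Γ₂, hΓ₂, h₂⟩ := h₂
  refine ⟨Γ₁ ++ Γ₂, fun θ hθ => ?_, h _ (h₁.weaken (by simp)) (h₂.weaken (by simp))⟩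
  exact (List.mem_append.1 hθ).elim (hΓ₁ θ) (hΓ₂ θ)

theorem lift₁ {φ χ : Fml} (h₁ : DerivesFrom T Δ φ)
    (h : ∀ Γ, Derives T Γ φ → Derives T Γ χ) : DerivesFrom T Δ χ :=
  lift₂ h₁ h₁ fun Γ d _ => h Γ d

theorem impE {φ ψ : Fml} (h₁ : DerivesFrom T Δ (imp φ ψ)) (h₂ : DerivesFrom T Δ φ) :
    DerivesFrom T Δ ψ :=
  lift₂ h₁ h₂ fun _ => Derives.impE

theorem cut {φ ψ : Fml} (h₁ : DerivesFrom T (insert φ Δ) ψ) (h₂ : DerivesFrom T Δ φ) :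
    DerivesFrom T Δ ψ :=
  impE h₁.impI h₂

theorem disjE {φ ψ χ : Fml} (h : DerivesFrom T Δ (disj φ ψ)) (h₁ : DerivesFrom T (insert φ Δ) χ)
    (h₂ : DerivesFrom T (insert ψ Δ) χ) : DerivesFrom T Δ χ := by
  refine impE (lift₁ h fun Γ d => ?_ :
    DerivesFrom T Δ (imp (imp φ χ) (imp (imp ψ χ) χ))) h₁.impI |>.impE h₂.impI
  refine .impI (.impI (.disjE (d.weaken (by simp)) ?_ ?_))
  · exact .impE (φ := φ) (.hyp (by simp)) (.hyp (by simp))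
  · exact .impE (φ := ψ) (.hyp (by simp)) (.hyp (by simp))

theorem all_of_fresh (hT : ∀ φ ∈ T, ∀ ξ, φ.rename ξ ∈ T) {φ : Fml} {c : ℕ}
    (h : DerivesFrom T Δ (φ.inst c)) (hΔ : ∀ ψ ∈ Δ, c ∉ ψ.fv) (hc : c ∉ (all φ).fv) :
    DerivesFrom T Δ (all φ) := by
  obtain ⟨Γ, hΓ, h⟩ := h
  exact ⟨Γ, hΓ, h.all_of_fresh hT (fun ψ hψ => hΔ ψ (hΓ ψ hψ)) hc⟩

theorem ex_elim_fresh (hT : ∀ φ ∈ T, ∀ ξ, φ.rename ξ ∈ T) {φ χ : Fml} {c : ℕ}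
    (h : DerivesFrom T (insert (φ.inst c) Δ) χ) (he : DerivesFrom T Δ (ex φ))
    (hΔ : ∀ ψ ∈ Δ, c ∉ ψ.fv) (hc : c ∉ (ex φ).fv) (hχ : c ∉ χ.fv) : DerivesFrom T Δ χ := by
  obtain ⟨Γ, hΓ, h⟩ := h.impI
  obtain ⟨Γ', hΓ', he⟩ := he
  have hmem : ∀ ψ ∈ Γ ++ Γ', ψ ∈ Δ := fun ψ hψ => (List.mem_append.1 hψ).elim (hΓ ψ) (hΓ' ψ)
  refine ⟨Γ ++ Γ', hmem, Derives.ex_elim_fresh hT (c := c) ?_ (he.weaken (by simp))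
    (fun ψ hψ => hΔ ψ (hmem ψ hψ)) hc hχ⟩
  exact .impE (h.weaken fun ψ hψ => by simp [hψ]) (.hyp (by simp))

end DerivesFrom

end CZF

namespace CZF

open Fml

/-! ### Completeness for Kripke models -/

/-- A countable supply of variables, split into infinitely many infinite levels: the variables of
level less than `n`. -/
def varsBelow (n : ℕ) : Set ℕ := {v | v.unpair.1 < n}

theorem varsBelow_mono {m n : ℕ} (h : m ≤ n) : varsBelow m ⊆ varsBelow n :=
  fun _ hv => lt_of_lt_of_le hv h

theorem pair_mem_varsBelow {m n k : ℕ} : Nat.pair m k ∈ varsBelow n ↔ m < n := by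
  simp [varsBelow]

/-- A saturated theory: closed under deduction in the language with free variables below a level,
consistent, with the disjunction property and with witnesses for existential formulas. -/
structure PrimeTheory (T : Set Fml) (n : ℕ) (Δ : Set Fml) : Prop where
  fv_subset : ∀ φ ∈ Δ, φ.fv ⊆ varsBelow n
  mem_of_derives : ∀ φ : Fml, φ.fv ⊆ varsBelow n → DerivesFrom T Δ φ → φ ∈ Δ
  bot_notMem : bot ∉ Δ
  prime : ∀ φ ψ : Fml, disj φ ψ ∈ Δ → φ ∈ Δ ∨ ψ ∈ Δ
  witness : ∀ φ : Fml, ex φ ∈ Δ → ∃ c ∈ varsBelow n, φ.inst c ∈ Δ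

/-! ### Extension of a theory to a saturated one -/

section Lindenbaum

/-- Formulas as terms of a countable type. -/
def code : Fml → ℕ
  | bot => Nat.pair 0 0
  | eq i j => Nat.pair 1 (Nat.pair i j)
  | mem i j => Nat.pair 2 (Nat.pair i j)
  | conj φ ψ => Nat.pair 3 (Nat.pair (code φ) (code ψ))
  | disj φ ψ => Nat.pair 4 (Nat.pair (code φ) (code ψ))
  | imp φ ψ => Nat.pair 5 (Nat.pair (code φ) (code ψ))
  | all φ => Nat.pair 6 (code φ)
  | ex φ => Nat.pair 7 (code φ)

theorem code_injective : Function.Injective code := by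
  intro φ
  induction φ with
  | bot => intro ψ h; cases ψ <;> simp_all [code]
  | eq i j => intro ψ h; cases ψ <;> simp_all [code]
  | mem i j => intro ψ h; cases ψ <;> simp_all [code]
  | conj φ φ' h₁ h₂ =>
    intro ψ h; cases ψ <;> simp [code] at h
    exact congrArg₂ conj (h₁ h.1) (h₂ h.2)
  | disj φ φ' h₁ h₂ =>
    intro ψ h; cases ψ <;> simp [code] at h
    exact congrArg₂ disj (h₁ h.1) (h₂ h.2)
  | imp φ φ' h₁ h₂ =>
    intro ψ h; cases ψ <;> simp [code] at h
    exact congrArg₂ imp (h₁ h.1) (h₂ h.2)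
  | all φ h₁ =>
    intro ψ h; cases ψ <;> simp [code] at h
    exact congrArg all (h₁ h)
  | ex φ h₁ =>
    intro ψ h; cases ψ <;> simp [code] at h
    exact congrArg ex (h₁ h)

theorem exists_enumeration : ∃ f : ℕ → Fml, Function.Surjective f := by
  have : Countable Fml := code_injective.countable
  have : Nonempty Fml := ⟨bot⟩
  exact exists_surjective_nat Fml

variable {T : Set Fml} {n : ℕ} {Γ : Set Fml} {χ : Fml}

theorem exists_fresh (n : ℕ) {L : Set Fml} (hL : L.Finite) :
    ∃ k, ∀ φ ∈ L, Nat.pair n k ∉ φ.fv := by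
  have hfin : (⋃ φ ∈ L, φ.fv).Finite := hL.biUnion fun φ _ => finite_fv φ
  have hinj : Function.Injective (Nat.pair n) := fun a b h => (Nat.pair_eq_pair.1 h).2
  obtain ⟨k, hk⟩ := (hfin.preimage hinj.injOn).exists_notMem
  exact ⟨k, fun φ hφ hk' => hk (Set.mem_biUnion hφ hk')⟩

/-- One stage of the construction of a saturated theory: either the formula `φ` would make `χ`
derivable, or it is added together with a witness. -/
theorem exists_stage (hT : ∀ φ ∈ T, ∀ ξ, φ.rename ξ ∈ T) (hΓ : ∀ φ ∈ Γ, φ.fv ⊆ varsBelow n)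
    (hχ : χ.fv ⊆ varsBelow n) (φ : Fml) (hφ : φ.fv ⊆ varsBelow (n + 1))
    (L : Set Fml) (hL : L.Finite) (hLv : ∀ φ ∈ L, φ.fv ⊆ varsBelow (n + 1))
    (hc : ¬ DerivesFrom T (Γ ∪ L) χ) :
    ∃ L' : Set Fml, L ⊆ L' ∧ L'.Finite ∧ (∀ φ ∈ L', φ.fv ⊆ varsBelow (n + 1)) ∧
      ¬ DerivesFrom T (Γ ∪ L') χ ∧
      (DerivesFrom T (insert φ (Γ ∪ L)) χ ∨
        φ ∈ L' ∧ ∀ ψ, φ = ex ψ → ∃ c ∈ varsBelow (n + 1), ψ.inst c ∈ L') := by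
  by_cases h : DerivesFrom T (insert φ (Γ ∪ L)) χ
  · exact ⟨L, subset_rfl, hL, hLv, hc, Or.inl h⟩
  by_cases hex : ∃ ψ, φ = ex ψ
  · obtain ⟨ψ, rfl⟩ := hex
    -- The witness is a variable of level exactly `n`: it cannot occur in `Γ` or `χ`, whose
    -- variables have smaller level, and its index `k` avoids the finitely many formulas added so
    -- far.
    obtain ⟨k, hk⟩ := exists_fresh n (hL.insert (ex ψ))
    have hfr : ∀ θ : Fml, θ.fv ⊆ varsBelow n → Nat.pair n k ∉ θ.fv := fun θ hθ hm =>
      lt_irrefl n (pair_mem_varsBelow.1 (hθ hm))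
    refine ⟨insert (ψ.inst (Nat.pair n k)) (insert (ex ψ) L), fun θ hθ => Or.inr (Or.inr hθ),
      (hL.insert _).insert _, ?_, ?_, Or.inr ⟨Or.inr (Or.inl rfl), ?_⟩⟩
    · rintro θ (rfl | rfl | hθ)
      · intro v hv
        obtain ⟨m, hm, rfl⟩ := fv_rename _ _ hv
        cases m with
        | zero => exact pair_mem_varsBelow.2 n.lt_succ_self
        | succ m => exact hφ hm
      · exact hφ
      · exact hLv θ hθ
    · intro hd
      refine h (DerivesFrom.ex_elim_fresh hT (c := Nat.pair n k) (φ := ψ) (hd.mono ?_)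
        (.of_mem (Or.inl rfl)) ?_ (hk _ (Or.inl rfl)) (hfr _ hχ))
      · rintro θ (hθ | rfl | rfl | hθ) <;> simp_all
      · rintro θ (rfl | hθ | hθ)
        · exact hk _ (Or.inl rfl)
        · exact hfr θ (hΓ θ hθ)
        · exact hk θ (Or.inr hθ)
    · intro ψ' hψ'
      obtain rfl : ψ = ψ' := by injection hψ'
      exact ⟨_, pair_mem_varsBelow.2 n.lt_succ_self, Or.inl rfl⟩
  · refine ⟨insert φ L, Set.subset_insert _ _, hL.insert _, ?_, ?_, Or.inr ⟨Or.inl rfl, ?_⟩⟩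
    · rintro θ (rfl | hθ)
      · exact hφ
      · exact hLv θ hθ
    · rwa [Set.union_insert]
    · exact fun ψ hψ => absurd ⟨ψ, hψ⟩ hex

/-- Henkin's construction along an enumeration of all formulas: a formula is added whenever `χ`
stays underivable, together with a witness if it is existential. Only finitely many formulas have
been added at each stage, so the variables of level `n` never run out. -/
theorem exists_primeTheory (hT : ∀ φ ∈ T, ∀ ξ, φ.rename ξ ∈ T)
    (hΓ : ∀ φ ∈ Γ, φ.fv ⊆ varsBelow n) (hχ : χ.fv ⊆ varsBelow n) (hc : ¬ DerivesFrom T Γ χ) :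
    ∃ Δ, PrimeTheory T (n + 1) Δ ∧ Γ ⊆ Δ ∧ χ ∉ Δ := by
  classical
  obtain ⟨f, hf⟩ := exists_enumeration
  let Good := {L : Set Fml // L.Finite ∧ (∀ φ ∈ L, φ.fv ⊆ varsBelow (n + 1)) ∧
    ¬ DerivesFrom T (Γ ∪ L) χ}
  have step : ∀ (φ : Fml) (L : Good), ∃ L' : Good, L.1 ⊆ L'.1 ∧ (φ.fv ⊆ varsBelow (n + 1) →
      DerivesFrom T (insert φ (Γ ∪ L.1)) χ ∨
        φ ∈ L'.1 ∧ ∀ ψ, φ = ex ψ → ∃ c ∈ varsBelow (n + 1), ψ.inst c ∈ L'.1) := by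
    intro φ L
    by_cases hφ : φ.fv ⊆ varsBelow (n + 1)
    · obtain ⟨L', h₁, h₂, h₃, h₄, h₅⟩ := exists_stage hT hΓ hχ φ hφ L.1 L.2.1 L.2.2.1 L.2.2.2
      exact ⟨⟨L', h₂, h₃, h₄⟩, h₁, fun _ => h₅⟩
    · exact ⟨L, subset_rfl, fun h => absurd h hφ⟩
  choose next hsub hnext using step
  let L₀ : Good := ⟨∅, Set.finite_empty, by simp, by simpa using hc⟩
  let seq : ℕ → Good := fun k => Nat.rec L₀ (fun k L => next (f k) L) k
  have hmono : Monotone fun k => (seq k).1 := monotone_nat_of_le_succ fun k => hsub (f k) (seq k)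
  let Δ : Set Fml := Γ ∪ ⋃ k, (seq k).1
  have hle : ∀ k, Γ ∪ (seq k).1 ⊆ Δ := fun k =>
    Set.union_subset_union_right _ (Set.subset_iUnion (fun k => (seq k).1) k)
  have hcons : ¬ DerivesFrom T Δ χ := by
    rintro ⟨Θ, hΘ, hd⟩
    have : ∃ k, ∀ ψ ∈ Θ, ψ ∈ Γ ∪ (seq k).1 := by
      clear hd
      induction Θ with
      | nil => exact ⟨0, by simp⟩
      | cons θ Θ ih =>
        obtain ⟨k, hk⟩ := ih fun ψ hψ => hΘ ψ (List.mem_cons_of_mem _ hψ)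
        obtain ⟨l, hl⟩ : ∃ l, θ ∈ Γ ∪ (seq l).1 := by
          rcases hΘ θ (List.mem_cons_self) with h | h
          · exact ⟨0, Or.inl h⟩
          · obtain ⟨l, hl⟩ := Set.mem_iUnion.1 h
            exact ⟨l, Or.inr hl⟩
        refine ⟨max k l, fun ψ hψ => ?_⟩
        rcases List.mem_cons.1 hψ with rfl | hψ
        · exact Set.union_subset_union_right _ (hmono (le_max_right k l)) hl
        · exact Set.union_subset_union_right _ (hmono (le_max_left k l)) (hk ψ hψ)
    obtain ⟨k, hk⟩ := this
    exact (seq k).2.2.2 ⟨Θ, hk, hd⟩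
  -- Each formula over the permitted variables either makes `χ` derivable or was added at its own
  -- stage. Deductive closure, primeness and witnesses all follow from this dichotomy.
  have hdec : ∀ φ : Fml, φ.fv ⊆ varsBelow (n + 1) → DerivesFrom T (insert φ Δ) χ ∨
      φ ∈ Δ ∧ ∀ ψ, φ = ex ψ → ∃ c ∈ varsBelow (n + 1), ψ.inst c ∈ Δ := by
    intro φ hφ
    obtain ⟨k, rfl⟩ := hf φ
    rcases hnext (f k) (seq k) hφ with h | ⟨h₁, h₂⟩
    · exact Or.inl (h.mono (Set.insert_subset_insert (hle k)))
    · refine Or.inr ⟨hle (k + 1) (Or.inr h₁), fun ψ hψ => ?_⟩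
      obtain ⟨c, hc, h⟩ := h₂ ψ hψ
      exact ⟨c, hc, hle (k + 1) (Or.inr h)⟩
  have hfv : ∀ φ ∈ Δ, φ.fv ⊆ varsBelow (n + 1) := by
    rintro φ (h | h)
    · exact (hΓ φ h).trans (varsBelow_mono n.le_succ)
    · obtain ⟨k, hk⟩ := Set.mem_iUnion.1 h
      exact (seq k).2.2.1 φ hk
  refine ⟨Δ, ⟨hfv, ?_, ?_, ?_, ?_⟩, Set.subset_union_left, fun h => hcons (.of_mem h)⟩
  · intro φ hφ hd
    rcases hdec φ hφ with h | h
    · exact absurd (h.cut hd) hcons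
    · exact h.1
  · exact fun h => hcons ((DerivesFrom.of_mem h).lift₁ fun _ d => .botE d)
  · intro φ ψ h
    have hv := hfv _ h
    by_contra! hn
    have h₁ := (hdec φ (Set.subset_union_left.trans hv)).resolve_right fun h => hn.1 h.1
    have h₂ := (hdec ψ (Set.subset_union_right.trans hv)).resolve_right fun h => hn.2 h.1
    exact hcons ((DerivesFrom.of_mem h).disjE h₁ h₂)
  · intro φ h
    rcases hdec _ (hfv _ h) with hd | hd
    · exact absurd (hd.cut (.of_mem h)) hcons
    · exact hd.2 φ rfl

end Lindenbaum

/-- The nodes of the canonical model. -/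
structure CanonicalNode (T : Set Fml) where
  /-- the level of the variables -/
  level : ℕ
  /-- the theory -/
  theory : Set Fml
  isPrime : PrimeTheory T level theory

namespace CanonicalNode

variable {T : Set Fml}

instance : PartialOrder (CanonicalNode T) where
  le P Q := P.level ≤ Q.level ∧ P.theory ⊆ Q.theory
  le_refl P := ⟨le_rfl, subset_rfl⟩
  le_trans P Q R h k := ⟨h.1.trans k.1, h.2.trans k.2⟩
  le_antisymm P Q h k := by
    cases P; cases Q
    obtain rfl := le_antisymm h.1 k.1
    obtain rfl := Set.Subset.antisymm h.2 k.2
    rfl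

/-- The variables of a node, those provably equal being identified. -/
instance varSetoid (P : CanonicalNode T) : Setoid (varsBelow P.level) where
  r a b := DerivesFrom T P.theory (eq a b)
  iseqv :=
    { refl := fun a => .of_derives (.eqRefl a.1)
      symm := fun h => h.lift₁ fun _ => Derives.eq_symm
      trans := fun h k => h.lift₂ k fun _ => Derives.eq_trans }

/-- The domain of a node. -/
abbrev Dom (P : CanonicalNode T) : Type := Quotient P.varSetoid

/-- The transition functions. -/
def trans {P Q : CanonicalNode T} (h : P ≤ Q) : P.Dom → Q.Dom :=
  Quotient.map (fun a => ⟨a.1, varsBelow_mono h.1 a.2⟩) fun _ _ hab => hab.mono h.2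

/-- Membership at a node. -/
def Mem (P : CanonicalNode T) : P.Dom → P.Dom → Prop :=
  Quotient.lift₂ (fun a b => DerivesFrom T P.theory (mem a b)) fun a₁ b₁ a₂ b₂ ha hb => by
    refine propext ⟨fun h => ?_, fun h => ?_⟩
    · exact (ha.lift₂ hb fun Γ h₁ h₂ => .conjI h₁ h₂).lift₂ h fun Γ h₁ h₂ =>
        .mem_congr h₁.conjE₁ h₁.conjE₂ h₂
    · exact (ha.lift₂ hb fun Γ h₁ h₂ => .conjI h₁ h₂).lift₂ h fun Γ h₁ h₂ =>
        .mem_congr h₁.conjE₁.eq_symm h₁.conjE₂.eq_symm h₂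

/-- The derivable formula `∃ x, x = x` needs a witness among the variables of the node. Hence the
domains of the canonical model are nonempty. -/
theorem level_pos (P : CanonicalNode T) : 0 < P.level := by
  have h : ex (eq 0 0) ∈ P.theory :=
    P.isPrime.mem_of_derives _ (by rintro v (h | h) <;> cases h) (.of_derives (.exI 0 (.eqRefl 0)))
  obtain ⟨c, hc, -⟩ := P.isPrime.witness _ h
  exact lt_of_le_of_lt (Nat.zero_le _) hc

end CanonicalNode

/-- The canonical model. -/
def canonicalModel (T : Set Fml) [Nonempty (CanonicalNode T)] : KripkeModel.{0, 0} where
  Node := CanonicalNode T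
  Dom := CanonicalNode.Dom
  dom_nonempty P := ⟨⟦⟨Nat.pair 0 0, pair_mem_varsBelow.2 P.level_pos⟩⟧⟩
  map := CanonicalNode.trans
  map_refl P x := by induction x using Quotient.inductionOn; rfl
  map_map h k x := by induction x using Quotient.inductionOn; rfl
  Mem := CanonicalNode.Mem
  mem_map h x y := by
    induction x using Quotient.inductionOn
    induction y using Quotient.inductionOn
    exact fun hm => hm.mono h.2

/-! ### The truth lemma for the canonical model -/

section Truth

variable {T : Set Fml}

/-- The assignment given by a renaming. -/
def CanonicalNode.assign (P : CanonicalNode T) (ξ : ℕ → varsBelow P.level) : ℕ → P.Dom :=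
  fun n => ⟦ξ n⟧

theorem CanonicalNode.exists_assign (P : CanonicalNode T) (e : ℕ → P.Dom) :
    ∃ ξ, e = P.assign ξ :=
  ⟨fun n => (e n).out, funext fun n => (Quotient.out_eq (e n)).symm⟩

theorem CanonicalNode.extend_assign (P : CanonicalNode T) (c : varsBelow P.level)
    (ξ : ℕ → varsBelow P.level) :
    extend (⟦c⟧ : P.Dom) (P.assign ξ) = P.assign (extend c ξ) := by
  funext n; cases n <;> rfl

theorem rename_extend_val {n : ℕ} (φ : Fml) (c : varsBelow n) (ξ : ℕ → varsBelow n) :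
    φ.rename (fun k => (extend c ξ k).1) = (φ.rename (lift fun k => (ξ k).1)).inst c := by
  rw [← rename_extend]
  congr 1; funext k; cases k <;> rfl

theorem fv_rename_val {n : ℕ} (φ : Fml) (ξ : ℕ → varsBelow n) :
    (φ.rename fun k => (ξ k).1).fv ⊆ varsBelow n := by
  intro v hv
  obtain ⟨k, -, rfl⟩ := fv_rename _ _ hv
  exact (ξ k).2

theorem PrimeTheory.mem_iff {n : ℕ} {Δ : Set Fml} (h : PrimeTheory T n Δ) (φ : Fml)
    (ξ : ℕ → varsBelow n) :
    φ.rename (fun k => (ξ k).1) ∈ Δ ↔ DerivesFrom T Δ (φ.rename fun k => (ξ k).1) :=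
  ⟨.of_mem, h.mem_of_derives _ (fv_rename_val φ ξ)⟩

/-- Satisfaction is membership in the theory of the node. If an implication or a universal formula
is not in the theory, a later node refutes it: adjoin the premise, or instantiate at a fresh
variable, and saturate while keeping the conclusion out. -/
theorem canonicalModel_sat [Nonempty (CanonicalNode T)] (hT : ∀ φ ∈ T, ∀ ξ, φ.rename ξ ∈ T) (φ : Fml) (P : CanonicalNode T)
    (ξ : ℕ → varsBelow P.level) :
    (canonicalModel T).Sat φ P (P.assign ξ) ↔ φ.rename (fun k => (ξ k).1) ∈ P.theory := by
  induction φ generalizing P with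
  | bot => exact ⟨False.elim, P.isPrime.bot_notMem⟩
  | eq i j =>
    rw [P.isPrime.mem_iff]
    exact Quotient.eq (r := P.varSetoid)
  | mem i j => rw [P.isPrime.mem_iff]; exact Iff.rfl
  | conj φ ψ h₁ h₂ =>
    refine (and_congr (h₁ P ξ) (h₂ P ξ)).trans ?_
    simp only [P.isPrime.mem_iff]
    exact ⟨fun h => h.1.lift₂ h.2 fun _ => .conjI,
      fun h => ⟨h.lift₁ fun _ => .conjE₁, h.lift₁ fun _ => .conjE₂⟩⟩
  | disj φ ψ h₁ h₂ =>
    refine (or_congr (h₁ P ξ) (h₂ P ξ)).trans ⟨?_, P.isPrime.prime _ _⟩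
    simp only [P.isPrime.mem_iff]
    rintro (h | h)
    · exact h.lift₁ fun _ => .disjI₁
    · exact h.lift₁ fun _ => .disjI₂
  | imp φ ψ h₁ h₂ =>
    constructor
    · intro h
      rw [P.isPrime.mem_iff]
      refine DerivesFrom.impI (by_contra fun hc => ?_)
      obtain ⟨Δ, hΔ, hs, hn⟩ := exists_primeTheory hT (n := P.level) (by
        rintro θ (rfl | hθ)
        · exact fv_rename_val φ ξ
        · exact P.isPrime.fv_subset θ hθ) (fv_rename_val ψ ξ) hc
      let Q : CanonicalNode T := ⟨_, Δ, hΔ⟩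
      have hPQ : P ≤ Q := ⟨Nat.le_succ _, (Set.subset_insert _ _).trans hs⟩
      let ξ' : ℕ → varsBelow Q.level := fun k => ⟨(ξ k).1, varsBelow_mono hPQ.1 (ξ k).2⟩
      exact hn ((h₂ Q ξ').1 (h Q hPQ ((h₁ Q ξ').2 (hs (Or.inl rfl)))))
    · intro h Q hPQ hφ
      let ξ' : ℕ → varsBelow Q.level := fun k => ⟨(ξ k).1, varsBelow_mono hPQ.1 (ξ k).2⟩
      refine (h₂ Q ξ').2 ((Q.isPrime.mem_iff ψ ξ').2 ?_)
      exact (DerivesFrom.of_mem (hPQ.2 h)).impE (.of_mem ((h₁ Q ξ').1 hφ))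
  | all φ ih =>
    constructor
    · intro h
      rw [P.isPrime.mem_iff]
      by_contra hc
      have hfr : ∀ θ : Fml, θ.fv ⊆ varsBelow P.level → Nat.pair P.level 0 ∉ θ.fv := fun θ hθ hm =>
        lt_irrefl _ (pair_mem_varsBelow.1 (hθ hm))
      have hn : ¬ DerivesFrom T P.theory
          ((φ.rename (lift fun k => (ξ k).1)).inst (Nat.pair P.level 0)) := fun hd =>
        hc (hd.all_of_fresh hT (fun θ hθ => hfr θ (P.isPrime.fv_subset θ hθ))
          (hfr _ (fv_rename_val (all φ) ξ)))
      let c : varsBelow (P.level + 1) :=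
        ⟨Nat.pair P.level 0, pair_mem_varsBelow.2 (Nat.lt_succ_self _)⟩
      let ξ₁ : ℕ → varsBelow (P.level + 1) :=
        fun k => ⟨(ξ k).1, varsBelow_mono (Nat.le_succ _) (ξ k).2⟩
      have hv := fv_rename_val φ (extend c ξ₁)
      rw [rename_extend_val] at hv
      -- The level rises by two: one level for the eigenvariable, one for the witnesses of the
      -- saturated extension.
      obtain ⟨Δ, hΔ, hs, hn⟩ := exists_primeTheory hT (n := P.level + 1)
        (fun θ hθ => (P.isPrime.fv_subset θ hθ).trans (varsBelow_mono (Nat.le_succ _))) hv hn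
      let Q : CanonicalNode T := ⟨_, Δ, hΔ⟩
      have hPQ : P ≤ Q := ⟨Nat.le_add_right _ 2, hs⟩
      let c' : varsBelow Q.level := ⟨c.1, varsBelow_mono (Nat.le_succ _) c.2⟩
      let ξ' : ℕ → varsBelow Q.level := fun k => ⟨(ξ k).1, varsBelow_mono hPQ.1 (ξ k).2⟩
      have := h Q hPQ (⟦c'⟧ : Q.Dom)
      have h' := (ih Q (extend c' ξ')).1 (Q.extend_assign c' ξ' ▸ this)
      rw [rename_extend_val] at h'
      exact hn h'
    · intro h Q hPQ d
      induction d using Quotient.inductionOn with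
      | h c =>
        let ξ' : ℕ → varsBelow Q.level := fun k => ⟨(ξ k).1, varsBelow_mono hPQ.1 (ξ k).2⟩
        have := (ih Q (extend c ξ')).2 (by
          rw [Q.isPrime.mem_iff, rename_extend_val]
          exact (DerivesFrom.of_mem (hPQ.2 h)).lift₁ fun _ => .allE _)
        rw [← Q.extend_assign] at this
        exact this
  | ex φ ih =>
    constructor
    · rintro ⟨d, hd⟩
      induction d using Quotient.inductionOn with
      | h c =>
        have hd' := (ih P (extend c ξ)).1 (P.extend_assign c ξ ▸ hd)
        rw [P.isPrime.mem_iff, rename_extend_val] at hd'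
        rw [P.isPrime.mem_iff]
        exact hd'.lift₁ fun _ => .exI _
    · intro h
      obtain ⟨c, hc, h⟩ := P.isPrime.witness _ h
      refine ⟨(⟦⟨c, hc⟩⟧ : P.Dom), ?_⟩
      have := (ih P (extend ⟨c, hc⟩ ξ)).2 (by rwa [rename_extend_val])
      rw [← P.extend_assign] at this
      exact this

end Truth

/-- Completeness of intuitionistic logic for Kripke models. -/
theorem exists_countermodel {T : Set Fml} (hT : ∀ φ ∈ T, ∀ ξ, φ.rename ξ ∈ T) {φ : Fml}
    (h : ¬ Proves T φ) :
    ∃ M : KripkeModel.{0, 0}, (∀ ψ ∈ T, M.Models ψ) ∧ ¬ M.Models φ := by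
  -- All variables of `φ` are moved injectively into level `0`, which leaves the higher levels for
  -- witnesses; the second component of `Nat.unpair` moves them back.
  let ξ : ℕ → varsBelow 1 := fun k => ⟨Nat.pair 0 k, pair_mem_varsBelow.2 Nat.one_pos⟩
  have hn : ¬ DerivesFrom T ∅ (φ.rename fun k => (ξ k).1) := by
    rintro ⟨Γ, hΓ, hd⟩
    obtain rfl : Γ = [] := List.eq_nil_iff_forall_not_mem.2 hΓ
    have := hd.rename_vars hT fun v => v.unpair.2
    rw [rename_rename] at this
    have hid : ((fun v : ℕ => v.unpair.2) ∘ fun k => (ξ k).1) = id := by funext k; simp [ξ]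
    rw [hid, rename_id] at this
    exact h this
  obtain ⟨Δ, hΔ, -, hφ⟩ := exists_primeTheory hT (n := 1) (by simp) (fv_rename_val φ ξ) hn
  let P : CanonicalNode T := ⟨_, Δ, hΔ⟩
  have : Nonempty (CanonicalNode T) := ⟨P⟩
  refine ⟨canonicalModel T, fun ψ hψ Q e => ?_, fun hM => ?_⟩
  · obtain ⟨η, rfl⟩ := Q.exists_assign e
    exact (canonicalModel_sat hT ψ Q η).2
      ((Q.isPrime.mem_iff ψ η).2 (.of_derives (.ax (hT ψ hψ _))))
  · let ξ' : ℕ → varsBelow P.level := fun k => ⟨(ξ k).1, varsBelow_mono (Nat.le_succ _) (ξ k).2⟩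
    exact hφ ((canonicalModel_sat hT φ P ξ').1 (hM P (P.assign ξ')))

/-! ### Change of universe levels -/

namespace KripkeModel

universe u v u' v'

/-- A Kripke model moved to larger universes. -/
def ulift (M : KripkeModel.{u, v}) : KripkeModel.{max u u', max v v'} where
  Node := ULift.{u'} M.Node
  order := PartialOrder.lift ULift.down ULift.down_injective
  Dom p := ULift.{v'} (M.Dom p.down)
  map h x := ⟨M.map h x.down⟩
  map_refl p x := congrArg ULift.up (M.map_refl p.down x.down)
  map_map h k x := congrArg ULift.up (M.map_map h k x.down)
  Mem p x y := M.Mem p.down x.down y.down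
  mem_map h x y := M.mem_map h x.down y.down

theorem ulift_sat (M : KripkeModel.{u, v}) (φ : Fml) (p : M.Node) (e : ℕ → M.Dom p) :
    (ulift.{u, v, u', v'} M).Sat φ ⟨p⟩ (fun n => ⟨e n⟩) ↔ M.Sat φ p e := by
  have hext : ∀ {q : M.Node} (d : M.Dom q) (e : ℕ → M.Dom q),
      (extend ⟨d⟩ fun n => ⟨e n⟩ : ℕ → ULift.{v'} (M.Dom q)) = fun n => ⟨extend d e n⟩ := by
    intro q d _; funext n; cases n <;> rfl
  induction φ generalizing p with
  | bot => exact Iff.rfl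
  | eq i j => exact ULift.up_injective.eq_iff
  | mem i j => exact Iff.rfl
  | conj φ ψ h₁ h₂ => exact and_congr (h₁ p e) (h₂ p e)
  | disj φ ψ h₁ h₂ => exact or_congr (h₁ p e) (h₂ p e)
  | imp φ ψ h₁ h₂ =>
    exact ⟨fun h q hpq hφ => (h₂ q _).1 (h ⟨q⟩ hpq ((h₁ q _).2 hφ)),
      fun h q hpq hφ => (h₂ q.down _).2 (h q.down hpq ((h₁ q.down _).1 hφ))⟩
  | all φ ih =>
    refine ⟨fun h q hpq d => (ih q _).1 ?_, fun h q hpq d => ?_⟩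
    · rw [← hext]; exact h ⟨q⟩ hpq ⟨d⟩
    · have := (ih q.down _).2 (h q.down hpq d.down)
      rw [← hext] at this; exact this
  | ex φ ih =>
    refine ⟨fun ⟨d, hd⟩ => ⟨d.down, (ih p _).1 ?_⟩, fun ⟨d, hd⟩ => ⟨⟨d⟩, ?_⟩⟩
    · rw [← hext]; exact hd
    · have := (ih p _).2 hd
      rw [← hext] at this; exact this

theorem ulift_models {M : KripkeModel.{u, v}} {φ : Fml} (h : M.Models φ) :
    (ulift.{u, v, u', v'} M).Models φ := fun p _ => (M.ulift_sat φ p.down _).2 (h _ _)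

end KripkeModel

end CZF

namespace CZF

open Fml Topology Filter TopologicalSpace

/-! ### Names over the real line

A name is a set that varies over the real line and may jump when the variable point settles. -/

/-- Names. The element `elt i` belongs to the name over the open set `opn i`; when the variable
point settles at `r`, the elements of `st r` are added. -/
inductive Name : Type 1
  | mk (I : Type) (elt : I → Name) (opn : I → Opens ℝ) (st : ℝ → ZFSet.{0}) : Name

namespace Name

/-- The index type of the varying elements. -/
def Idx : Name → Type
  | mk I _ _ _ => I

/-- The varying elements. -/
def elt : (σ : Name) → σ.Idx → Name
  | mk _ a _ _ => a

/-- The open set over which a varying element belongs to the name. -/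
def opn : (σ : Name) → σ.Idx → Opens ℝ
  | mk _ _ U _ => U

/-- The elements added when the point settles. -/
def st : Name → ℝ → ZFSet.{0}
  | mk _ _ _ s => s

/-- The set that a name becomes when the point settles at `r`. -/
noncomputable def settle : Name → ℝ → ZFSet.{0}
  | mk I a U s, r => s r ∪ ZFSet.range fun i : {i : I // r ∈ U i} => settle (a i.1) r

theorem mem_settle {σ : Name} {r : ℝ} {c : ZFSet.{0}} :
    c ∈ σ.settle r ↔ c ∈ σ.st r ∨ ∃ i, r ∈ σ.opn i ∧ (σ.elt i).settle r = c := by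
  cases σ
  simp only [settle, ZFSet.mem_union, ZFSet.mem_range, Subtype.exists, exists_prop]
  rfl

/-- The constant name of a set. -/
noncomputable def check (x : ZFSet.{0}) : Name :=
  -- The elements of a set form a small type in a higher universe; `Shrink` supplies the index type
  -- in `Type` that a name requires.
  mk (Shrink.{0} {y // y ∈ x}) (fun i => check ((equivShrink _).symm i).1) (fun _ => ⊤)
    (fun _ => ∅)
termination_by x
decreasing_by exact ((equivShrink _).symm i).2

theorem exists_idx_check {x : ZFSet.{0}} {P : Name → Prop} {r : ℝ} :
    (∃ i, r ∈ (check x).opn i ∧ P ((check x).elt i)) ↔ ∃ y ∈ x, P (check y) := by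
  rw [check]
  constructor
  · rintro ⟨i, -, h⟩
    exact ⟨_, ((equivShrink _).symm i).2, h⟩
  · rintro ⟨y, hy, h⟩
    refine ⟨equivShrink _ ⟨y, hy⟩, trivial, ?_⟩
    simpa [elt] using h

theorem st_check (x : ZFSet.{0}) (r : ℝ) : (check x).st r = ∅ := by
  rw [check]; rfl

@[simp]
theorem settle_check (x : ZFSet.{0}) (r : ℝ) : (check x).settle r = x := by
  induction x using ZFSet.inductionOn with
  | _ x ih =>
    ext c
    rw [mem_settle, st_check, exists_idx_check (P := fun n => n.settle r = c)]
    constructor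
    · rintro (h | ⟨y, hy, rfl⟩)
      · exact absurd h (ZFSet.notMem_empty c)
      · rwa [ih y hy]
    · exact fun h => Or.inr ⟨c, h, ih c h⟩

/-- Equality of names near a point. -/
def Eqv : Name → Name → ℝ → Prop
  | mk I a U s, mk J b V t, x => ∀ᶠ y in 𝓝 x, settle (mk I a U s) y = settle (mk J b V t) y ∧
      (∀ i, y ∈ U i → ∃ j, y ∈ V j ∧ Eqv (a i) (b j) y) ∧
      ∀ j, y ∈ V j → ∃ i, y ∈ U i ∧ Eqv (a i) (b j) y

/-- Membership of names at a point. -/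
def Mem (σ τ : Name) (x : ℝ) : Prop := ∃ j, x ∈ τ.opn j ∧ Eqv σ (τ.elt j) x

theorem eqv_iff_aux {σ τ : Name} {x : ℝ} : Eqv σ τ x ↔ ∀ᶠ y in 𝓝 x, σ.settle y = τ.settle y ∧
    (∀ i, y ∈ σ.opn i → ∃ j, y ∈ τ.opn j ∧ Eqv (σ.elt i) (τ.elt j) y) ∧
      ∀ j, y ∈ τ.opn j → ∃ i, y ∈ σ.opn i ∧ Eqv (σ.elt i) (τ.elt j) y := by
  cases σ; cases τ
  rw [Eqv]; rfl

theorem Eqv.eventually {σ τ : Name} {x : ℝ} (h : Eqv σ τ x) : ∀ᶠ y in 𝓝 x, Eqv σ τ y := by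
  rw [eqv_iff_aux] at h
  filter_upwards [h.eventually_nhds] with y hy using eqv_iff_aux.2 hy

theorem Eqv.settle_eq {σ τ : Name} {x : ℝ} (h : Eqv σ τ x) : σ.settle x = τ.settle x :=
  (eqv_iff_aux.1 h).self_of_nhds.1

theorem Eqv.refl (σ : Name) (x : ℝ) : Eqv σ σ x := by
  induction σ generalizing x with
  | mk I a U s ih =>
    exact eqv_iff_aux.2 (.of_forall fun y =>
      ⟨rfl, fun i hi => ⟨i, hi, ih i y⟩, fun i hi => ⟨i, hi, ih i y⟩⟩)

theorem Eqv.symm {σ τ : Name} {x : ℝ} (h : Eqv σ τ x) : Eqv τ σ x := by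
  induction σ generalizing τ x with
  | mk I a U s ih =>
    rw [eqv_iff_aux] at h ⊢
    filter_upwards [h] with y hy
    refine ⟨hy.1.symm, fun j hj => ?_, fun i hi => ?_⟩
    · obtain ⟨i, hi, h⟩ := hy.2.2 j hj
      exact ⟨i, hi, ih i h⟩
    · obtain ⟨j, hj, h⟩ := hy.2.1 i hi
      exact ⟨j, hj, ih i h⟩

theorem Eqv.trans {σ τ ρ : Name} {x : ℝ} (h : Eqv σ τ x) (h' : Eqv τ ρ x) : Eqv σ ρ x := by
  induction σ generalizing τ ρ x with
  | mk I a U s ih =>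
    rw [eqv_iff_aux] at h h' ⊢
    filter_upwards [h, h'] with y hy hy'
    refine ⟨hy.1.trans hy'.1, fun i hi => ?_, fun k hk => ?_⟩
    · obtain ⟨j, hj, h₁⟩ := hy.2.1 i hi
      obtain ⟨k, hk, h₂⟩ := hy'.2.1 j hj
      exact ⟨k, hk, ih i h₁ h₂⟩
    · obtain ⟨j, hj, h₂⟩ := hy'.2.2 k hk
      obtain ⟨i, hi, h₁⟩ := hy.2.2 j hj
      exact ⟨i, hi, ih i h₁ h₂⟩

theorem mem_elt {σ : Name} {x : ℝ} {i : σ.Idx} (h : x ∈ σ.opn i) : Mem (σ.elt i) σ x :=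
  ⟨i, h, .refl _ _⟩

theorem eqv_iff {σ τ : Name} {x : ℝ} : Eqv σ τ x ↔ ∀ᶠ y in 𝓝 x, σ.settle y = τ.settle y ∧
    (∀ i, y ∈ σ.opn i → Mem (σ.elt i) τ y) ∧ ∀ j, y ∈ τ.opn j → Mem (τ.elt j) σ y := by
  rw [eqv_iff_aux]
  refine eventually_congr (.of_forall fun y => and_congr_right fun _ => and_congr_right fun _ => ?_)
  exact forall₂_congr fun j _ => exists_congr fun i => and_congr_right fun _ =>
    ⟨Eqv.symm, Eqv.symm⟩

theorem Mem.eventually {σ τ : Name} {x : ℝ} (h : Mem σ τ x) : ∀ᶠ y in 𝓝 x, Mem σ τ y := by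
  obtain ⟨j, hj, h⟩ := h
  filter_upwards [h.eventually, (τ.opn j).isOpen.mem_nhds hj] with y h₁ h₂ using ⟨j, h₂, h₁⟩

theorem Mem.congr_left {σ σ' τ : Name} {x : ℝ} (h : Mem σ τ x) (hσ : Eqv σ σ' x) :
    Mem σ' τ x := by
  obtain ⟨j, hj, h⟩ := h
  exact ⟨j, hj, hσ.symm.trans h⟩

theorem Mem.congr_right {σ τ τ' : Name} {x : ℝ} (h : Mem σ τ x) (hτ : Eqv τ τ' x) :
    Mem σ τ' x := by
  obtain ⟨j, hj, h⟩ := h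
  exact ((eqv_iff.1 hτ).self_of_nhds.2.1 j hj).congr_left h.symm

theorem Mem.settle {σ τ : Name} {x : ℝ} (h : Mem σ τ x) : σ.settle x ∈ τ.settle x := by
  obtain ⟨j, hj, h⟩ := h
  exact mem_settle.2 (Or.inr ⟨j, hj, h.settle_eq.symm⟩)

/-- Extensionality for names. The settled values are compared separately, because the elements
supplied by `st` are invisible to `Mem` until the point settles. -/
theorem eqv_of_forall_mem {σ τ : Name} {x : ℝ}
    (h : ∀ᶠ y in 𝓝 x, σ.settle y = τ.settle y ∧ ∀ d, Mem d σ y ↔ Mem d τ y) : Eqv σ τ x := by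
  rw [eqv_iff]
  filter_upwards [h] with y hy
  exact ⟨hy.1, fun i hi => (hy.2 _).1 (mem_elt hi), fun j hj => (hy.2 _).2 (mem_elt hj)⟩

theorem mem_check {d : Name} {s : ZFSet.{0}} {x : ℝ} :
    Mem d (check s) x ↔ ∃ c ∈ s, Eqv d (check c) x :=
  exists_idx_check (P := fun n => Eqv d n x)

theorem eqv_check {a b : ZFSet.{0}} {x : ℝ} : Eqv (check a) (check b) x ↔ a = b := by
  refine ⟨fun h => by simpa using h.settle_eq, ?_⟩
  rintro rfl
  exact .refl _ _

theorem mem_check_check {a b : ZFSet.{0}} {x : ℝ} : Mem (check a) (check b) x ↔ a ∈ b := by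
  simp [mem_check, eqv_check]

end Name

/-! ### Forcing with names -/

open Name

/-- The assignment after the point has settled at `y`. -/
noncomputable def ground (e : ℕ → Name) (y : ℝ) : ℕ → Name := fun n => check ((e n).settle y)

theorem ground_extend (d : Name) (e : ℕ → Name) (y : ℝ) :
    ground (extend d e) y = extend (check (d.settle y)) (ground e y) := by
  funext n; cases n <;> rfl

@[simp]
theorem ground_ground (e : ℕ → Name) (y z : ℝ) : ground (ground e y) z = ground e y := by
  funext n; simp [ground]

theorem ground_check (v : ℕ → ZFSet.{0}) (y : ℝ) :
    ground (fun n => check (v n)) y = fun n => check (v n) := by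
  funext n; simp [ground]

theorem extend_comp {D D' : Type*} (f : D → D') (d : D) (e : ℕ → D) :
    (fun n => f (extend d e n)) = extend (f d) fun n => f (e n) := by
  funext n; cases n <;> rfl

/-- Forcing at a point. An implication or a universal statement has to hold at all nearby points,
and also everywhere after the point has settled. -/
def Force : Fml → ℝ → (ℕ → Name) → Prop
  | bot, _, _ => False
  | eq i j, x, e => Eqv (e i) (e j) x
  | mem i j, x, e => Mem (e i) (e j) x
  | conj φ ψ, x, e => Force φ x e ∧ Force ψ x e
  | disj φ ψ, x, e => Force φ x e ∨ Force ψ x e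
  | imp φ ψ, x, e => ∀ᶠ y in 𝓝 x, (Force φ y e → Force ψ y e) ∧
      ∀ z, Force φ z (ground e y) → Force ψ z (ground e y)
  | all φ, x, e => ∀ᶠ y in 𝓝 x, (∀ d, Force φ y (extend d e)) ∧
      ∀ z d, Force φ z (extend d (ground e y))
  | ex φ, x, e => ∃ d, Force φ x (extend d e)

namespace Force

theorem eventually {φ : Fml} {x : ℝ} {e : ℕ → Name} (h : Force φ x e) :
    ∀ᶠ y in 𝓝 x, Force φ y e := by
  induction φ generalizing x e with
  | bot => exact h.elim
  | eq i j => exact Eqv.eventually h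
  | mem i j => exact Mem.eventually h
  | conj φ ψ h₁ h₂ => exact (h₁ h.1).and (h₂ h.2)
  | disj φ ψ h₁ h₂ =>
    exact h.elim (fun h => (h₁ h).mono fun _ => Or.inl) fun h => (h₂ h).mono fun _ => Or.inr
  | imp φ ψ h₁ h₂ => exact Eventually.eventually_nhds h
  | all φ ih => exact Eventually.eventually_nhds h
  | ex φ ih =>
    obtain ⟨d, hd⟩ := h
    exact (ih hd).mono fun _ h => ⟨d, h⟩

/-- What is forced remains true when the point settles. -/
theorem ground {φ : Fml} {x : ℝ} {e : ℕ → Name} (h : Force φ x e) (z : ℝ) :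
    Force φ z (ground e x) := by
  induction φ generalizing x e with
  | bot => exact h
  | eq i j => exact eqv_check.2 (Eqv.settle_eq h)
  | mem i j => exact mem_check_check.2 (Mem.settle h)
  | conj φ ψ h₁ h₂ => exact ⟨h₁ h.1, h₂ h.2⟩
  | disj φ ψ h₁ h₂ => exact h.imp h₁ h₂
  | imp φ ψ h₁ h₂ =>
    -- The second half of the clause speaks of settled parameters at every point. Since `ground` is
    -- idempotent, it serves for both halves after settling.
    have := (Eventually.self_of_nhds h).2
    exact .of_forall fun y => ⟨this y, fun z => by simpa using this z⟩
  | all φ ih =>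
    have := (Eventually.self_of_nhds h).2
    exact .of_forall fun y => ⟨this y, fun z => by simpa using this z⟩
  | ex φ ih =>
    obtain ⟨d, hd⟩ := h
    exact ⟨_, ground_extend d e x ▸ ih hd⟩

theorem rename_iff {φ : Fml} {x : ℝ} {e : ℕ → Name} {ξ : ℕ → ℕ} :
    Force (φ.rename ξ) x e ↔ Force φ x fun n => e (ξ n) := by
  have hext : ∀ (d : Name) (e : ℕ → Name) (ξ : ℕ → ℕ),
      (fun n => extend d e (lift ξ n)) = extend d fun n => e (ξ n) := by
    intro d e ξ; funext n; cases n <;> rfl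
  induction φ generalizing x e ξ with
  | bot => exact Iff.rfl
  | eq i j => exact Iff.rfl
  | mem i j => exact Iff.rfl
  | conj φ ψ h₁ h₂ => exact and_congr h₁ h₂
  | disj φ ψ h₁ h₂ => exact or_congr h₁ h₂
  | imp φ ψ h₁ h₂ =>
    simp only [rename, Force, h₁, h₂]; rfl
  | all φ ih => simp only [rename, Force, ih, hext]; rfl
  | ex φ ih => simp only [rename, Force, ih, hext]

/-- An assignment has infinitely many entries, and equality of each at `x` need not give a common
neighbourhood. So the hypothesis asks for one neighbourhood that works for all entries at once. -/
theorem congr {φ : Fml} {x : ℝ} {e e' : ℕ → Name} (h : Force φ x e)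
    (he : ∀ᶠ y in 𝓝 x, ∀ n, Eqv (e n) (e' n) y) : Force φ x e' := by
  have hg : ∀ {y : ℝ} {e e' : ℕ → Name}, (∀ n, Eqv (e n) (e' n) y) →
      CZF.ground e y = CZF.ground e' y := fun h => funext fun n => congrArg check (h n).settle_eq
  have hext : ∀ {y : ℝ} {e e' : ℕ → Name} (d : Name), (∀ᶠ z in 𝓝 y, ∀ n, Eqv (e n) (e' n) z) →
      ∀ᶠ z in 𝓝 y, ∀ n, Eqv (extend d e n) (extend d e' n) z := by
    intro y e e' d h
    filter_upwards [h] with z hz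
    rintro (_ | n)
    · exact .refl _ _
    · exact hz n
  induction φ generalizing x e e' with
  | bot => exact h
  | eq i j =>
    exact ((he.self_of_nhds i).symm.trans h).trans (he.self_of_nhds j)
  | mem i j => exact (Mem.congr_left h (he.self_of_nhds i)).congr_right (he.self_of_nhds j)
  | conj φ ψ h₁ h₂ => exact ⟨h₁ h.1 he, h₂ h.2 he⟩
  | disj φ ψ h₁ h₂ => exact h.imp (h₁ · he) (h₂ · he)
  | imp φ ψ h₁ h₂ =>
    have h' : ∀ᶠ y in 𝓝 x, _ := h
    refine Eventually.mono (h'.and he.eventually_nhds) fun y ⟨hy, hy'⟩ => ⟨fun hφ => ?_, ?_⟩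
    · exact h₂ (hy.1 (h₁ hφ (hy'.mono fun z hz n => (hz n).symm))) hy'
    · rw [← hg hy'.self_of_nhds]; exact hy.2
  | all φ ih =>
    have h' : ∀ᶠ y in 𝓝 x, _ := h
    refine Eventually.mono (h'.and he.eventually_nhds) fun y ⟨hy, hy'⟩ => ⟨fun d => ?_, ?_⟩
    · exact ih (hy.1 d) (hext d hy')
    · rw [← hg hy'.self_of_nhds]; exact hy.2
  | ex φ ih =>
    obtain ⟨d, hd⟩ := h
    exact ⟨d, ih hd (hext d he)⟩

/-- Substitution of equal names for the variable `0`. -/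
theorem congr_zero {φ : Fml} {x : ℝ} {e : ℕ → Name} {d d' : Name} (h : Force φ x (extend d e))
    (hd : Eqv d d' x) : Force φ x (extend d' e) := by
  refine h.congr (hd.eventually.mono fun y hy n => ?_)
  cases n with
  | zero => exact hy
  | succ n => exact .refl _ _

/-- Substitution of equal names for the variable `1`. -/
theorem congr_one {φ : Fml} {x : ℝ} {e : ℕ → Name} {c d d' : Name}
    (h : Force φ x (extend c (extend d e))) (hd : Eqv d d' x) :
    Force φ x (extend c (extend d' e)) := by
  refine h.congr (hd.eventually.mono fun y hy n => ?_)
  match n with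
  | 0 => exact .refl _ _
  | 1 => exact hy
  | n + 2 => exact .refl _ _

theorem iff_iff {φ ψ : Fml} {x : ℝ} {e : ℕ → Name} : Force (iff φ ψ) x e ↔
    ∀ᶠ y in 𝓝 x, (Force φ y e ↔ Force ψ y e) ∧
      ∀ z, Force φ z (CZF.ground e y) ↔ Force ψ z (CZF.ground e y) := by
  simp only [Fml.iff, Force, ← eventually_and]
  exact eventually_congr (.of_forall fun y => by grind)

/-- The neighbourhoods of the nested connectives collapse into one because the clause is an open
condition, and repeated settling collapses because `ground` is idempotent. -/
theorem all_iff_iff {φ ψ : Fml} {x : ℝ} {e : ℕ → Name} : Force (all (iff φ ψ)) x e ↔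
    ∀ᶠ y in 𝓝 x, (∀ d, Force φ y (extend d e) ↔ Force ψ y (extend d e)) ∧
      ∀ z d, Force φ z (extend d (CZF.ground e y)) ↔ Force ψ z (extend d (CZF.ground e y)) := by
  rw [Force]
  constructor
  · intro h
    filter_upwards [h] with y hy
    exact ⟨fun d => (iff_iff.1 (hy.1 d)).self_of_nhds.1,
      fun z d => (iff_iff.1 (hy.2 z d)).self_of_nhds.1⟩
  · intro h
    filter_upwards [h.eventually_nhds] with y hy
    refine ⟨fun d => iff_iff.2 (hy.mono fun z hz => ⟨hz.1 d, fun z' => ?_⟩), fun z d =>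
      iff_iff.2 (.of_forall fun z' => ⟨hy.self_of_nhds.2 z' d, fun z'' => ?_⟩)⟩
    · rw [ground_extend]; exact hz.2 _ _
    · rw [ground_extend, ground_ground]; exact hy.self_of_nhds.2 _ _

/-- After settling, the bound is a constant name, and each of its members is locally equal to a
constant. So the settled half only has to be tested on constants. -/
theorem ball_iff {φ : Fml} {i : ℕ} {x : ℝ} {e : ℕ → Name} : Force (ball i φ) x e ↔
    ∀ᶠ y in 𝓝 x, (∀ d, Mem d (e i) y → Force φ y (extend d e)) ∧
      ∀ z, ∀ c ∈ (e i).settle y, Force φ z (extend (check c) (CZF.ground e y)) := by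
  rw [ball, Force]
  constructor
  · intro h
    filter_upwards [h] with y hy
    exact ⟨fun d hd => (Eventually.self_of_nhds (hy.1 d)).1 hd,
      fun z c hc => (Eventually.self_of_nhds (hy.2 z (check c))).1 (mem_check_check.2 hc)⟩
  · intro h
    filter_upwards [h.eventually_nhds] with y hy
    have key : ∀ {z z' : ℝ} {d : Name}, (∀ z, ∀ c ∈ (e i).settle z',
        Force φ z (extend (check c) (CZF.ground e z'))) → Mem d (check ((e i).settle z')) z →
        Force φ z (extend d (CZF.ground e z')) := by
      intro z z' d hz hd
      obtain ⟨c, hc, h⟩ := mem_check.1 hd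
      exact (hz z c hc).congr_zero h.symm
    refine ⟨fun d => hy.mono fun z hz => ⟨hz.1 d, fun z' hd => ?_⟩, fun z d =>
      .of_forall fun z' => ⟨key hy.self_of_nhds.2, fun z'' hd => ?_⟩⟩
    · rw [ground_extend] at hd ⊢; exact key hz.2 hd
    · rw [ground_extend, ground_ground] at hd ⊢; exact key hy.self_of_nhds.2 hd

/-- The indexed elements suffice as witnesses, since every member of a name is equal to one of them
near the point. -/
theorem bex_iff {φ : Fml} {i : ℕ} {x : ℝ} {e : ℕ → Name} : Force (bex i φ) x e ↔
    ∃ j, x ∈ (e i).opn j ∧ Force φ x (extend ((e i).elt j) e) := by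
  constructor
  · rintro ⟨d, ⟨j, hj, hd⟩, h⟩
    exact ⟨j, hj, h.congr_zero hd⟩
  · rintro ⟨j, hj, h⟩
    exact ⟨_, mem_elt hj, h⟩

end Force

/-! ### Validity and soundness -/

/-- Validity in the model of names. -/
def Valid (φ : Fml) : Prop := ∀ x e, Force φ x e

theorem Valid.rename {φ : Fml} (h : Valid φ) (ξ : ℕ → ℕ) : Valid (φ.rename ξ) :=
  fun x _ => Force.rename_iff.2 (h x _)

theorem force_inst {φ : Fml} {x : ℝ} {e : ℕ → Name} {t : ℕ} :
    Force (φ.inst t) x e ↔ Force φ x (extend (e t) e) := by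
  rw [inst, Force.rename_iff]
  exact iff_of_eq (congrArg _ (funext fun n => by cases n <;> rfl))

theorem force_shift {φ : Fml} {x : ℝ} {e : ℕ → Name} {d : Name} :
    Force φ.shift x (extend d e) ↔ Force φ x e :=
  Force.rename_iff

/-- Soundness. -/
theorem Derives.force {T : Set Fml} (hT : ∀ φ ∈ T, Valid φ) {Γ : List Fml} {φ : Fml}
    (h : Derives T Γ φ) {x : ℝ} {e : ℕ → Name} (hΓ : ∀ ψ ∈ Γ, Force ψ x e) : Force φ x e := by
  have hev : ∀ {Γ : List Fml} {x : ℝ} {e : ℕ → Name}, (∀ ψ ∈ Γ, Force ψ x e) →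
      ∀ᶠ y in 𝓝 x, ∀ ψ ∈ Γ, Force ψ y e := by
    intro Γ x e h
    induction Γ with
    | nil => simp
    | cons ψ Γ ih =>
      simp only [List.forall_mem_cons] at h ⊢
      exact h.1.eventually.and (ih h.2)
  have hsh : ∀ {Γ : List Fml} {x : ℝ} {e : ℕ → Name} (d : Name), (∀ ψ ∈ Γ, Force ψ x e) →
      ∀ ψ ∈ Γ.map shift, Force ψ x (extend d e) := by
    intro Γ x e d h ψ hψ
    obtain ⟨θ, hθ, rfl⟩ := List.mem_map.1 hψ
    exact force_shift.2 (h θ hθ)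
  induction h generalizing x e with
  | ax h => exact hT _ h x e
  | hyp h => exact hΓ _ h
  | botE _ ih => exact (ih hΓ).elim
  | conjI _ _ h₁ h₂ => exact ⟨h₁ hΓ, h₂ hΓ⟩
  | conjE₁ _ ih => exact (ih hΓ).1
  | conjE₂ _ ih => exact (ih hΓ).2
  | disjI₁ _ ih => exact Or.inl (ih hΓ)
  | disjI₂ _ ih => exact Or.inr (ih hΓ)
  | disjE _ _ _ h₁ h₂ h₃ =>
    rcases h₁ hΓ with h | h
    · exact h₂ (List.forall_mem_cons.2 ⟨h, hΓ⟩)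
    · exact h₃ (List.forall_mem_cons.2 ⟨h, hΓ⟩)
  | impI _ ih =>
    -- For the settled half, the side assumptions are first settled at `y` by `Force.ground`, and
    -- the induction hypothesis is then applied at the new point.
    refine (hev hΓ).mono fun y hy => ⟨fun h => ih (List.forall_mem_cons.2 ⟨h, hy⟩), fun z h =>
      ih (List.forall_mem_cons.2 ⟨h, fun ψ hψ => (hy ψ hψ).ground z⟩)⟩
  | impE _ _ h₁ h₂ => exact (Eventually.self_of_nhds (h₁ hΓ)).1 (h₂ hΓ)
  | allI _ ih =>
    exact (hev hΓ).mono fun y hy => ⟨fun d => ih (hsh d hy), fun z d =>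
      ih (hsh d fun ψ hψ => (hy ψ hψ).ground z)⟩
  | allE t _ ih => exact force_inst.2 ((Eventually.self_of_nhds (ih hΓ)).1 _)
  | exI t _ ih => exact ⟨_, force_inst.1 (ih hΓ)⟩
  | exE _ _ h₁ h₂ =>
    obtain ⟨d, hd⟩ := h₁ hΓ
    exact force_shift.1 (h₂ (List.forall_mem_cons.2 ⟨hd, hsh d hΓ⟩))
  | eqRefl t => exact Eqv.refl _ _
  | eqSubst s t _ _ h₁ h₂ =>
    exact force_inst.2 ((force_inst.1 (h₂ hΓ)).congr_zero (h₁ hΓ))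

end CZF

namespace CZF

open Fml Topology Filter TopologicalSpace Name

/-! ### Absoluteness for settled parameters -/

/-- Truth in the universe of sets. -/
def ZSat : Fml → (ℕ → ZFSet.{0}) → Prop
  | bot, _ => False
  | eq i j, v => v i = v j
  | mem i j, v => v i ∈ v j
  | conj φ ψ, v => ZSat φ v ∧ ZSat ψ v
  | disj φ ψ, v => ZSat φ v ∨ ZSat ψ v
  | imp φ ψ, v => ZSat φ v → ZSat ψ v
  | all φ, v => ∀ c, ZSat φ (extend c v)
  | ex φ, v => ∃ c, ZSat φ (extend c v)

/-- Formulas in which all universal quantifiers are bounded. -/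
inductive BoundedAll : Fml → Prop
  | bot : BoundedAll bot
  | eq (i j : ℕ) : BoundedAll (eq i j)
  | mem (i j : ℕ) : BoundedAll (mem i j)
  | conj {φ ψ : Fml} : BoundedAll φ → BoundedAll ψ → BoundedAll (conj φ ψ)
  | disj {φ ψ : Fml} : BoundedAll φ → BoundedAll ψ → BoundedAll (disj φ ψ)
  | imp {φ ψ : Fml} : BoundedAll φ → BoundedAll ψ → BoundedAll (imp φ ψ)
  | ball (y : ℕ) {φ : Fml} : BoundedAll φ → BoundedAll (ball y φ)
  | ex {φ : Fml} : BoundedAll φ → BoundedAll (ex φ)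

theorem BoundedAll.bex (y : ℕ) {φ : Fml} (h : BoundedAll φ) : BoundedAll (bex y φ) :=
  .ex (.conj (.mem _ _) h)

theorem Fml.Bounded.boundedAll {φ : Fml} (h : Bounded φ) : BoundedAll φ := by
  induction h with
  | bot => exact .bot
  | eq i j => exact .eq i j
  | mem i j => exact .mem i j
  | conj _ _ h₁ h₂ => exact .conj h₁ h₂
  | disj _ _ h₁ h₂ => exact .disj h₁ h₂
  | imp _ _ h₁ h₂ => exact .imp h₁ h₂
  | ball y _ h => exact .ball y h
  | bex y _ h => exact .bex y h

/-- Members of constant names are locally constant, so a bounded universal quantifier sees only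
constants. An unbounded one would also range over varying names, whereas an unbounded existential
does no harm, since its witness can be settled. -/
theorem force_check {φ : Fml} (hφ : BoundedAll φ) {z : ℝ} {v : ℕ → ZFSet.{0}} :
    Force φ z (fun n => check (v n)) ↔ ZSat φ v := by
  induction hφ generalizing z v with
  | bot => exact Iff.rfl
  | eq i j => exact eqv_check
  | mem i j => exact mem_check_check
  | conj _ _ h₁ h₂ => exact and_congr h₁ h₂
  | disj _ _ h₁ h₂ => exact or_congr h₁ h₂
  | imp _ _ h₁ h₂ =>
    simp only [Force, ground_check, h₁, h₂, ZSat]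
    exact ⟨fun h => h.self_of_nhds.1, fun h => .of_forall fun _ => ⟨h, fun _ => h⟩⟩
  | ball y _ ih =>
    rw [Force.ball_iff]
    simp only [ground_check, settle_check, ← extend_comp, ih]
    simp only [ball, ZSat]
    refine ⟨fun h => h.self_of_nhds.2 0, fun h => .of_forall fun x => ⟨fun d hd => ?_, fun _ => h⟩⟩
    obtain ⟨c, hc, hd⟩ := mem_check.1 hd
    refine Force.congr_zero ?_ hd.symm
    rw [← extend_comp, ih]
    exact h c hc
  | ex _ ih =>
    constructor
    · rintro ⟨d, hd⟩
      -- Settling leaves the constant parameters alone and replaces the witness by a constant one.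
      have := hd.ground z
      rw [ground_extend, ground_check, ← extend_comp, ih] at this
      exact ⟨_, this⟩
    · rintro ⟨c, hc⟩
      exact ⟨check c, by rwa [← extend_comp, ih]⟩

theorem force_ground {φ : Fml} (hφ : BoundedAll φ) {y z : ℝ} {e : ℕ → Name} :
    Force φ z (ground e y) ↔ ZSat φ fun n => (e n).settle y :=
  force_check hφ

theorem force_extend_ground {φ : Fml} (hφ : BoundedAll φ) {y z : ℝ} {e : ℕ → Name}
    {c : ZFSet.{0}} :
    Force φ z (extend (check c) (ground e y)) ↔ ZSat φ (extend c fun n => (e n).settle y) := by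
  rw [← force_check hφ (z := z), extend_comp]; rfl

theorem Force.zsat {φ : Fml} (hφ : BoundedAll φ) {x : ℝ} {e : ℕ → Name} (h : Force φ x e) :
    ZSat φ fun n => (e n).settle x :=
  (force_ground hφ).1 (h.ground x)

theorem Force.zsat_extend {φ : Fml} (hφ : BoundedAll φ) {x : ℝ} {d : Name} {e : ℕ → Name}
    (h : Force φ x (extend d e)) : ZSat φ (extend (d.settle x) fun n => (e n).settle x) := by
  have := h.ground x
  rwa [ground_extend, force_extend_ground hφ] at this

/-! ### The axioms in the model of names -/

theorem Valid.all {φ : Fml} (h : Valid φ) : Valid (all φ) :=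
  fun _ _ => .of_forall fun _ => ⟨fun _ => h _ _, fun _ _ => h _ _⟩

theorem Valid.imp {φ ψ : Fml} (h : ∀ x e, Force φ x e → Force ψ x e) : Valid (imp φ ψ) :=
  fun _ _ => .of_forall fun _ => ⟨h _ _, fun _ => h _ _⟩

/-- A set-existence axiom needs a single name doing two jobs: its members are right while the point
moves, and its settled value is right over the settled parameters. The component `st` makes the
second job independent of the first. -/
theorem force_ex_set {ψ : Fml} {x : ℝ} {e : ℕ → Name} (N : Name)
    (h : ∀ᶠ y in 𝓝 x, (∀ d, Mem d N y ↔ Force ψ y (extend d (extend N e))) ∧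
      ∀ z d, Mem d (check (N.settle y)) z ↔
        Force ψ z (extend d (extend (check (N.settle y)) (ground e y)))) :
    Force (ex (all (iff (mem 0 1) ψ))) x e := by
  refine ⟨N, Force.all_iff_iff.2 (h.mono fun y hy => ⟨hy.1, fun z d => ?_⟩)⟩
  rw [ground_extend]
  exact hy.2 z d

theorem valid_extensionality : Valid extensionality := by
  refine Valid.all (Valid.all (Valid.imp fun x e h => ?_))
  refine eqv_of_forall_mem ((Force.all_iff_iff.1 h).mono fun y hy => ⟨?_, hy.1⟩)
  ext c
  exact (mem_check_check (x := 0)).symm.trans ((hy.2 0 (check c)).trans mem_check_check)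

/-! ### Names of unordered and ordered pairs -/

namespace Name

/-- The name of an unordered pair. -/
def upair (σ τ : Name) : Name := mk Bool (fun b => cond b σ τ) (fun _ => ⊤) (fun _ => ∅)

theorem mem_upair {d σ τ : Name} {x : ℝ} : Mem d (upair σ τ) x ↔ Eqv d σ x ∨ Eqv d τ x := by
  constructor
  · rintro ⟨_ | _, -, h⟩
    · exact Or.inr h
    · exact Or.inl h
  · rintro (h | h)
    · exact ⟨true, trivial, h⟩
    · exact ⟨false, trivial, h⟩

theorem settle_upair (σ τ : Name) (x : ℝ) : (upair σ τ).settle x = {σ.settle x, τ.settle x} := by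
  ext c
  rw [mem_settle, ZFSet.mem_pair]
  constructor
  · rintro (h | ⟨_ | _, -, h⟩)
    · exact absurd h (ZFSet.notMem_empty c)
    · exact Or.inr h.symm
    · exact Or.inl h.symm
  · rintro (h | h)
    · exact Or.inr ⟨true, trivial, h.symm⟩
    · exact Or.inr ⟨false, trivial, h.symm⟩

theorem eqv_upair_iff {ρ σ τ : Name} {x : ℝ} : Eqv ρ (upair σ τ) x ↔ Mem σ ρ x ∧ Mem τ ρ x ∧
    ∀ᶠ y in 𝓝 x, (∀ d, Mem d ρ y → Eqv d σ y ∨ Eqv d τ y) ∧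
      ∀ c ∈ ρ.settle y, c = σ.settle y ∨ c = τ.settle y := by
  constructor
  · intro h
    refine ⟨(mem_upair.2 (Or.inl (.refl _ _))).congr_right h.symm,
      (mem_upair.2 (Or.inr (.refl _ _))).congr_right h.symm, h.eventually.mono fun y hy => ?_⟩
    refine ⟨fun d hd => mem_upair.1 (hd.congr_right hy), fun c hc => ?_⟩
    rwa [hy.settle_eq, settle_upair, ZFSet.mem_pair] at hc
  · rintro ⟨h₁, h₂, h₃⟩
    refine eqv_of_forall_mem ?_
    filter_upwards [h₁.eventually, h₂.eventually, h₃] with y h₁ h₂ h₃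
    constructor
    · ext c
      rw [settle_upair, ZFSet.mem_pair]
      refine ⟨h₃.2 c, ?_⟩
      rintro (rfl | rfl)
      · exact h₁.settle
      · exact h₂.settle
    · intro d
      rw [mem_upair]
      refine ⟨h₃.1 d, ?_⟩
      rintro (h | h)
      · exact h₁.congr_left h.symm
      · exact h₂.congr_left h.symm

theorem eqv_check_upair {a b c : ZFSet.{0}} {x : ℝ} :
    Eqv (check c) (upair (check a) (check b)) x ↔ c = {a, b} := by
  refine ⟨fun h => by simpa [settle_upair] using h.settle_eq, ?_⟩
  rintro rfl
  refine eqv_upair_iff.2 ⟨mem_check_check.2 (by simp), mem_check_check.2 (by simp),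
    .of_forall fun y => ⟨fun d hd => ?_, fun c hc => by simpa using hc⟩⟩
  obtain ⟨c, hc, h⟩ := mem_check.1 hd
  rcases ZFSet.mem_pair.1 hc with rfl | rfl
  · exact Or.inl h
  · exact Or.inr h

theorem Eqv.upair {σ σ' τ τ' : Name} {x : ℝ} (h : Eqv σ σ' x) (h' : Eqv τ τ' x) :
    Eqv (upair σ τ) (upair σ' τ') x := by
  refine eqv_upair_iff.2 ⟨mem_upair.2 (Or.inl h.symm), mem_upair.2 (Or.inr h'.symm), ?_⟩
  filter_upwards [h.eventually, h'.eventually] with y hy hy'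
  refine ⟨fun d hd => (mem_upair.1 hd).imp (·.trans hy) (·.trans hy'), fun c hc => ?_⟩
  rwa [settle_upair, ZFSet.mem_pair, hy.settle_eq, hy'.settle_eq] at hc

/-- The name of an ordered pair. -/
def pair (σ τ : Name) : Name := upair (upair σ σ) (upair σ τ)

theorem settle_pair (σ τ : Name) (x : ℝ) :
    (pair σ τ).settle x = ZFSet.pair (σ.settle x) (τ.settle x) := by
  simp [pair, settle_upair, ZFSet.pair]

theorem Eqv.pair {σ σ' τ τ' : Name} {x : ℝ} (h : Eqv σ σ' x) (h' : Eqv τ τ' x) :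
    Eqv (pair σ τ) (pair σ' τ') x :=
  (h.upair h).upair (h.upair h')

theorem eqv_check_pair {a b c : ZFSet.{0}} {x : ℝ} :
    Eqv (check c) (pair (check a) (check b)) x ↔ c = ZFSet.pair a b := by
  refine ⟨fun h => by simpa [settle_pair] using h.settle_eq, ?_⟩
  rintro rfl
  have h : Eqv (check (ZFSet.pair a b)) (upair (check {a, a}) (check {a, b})) x :=
    eqv_check_upair.2 (by simp [ZFSet.pair])
  exact h.trans ((eqv_check_upair.2 rfl).upair (eqv_check_upair.2 rfl))

end Name

theorem force_isUPair {i j k : ℕ} {x : ℝ} {e : ℕ → Name} :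
    Force (isUPair i j k) x e ↔ Eqv (e i) (upair (e j) (e k)) x := by
  rw [isUPair, eqv_upair_iff]
  refine and_congr_right fun _ => and_congr_right fun _ => ?_
  rw [Force.ball_iff]
  refine eventually_congr (.of_forall fun y => and_congr_right fun _ => ?_)
  refine ⟨fun h c hc => (h 0 c hc).imp eqv_check.1 eqv_check.1,
    fun h z c hc => (h c hc).imp eqv_check.2 eqv_check.2⟩

theorem force_isPair {i j k : ℕ} {x : ℝ} {e : ℕ → Name} :
    Force (isPair i j k) x e ↔ Eqv (e i) (Name.pair (e j) (e k)) x := by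
  have hb : ∀ (j k : ℕ), Force (bex i (isUPair 0 (j + 1) (k + 1))) x e ↔
      Mem (upair (e j) (e k)) (e i) x := by
    intro j k
    simp only [bex, Force, force_isUPair]
    exact ⟨fun ⟨d, hd, h⟩ => Mem.congr_left hd h, fun h => ⟨_, h, .refl _ _⟩⟩
  rw [isPair, Name.pair, eqv_upair_iff, Force, Force, hb, hb]
  refine and_congr_right fun _ => and_congr_right fun _ => ?_
  rw [Force.ball_iff]
  simp only [Force, force_isUPair, settle_upair]
  refine eventually_congr (.of_forall fun y => and_congr_right fun _ => ?_)
  exact ⟨fun h c hc => (h 0 c hc).imp eqv_check_upair.1 eqv_check_upair.1,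
    fun h z c hc => (h c hc).imp eqv_check_upair.2 eqv_check_upair.2⟩

theorem force_app {f i j : ℕ} {x : ℝ} {e : ℕ → Name} :
    Force (app f i j) x e ↔ Mem (Name.pair (e i) (e j)) (e f) x := by
  simp only [app, bex, Force, force_isPair]
  exact ⟨fun ⟨d, hd, h⟩ => Mem.congr_left hd h, fun h => ⟨_, h, .refl _ _⟩⟩

theorem valid_pairing : Valid pairing := by
  refine Valid.all (Valid.all fun x e => force_ex_set (upair (e 1) (e 0)) ?_)
  refine .of_forall fun y => ⟨fun d => mem_upair, fun z d => ?_⟩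
  rw [settle_upair, mem_check]
  simp only [ZFSet.mem_pair, exists_eq_or_imp, exists_eq_left]
  exact Iff.rfl

theorem valid_union : Valid union := by
  refine Valid.all fun x e => force_ex_set
    (.mk (Σ i : (e 0).Idx, ((e 0).elt i).Idx) (fun p => ((e 0).elt p.1).elt p.2)
      (fun p => (e 0).opn p.1 ⊓ ((e 0).elt p.1).opn p.2)
      -- A settled element of `e 0` may come from `st` and have no index, so the settled union is
      -- supplied as a whole.
      (fun r => ((e 0).settle r).sUnion)) (.of_forall fun y => ⟨fun d => ?_, fun z d => ?_⟩)
  · rw [Force.bex_iff]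
    constructor
    · rintro ⟨⟨i, j⟩, h, hd⟩
      exact ⟨i, h.1, j, h.2, hd⟩
    · rintro ⟨i, hi, j, hj, hd⟩
      exact ⟨⟨i, j⟩, ⟨hi, hj⟩, hd⟩
  · have hs : ∀ c, c ∈ settle (.mk (Σ i : (e 0).Idx, ((e 0).elt i).Idx)
        (fun p => ((e 0).elt p.1).elt p.2)
        (fun p => (e 0).opn p.1 ⊓ ((e 0).elt p.1).opn p.2)
        (fun r => ((e 0).settle r).sUnion)) y ↔ ∃ s ∈ (e 0).settle y, c ∈ s := by
      intro c
      rw [mem_settle, ← ZFSet.mem_sUnion]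
      refine or_iff_left_of_imp ?_
      rintro ⟨⟨i, j⟩, h, rfl⟩
      exact ZFSet.mem_sUnion.2 ⟨_, (mem_elt h.1).settle, (mem_elt h.2).settle⟩
    simp only [mem_check, hs]
    constructor
    · rintro ⟨c, ⟨s, hs, hc⟩, hd⟩
      exact ⟨check s, mem_check_check.2 hs, mem_check.2 ⟨c, hc, hd⟩⟩
    · rintro ⟨d', hd', hd⟩
      obtain ⟨s, hs, h⟩ := mem_check.1 hd'
      obtain ⟨c, hc, h'⟩ := mem_check.1 (Mem.congr_right hd h)
      exact ⟨c, ⟨s, hs, hc⟩, h'⟩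

/-- Two inductions: `∈`-induction over settled sets (`hground`), then induction over names (`hall`).
The second uses the first for the settled half of the bounded quantifier. -/
theorem valid_setInduction (φ : Fml) : Valid (setInduction φ) := by
  have hren : ∀ {x : ℝ} {d' d : Name} {e : ℕ → Name},
      Force (φ.rename (sub1 0 2)) x (extend d' (extend d e)) ↔ Force φ x (extend d' e) := by
    intro x d' d e
    rw [Force.rename_iff]
    exact iff_of_eq (congrArg _ (funext fun n => by cases n <;> rfl))
  have hground : ∀ (e : ℕ → Name) (y z : ℝ), Force (all (imp (ball 0 (φ.rename (sub1 0 2))) φ)) z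
      (ground e y) → ∀ (c : ZFSet.{0}) (z : ℝ), Force φ z (extend (check c) (ground e y)) := by
    intro e y z h c
    induction c using ZFSet.inductionOn with
    | _ c ih =>
      intro z
      have h' := h.ground z
      rw [ground_ground] at h'
      refine (Eventually.self_of_nhds ((Eventually.self_of_nhds h').1 (check c))).1 ?_
      rw [Force.ball_iff]
      refine .of_forall fun y' => ⟨fun d hd => ?_, fun z' c' hc' => ?_⟩
      · obtain ⟨c', hc', hd⟩ := mem_check.1 hd
        exact hren.2 ((ih c' hc' y').congr_zero hd.symm)
      · rw [ground_extend, ground_ground, hren]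
        exact ih c' (by simpa [extend] using hc') z'
  have hall : ∀ (e : ℕ → Name) (d : Name) (y : ℝ),
      Force (all (imp (ball 0 (φ.rename (sub1 0 2))) φ)) y e → Force φ y (extend d e) := by
    intro e d
    induction d with
    | mk I a U s ih =>
      intro y h
      refine (Eventually.self_of_nhds ((Eventually.self_of_nhds h).1 _)).1 ?_
      rw [Force.ball_iff]
      filter_upwards [h.eventually] with y' hy'
      refine ⟨fun d ⟨i, hi, hd⟩ => ?_, fun z c hc => ?_⟩
      · exact hren.2 ((ih i y' hy').congr_zero hd.symm)
      · rw [ground_extend, hren]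
        exact hground e y' z (hy'.ground z) c z
  exact Valid.imp fun x e h => h.eventually.mono fun y hy =>
    ⟨fun d => hall e d y hy, fun z d => hall _ d z (hy.ground z)⟩

/-- The open set of the points at which a formula is forced. -/
def forceOpens (φ : Fml) (e : ℕ → Name) : Opens ℝ :=
  ⟨{x | Force φ x e}, isOpen_iff_mem_nhds.2 fun _ h => Force.eventually h⟩

/-- While the point moves, each element is restricted to the open set where it is forced to satisfy
`φ`. The settled value is separated classically, and absoluteness of bounded formulas makes this
agree with forcing over settled parameters. -/
theorem valid_separation {φ : Fml} (hφ : Bounded φ) : Valid (separation φ) := by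
  have hren : ∀ {x : ℝ} {d b a : Name} {e : ℕ → Name},
      Force (φ.rename (sub1 0 3)) x (extend d (extend b (extend a e))) ↔
        Force φ x (extend d e) := by
    intro x d b a e
    rw [Force.rename_iff]
    exact iff_of_eq (congrArg _ (funext fun n => by cases n <;> rfl))
  refine Valid.all fun x e => ?_
  obtain ⟨a, e, rfl⟩ : ∃ a e', e = extend a e' :=
    ⟨e 0, fun n => e (n + 1), funext fun n => by cases n <;> rfl⟩
  obtain ⟨S, hS⟩ : ∃ S : ℝ → ZFSet.{0}, ∀ r c, c ∈ S r ↔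
      c ∈ a.settle r ∧ ZSat φ (extend c fun n => (e n).settle r) :=
    ⟨fun r => (a.settle r).sep fun c => ZSat φ (extend c fun n => (e n).settle r),
      fun r c => ZFSet.mem_sep⟩
  refine force_ex_set (.mk a.Idx a.elt (fun i => a.opn i ⊓ forceOpens φ (extend (a.elt i) e)) S)
    (.of_forall fun y => ⟨fun d => ?_, fun z d => ?_⟩)
  · rw [Force, hren]
    constructor
    · rintro ⟨i, hi, hd⟩
      exact ⟨⟨i, hi.1, hd⟩, Force.congr_zero hi.2 hd.symm⟩
    · rintro ⟨⟨i, hi, hd⟩, h⟩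
      exact ⟨i, ⟨hi, h.congr_zero hd⟩, hd⟩
  · rw [Force, ground_extend, hren, mem_check]
    simp only [mem_settle (σ := .mk _ _ _ _)]
    constructor
    · rintro ⟨c, hc, hd⟩
      have hc' : c ∈ a.settle y ∧ ZSat φ (extend c fun n => (e n).settle y) := by
        rcases hc with hc | ⟨i, hi, rfl⟩
        · exact (hS y c).1 hc
        · exact ⟨(mem_elt hi.1).settle, Force.zsat_extend hφ.boundedAll hi.2⟩
      exact ⟨mem_check.2 ⟨c, hc'.1, hd⟩,
        ((force_extend_ground hφ.boundedAll).2 hc'.2).congr_zero hd.symm⟩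
    · rintro ⟨hm, h⟩
      obtain ⟨c, hc, hd⟩ := mem_check.1 hm
      exact ⟨c, Or.inl ((hS y c).2
        ⟨hc, (force_extend_ground hφ.boundedAll).1 (h.congr_zero hd)⟩), hd⟩

/-- Since `φ` is arbitrary, no absoluteness is available. One witness is chosen for each pair of an
index and a point, and one settled witness for each settled element. There are set-many such pairs,
so the chosen witnesses form a name. -/
theorem valid_strongCollection (φ : Fml) : Valid (strongCollection φ) := by
  classical
  have hren₁ : ∀ {x : ℝ} {d c a : Name} {e : ℕ → Name},
      Force (φ.rename (sub2 0 1 3)) x (extend d (extend c (extend a e))) ↔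
        Force φ x (extend d (extend c e)) := by
    intro x d c a e
    rw [Force.rename_iff]
    exact iff_of_eq (congrArg _ (funext fun n => by rcases n with _ | _ | n <;> rfl))
  have hren₂ : ∀ {x : ℝ} {d c b a : Name} {e : ℕ → Name},
      Force (φ.rename (sub2 0 1 4)) x (extend d (extend c (extend b (extend a e)))) ↔
        Force φ x (extend d (extend c e)) := by
    intro x d c b a e
    rw [Force.rename_iff]
    exact iff_of_eq (congrArg _ (funext fun n => by rcases n with _ | _ | n <;> rfl))
  have hren₃ : ∀ {x : ℝ} {d c b a : Name} {e : ℕ → Name},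
      Force (φ.rename (sub2 1 0 4)) x (extend d (extend c (extend b (extend a e)))) ↔
        Force φ x (extend c (extend d e)) := by
    intro x d c b a e
    rw [Force.rename_iff]
    exact iff_of_eq (congrArg _ (funext fun n => by rcases n with _ | _ | n <;> rfl))
  refine Valid.all (Valid.imp fun x e h => ?_)
  obtain ⟨a, e, rfl⟩ : ∃ a e', e = extend a e' :=
    ⟨e 0, fun n => e (n + 1), funext fun n => by cases n <;> rfl⟩
  rw [Force.ball_iff] at h
  simp only [Force, ground_extend, hren₁] at h
  have hY : ∀ (i : a.Idx) (r : ℝ), ∃ Y : Name, (∃ d, Force φ r (extend d (extend (a.elt i) e))) →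
      Force φ r (extend Y (extend (a.elt i) e)) := by
    intro i r
    by_cases h : ∃ d, Force φ r (extend d (extend (a.elt i) e))
    · exact ⟨h.choose, fun _ => h.choose_spec⟩
    · exact ⟨a, fun h' => absurd h' h⟩
  choose Y hY using hY
  -- A witness found at one point over settled parameters can itself be settled, and then works at
  -- every point.
  have hZ : ∀ (r : ℝ) (c : ZFSet.{0}), ∃ c' : ZFSet.{0},
      (∃ z d, Force φ z (extend d (extend (check c) (ground e r)))) →
      ∀ z, Force φ z (extend (check c') (extend (check c) (ground e r))) := by
    intro r c
    by_cases h : ∃ z d, Force φ z (extend d (extend (check c) (ground e r)))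
    · obtain ⟨z, d, h⟩ := h
      refine ⟨d.settle z, fun _ z' => ?_⟩
      have := h.ground z'
      rwa [ground_extend, ground_extend, ground_ground, settle_check] at this
    · exact ⟨∅, fun h' => absurd h' h⟩
  choose Z hZ using hZ
  -- Only those chosen sets are kept that really are witnesses; the second half of Strong Collection
  -- demands this.
  let B : ℝ → ZFSet.{0} := fun r => ZFSet.range fun c : {c : Shrink.{0} {c // c ∈ a.settle r} //
      ∀ z, Force φ z (extend (check (Z r ((equivShrink _).symm c).1))
        (extend (check ((equivShrink _).symm c).1) (ground e r)))} =>
    Z r ((equivShrink _).symm c.1).1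
  have hB : ∀ r c', c' ∈ B r ↔ ∃ c ∈ a.settle r, Z r c = c' ∧
      ∀ z, Force φ z (extend (check c') (extend (check c) (ground e r))) := by
    intro r c'
    simp only [B, ZFSet.mem_range, Subtype.exists]
    constructor
    · rintro ⟨s, hs, rfl⟩
      exact ⟨_, ((equivShrink _).symm s).2, rfl, hs⟩
    · rintro ⟨c, hc, rfl, h⟩
      exact ⟨equivShrink _ ⟨c, hc⟩, by simpa using h, by simp⟩
  let b : Name := .mk (a.Idx × ℝ) (fun p => Y p.1 p.2)
    (fun p => a.opn p.1 ⊓ forceOpens φ (extend (Y p.1 p.2) (extend (a.elt p.1) e))) B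
  refine ⟨b, ?_, ?_⟩
  · rw [Force.ball_iff]
    filter_upwards [h] with y hy
    refine ⟨fun d hd => ?_, fun z c hc => ?_⟩
    · obtain ⟨i, hi, hd'⟩ := hd
      obtain ⟨d', h'⟩ := hy.1 d ⟨i, hi, hd'⟩
      have := hY i y ⟨d', h'.congr_one hd'⟩
      refine ⟨Y i y, ⟨(i, y), ⟨hi, this⟩, .refl _ _⟩, hren₂.2 (this.congr_one hd'.symm)⟩
    · obtain ⟨d', h'⟩ := hy.2 z c hc
      have := hZ y c ⟨z, d', h'⟩
      refine ⟨check (Z y c), mem_check_check.2 (mem_settle.2 (Or.inl ((hB y _).2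
        ⟨c, hc, rfl, this⟩))), ?_⟩
      rw [ground_extend, ground_extend, hren₂]
      exact this z
  · rw [Force.ball_iff]
    refine .of_forall fun y => ⟨fun d hd => ?_, fun z c hc => ?_⟩
    · obtain ⟨⟨i, r⟩, hi, hd⟩ := hd
      exact ⟨a.elt i, mem_elt hi.1, hren₃.2 (Force.congr_zero hi.2 hd.symm)⟩
    · obtain ⟨c₀, hc₀, h⟩ : ∃ c₀ ∈ a.settle y,
          Force φ z (extend (check c) (extend (check c₀) (ground e y))) := by
        rcases mem_settle.1 hc with hc | ⟨⟨i, r⟩, hi, rfl⟩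
        · obtain ⟨c₀, hc₀, -, h⟩ := (hB y c).1 hc
          exact ⟨c₀, hc₀, h z⟩
        · refine ⟨_, (mem_elt hi.1).settle, ?_⟩
          have := Force.ground hi.2 z
          rwa [ground_extend, ground_extend] at this
      refine ⟨check c₀, mem_check_check.2 hc₀, ?_⟩
      rw [ground_extend, ground_extend, hren₃]
      exact h

end CZF

namespace CZF

open Fml Topology Filter TopologicalSpace Name

/-! ### Exponentiation -/

/-- `f` is a function from `a` to `b`. -/
def ZFun (f a b : ZFSet.{0}) : Prop :=
  (∀ p ∈ f, ∃ x ∈ a, ∃ y ∈ b, p = ZFSet.pair x y) ∧ (∀ x ∈ a, ∃ y ∈ b, ZFSet.pair x y ∈ f) ∧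
    ∀ x ∈ a, ∀ y ∈ b, ∀ y' ∈ b, ZFSet.pair x y ∈ f → ZFSet.pair x y' ∈ f → y = y'

theorem boundedAll_isPair (i j k : ℕ) : BoundedAll (isPair i j k) := by
  repeat' constructor

theorem boundedAll_isFun (f A B : ℕ) : BoundedAll (isFun f A B) := by
  repeat' constructor

theorem zsat_isPair {i j k : ℕ} {v : ℕ → ZFSet.{0}} :
    ZSat (isPair i j k) v ↔ v i = ZFSet.pair (v j) (v k) := by
  rw [← force_check (boundedAll_isPair i j k) (z := 0), force_isPair, eqv_check_pair]

theorem zsat_app {i j k : ℕ} {v : ℕ → ZFSet.{0}} :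
    ZSat (app i j k) v ↔ ZFSet.pair (v j) (v k) ∈ v i := by
  simp only [app, bex, ZSat, zsat_isPair]
  exact ⟨fun ⟨c, hc, h⟩ => (h : c = _) ▸ hc, fun h => ⟨_, h, rfl⟩⟩

theorem zsat_bex {i : ℕ} {φ : Fml} {v : ℕ → ZFSet.{0}} :
    ZSat (bex i φ) v ↔ ∃ c ∈ v i, ZSat φ (extend c v) := Iff.rfl

theorem zsat_ball {i : ℕ} {φ : Fml} {v : ℕ → ZFSet.{0}} :
    ZSat (ball i φ) v ↔ ∀ c ∈ v i, ZSat φ (extend c v) := Iff.rfl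

theorem zsat_isFun {f A B : ℕ} {v : ℕ → ZFSet.{0}} :
    ZSat (isFun f A B) v ↔ ZFun (v f) (v A) (v B) := by
  simp only [isFun, ZSat, zsat_ball, zsat_bex, zsat_isPair, zsat_app, ZFun, and_imp]
  exact Iff.rfl

/-- `F` is a function from `A` to `B` at a point. -/
def IsFunAt (F A B : Name) (x : ℝ) : Prop :=
  Force (isFun 0 1 2) x (extend F (extend A fun _ => B))

theorem force_isFun {f A B : ℕ} {x : ℝ} {e : ℕ → Name} :
    Force (isFun f A B) x e ↔ IsFunAt (e f) (e A) (e B) x := by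
  have : isFun f A B = (isFun 0 1 2).rename (extend f (extend A fun _ => B)) := rfl
  rw [this, Force.rename_iff, extend_comp, extend_comp]
  rfl

namespace IsFunAt

variable {F A B : Name} {x : ℝ}

theorem eventually (h : IsFunAt F A B x) : ∀ᶠ y in 𝓝 x, IsFunAt F A B y := Force.eventually h

theorem congr {F' : Name} (h : IsFunAt F A B x) (hF : Eqv F F' x) : IsFunAt F' A B x :=
  Force.congr_zero h hF

theorem zfun (h : IsFunAt F A B x) : ZFun (F.settle x) (A.settle x) (B.settle x) :=
  zsat_isFun.1 (Force.zsat (boundedAll_isFun _ _ _) h)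

theorem exists_pair (h : IsFunAt F A B x) {d : Name} (hd : Mem d F x) :
    ∃ u v, Mem u A x ∧ Mem v B x ∧ Eqv d (Name.pair u v) x := by
  obtain ⟨u, hu, v, hv, huv⟩ := (Force.ball_iff.1 h.1).self_of_nhds.1 d hd
  exact ⟨u, v, hu, hv, force_isPair.1 huv⟩

theorem exists_value (h : IsFunAt F A B x) {u : Name} (hu : Mem u A x) :
    ∃ v, Mem v B x ∧ Mem (Name.pair u v) F x := by
  obtain ⟨v, hv, huv⟩ := (Force.ball_iff.1 h.2.1).self_of_nhds.1 u hu
  exact ⟨v, hv, force_app.1 huv⟩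

end IsFunAt

theorem isFunAt_check {f a b : ZFSet.{0}} {x : ℝ} :
    IsFunAt (check f) (check a) (check b) x ↔ ZFun f a b := by
  have := force_check (boundedAll_isFun 0 1 2) (z := x) (v := extend f (extend a fun _ => b))
  rw [extend_comp, extend_comp, zsat_isFun] at this
  exact this

theorem isOpen_mem (σ τ : Name) : IsOpen {x | Mem σ τ x} :=
  isOpen_iff_mem_nhds.2 fun _ h => Mem.eventually h

/-- A function between constant names is constant near every point, because intervals are
connected. -/
theorem IsFunAt.eqv_check_settle {d : Name} {a b : ZFSet.{0}} {z : ℝ}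
    (h : IsFunAt d (check a) (check b) z) : Eqv d (check (d.settle z)) z := by
  obtain ⟨ε, hε, hU⟩ := Metric.eventually_nhds_iff_ball.1 h.eventually
  set U := Metric.ball z ε
  have hfun : ∀ y ∈ U, ZFun (d.settle y) a b := fun y hy => by simpa using (hU y hy).zfun
  have hval : ∀ y ∈ U, ∀ c ∈ a, ∃ c' ∈ b, Mem (Name.pair (check c) (check c')) d y := by
    intro y hy c hc
    obtain ⟨v, hv, hm⟩ := (hU y hy).exists_value (mem_check_check.2 hc)
    obtain ⟨c', hc', hv'⟩ := mem_check.1 hv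
    exact ⟨c', hc', hm.congr_left ((Eqv.refl _ _).pair hv')⟩
  have hset : ∀ y c c', Mem (Name.pair (check c) (check c')) d y →
      ZFSet.pair c c' ∈ d.settle y := by
    intro y c c' hm
    simpa [settle_pair] using hm.settle
  have hmem : ∀ y ∈ U, ∀ c ∈ a, ∀ c' ∈ b, ZFSet.pair c c' ∈ d.settle y →
      Mem (Name.pair (check c) (check c')) d y := by
    intro y hy c hc c' hc' hp
    obtain ⟨c'', hc'', hm⟩ := hval y hy c hc
    obtain rfl := (hfun y hy).2.2 c hc c'' hc'' c' hc' (hset y c c'' hm) hp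
    exact hm
  have hconst : ∀ y ∈ U, ∀ y' ∈ U, d.settle y ⊆ d.settle y' := by
    intro y hy y' hy' p hp
    obtain ⟨c, hc, c', hc', rfl⟩ := (hfun y hy).1 p hp
    -- The ball is covered by two disjoint open sets: where the value at `c` is `c'`, and where it
    -- is something else. Being connected and meeting the first, it lies inside it.
    let u : Set ℝ := U ∩ {x | Mem (Name.pair (check c) (check c')) d x}
    let w : Set ℝ := U ∩ ⋃ c'' ∈ {c'' | c'' ∈ b ∧ c'' ≠ c'},
      {x | Mem (Name.pair (check c) (check c'')) d x}
    have huo : IsOpen u := Metric.isOpen_ball.inter (isOpen_mem _ _)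
    have hwo : IsOpen w :=
      Metric.isOpen_ball.inter (isOpen_biUnion fun _ _ => isOpen_mem _ _)
    have hdis : Disjoint u w := by
      refine Set.disjoint_left.2 fun x hx hx' => ?_
      obtain ⟨c'', ⟨hb, hne⟩, hm⟩ := Set.mem_iUnion₂.1 hx'.2
      exact hne ((hfun x hx.1).2.2 c hc c'' hb c' hc' (hset _ _ _ hm) (hset _ _ _ hx.2))
    have hcov : U ⊆ u ∪ w := by
      intro x hx
      obtain ⟨c'', hb, hm⟩ := hval x hx c hc
      by_cases hcc : c'' = c'
      · exact Or.inl ⟨hx, hcc ▸ hm⟩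
      · exact Or.inr ⟨hx, Set.mem_iUnion₂.2 ⟨c'', ⟨hb, hcc⟩, hm⟩⟩
    have hsub := IsPreconnected.subset_left_of_subset_union huo hwo hdis hcov
      ⟨y, hy, hy, hmem y hy c hc c' hc' hp⟩ (convex_ball z ε).isPreconnected
    exact hset _ _ _ (hsub hy').2
  have hz : z ∈ U := Metric.mem_ball_self hε
  refine eqv_of_forall_mem ?_
  filter_upwards [Metric.ball_mem_nhds z hε] with y hy
  have hyz : d.settle y = d.settle z :=
    ZFSet.ext fun p => ⟨fun hp => hconst y hy z hz hp, fun hp => hconst z hz y hy hp⟩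
  refine ⟨by rw [settle_check, hyz], fun d' => ⟨fun hd => ?_, fun hd => ?_⟩⟩
  · obtain ⟨u, v, hu, hv, huv⟩ := (hU y hy).exists_pair hd
    obtain ⟨c, hc, hu⟩ := mem_check.1 hu
    obtain ⟨c', hc', hv⟩ := mem_check.1 hv
    have hd' := huv.trans (hu.pair hv)
    refine mem_check.2 ⟨ZFSet.pair c c', ?_, hd'.trans (eqv_check_pair.2 rfl).symm⟩
    rw [← hyz]
    exact hset y c c' (hd.congr_left hd')
  · obtain ⟨p, hp, hd⟩ := mem_check.1 hd
    rw [← hyz] at hp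
    obtain ⟨c, hc, c', hc', rfl⟩ := (hfun y hy).1 p hp
    exact (hmem y hy c hc c' hc' hp).congr_left (hd.trans (eqv_check_pair.2 rfl)).symm

/-- The possible jumps of a subset of the product of two names. -/
abbrev Jump (σ τ : Name) : Type :=
  (r : ℝ) → Shrink.{0} {c // c ∈ ZFSet.powerset (ZFSet.prod (σ.settle r) (τ.settle r))}

/-- The value of a jump. -/
noncomputable def Jump.val {σ τ : Name} (g : Jump σ τ) (r : ℝ) : ZFSet.{0} :=
  ((equivShrink _).symm (g r)).1

/-- A canonical name for a subset of the product of two names. -/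
noncomputable def relName (σ τ : Name) (O : σ.Idx → τ.Idx → Opens ℝ) (g : Jump σ τ) : Name :=
  .mk (σ.Idx × τ.Idx) (fun p => Name.pair (σ.elt p.1) (τ.elt p.2)) (fun p => O p.1 p.2) g.val

/-- A function is recovered from the open sets on which it contains the pair of the `i`-th and the
`j`-th element, together with its settled values. This data ranges over a small type, which is what
replaces Power Set. -/
theorem IsFunAt.exists_eqv_relName {d σ τ : Name} {x : ℝ} (h : IsFunAt d σ τ x) :
    ∃ O g, Eqv d (relName σ τ O g) x := by
  classical
  have hsub : ∀ {y}, IsFunAt d σ τ y →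
      d.settle y ∈ ZFSet.powerset (ZFSet.prod (σ.settle y) (τ.settle y)) := by
    intro y hy
    refine ZFSet.mem_powerset.2 fun p hp => ?_
    obtain ⟨a, ha, b, hb, rfl⟩ := hy.zfun.1 p hp
    exact ZFSet.pair_mem_prod.2 ⟨ha, hb⟩
  have hg : ∀ r, ∃ s : Shrink.{0}
      {c // c ∈ ZFSet.powerset (ZFSet.prod (σ.settle r) (τ.settle r))},
      IsFunAt d σ τ r → ((equivShrink _).symm s).1 = d.settle r := by
    intro r
    by_cases hr : IsFunAt d σ τ r
    · exact ⟨equivShrink _ ⟨_, hsub hr⟩, fun _ => by simp⟩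
    -- Where `d` is not a function the jump is `∅`; such points are never used, since `d` is a
    -- function near `x`.
    · exact ⟨equivShrink _ ⟨∅, ZFSet.mem_powerset.2 (ZFSet.empty_subset _)⟩,
        fun h => absurd h hr⟩
  choose g hg using hg
  let O : σ.Idx → τ.Idx → Opens ℝ := fun i j => σ.opn i ⊓ τ.opn j ⊓
    ⟨{y | Mem (Name.pair (σ.elt i) (τ.elt j)) d y}, isOpen_mem _ _⟩
  refine ⟨O, g, eqv_of_forall_mem ?_⟩
  filter_upwards [h.eventually] with y hy
  constructor
  · ext c
    rw [mem_settle (σ := relName σ τ O g)]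
    constructor
    · intro hc
      left
      change c ∈ ((equivShrink _).symm (g y)).1
      rwa [hg y hy]
    · rintro (hc | ⟨⟨i, j⟩, hi, rfl⟩)
      · change c ∈ ((equivShrink _).symm (g y)).1 at hc
        rwa [hg y hy] at hc
      · exact Mem.settle hi.2
  · intro d'
    constructor
    · intro hd
      obtain ⟨u, v, ⟨i, hi, hu⟩, ⟨j, hj, hv⟩, huv⟩ := hy.exists_pair hd
      have hd' := huv.trans (hu.pair hv)
      exact ⟨(i, j), ⟨⟨hi, hj⟩, hd.congr_left hd'⟩, hd'⟩
    · rintro ⟨⟨i, j⟩, hi, hd⟩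
      exact Mem.congr_left hi.2 hd.symm

/-- The index type consists of all canonical data, each name being restricted to the open set where
it is a function. The settled value is the classical function set, which is complete over constant
parameters by `IsFunAt.eqv_check_settle`. -/
theorem valid_exponentiation : Valid exponentiation := by
  refine Valid.all (Valid.all fun x e => ?_)
  generalize hσ : e 1 = σ
  generalize hτ : e 0 = τ
  obtain ⟨S, hS⟩ : ∃ S : ℝ → ZFSet.{0}, ∀ r c, c ∈ S r ↔ ZFun c (σ.settle r) (τ.settle r) := by
    refine ⟨fun r => (ZFSet.powerset (ZFSet.prod (σ.settle r) (τ.settle r))).sep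
      fun c => ZFun c (σ.settle r) (τ.settle r), fun r c => ?_⟩
    rw [ZFSet.mem_sep, and_iff_right_iff_imp]
    refine fun h => ZFSet.mem_powerset.2 fun p hp => ?_
    obtain ⟨a, ha, b, hb, rfl⟩ := h.1 p hp
    exact ZFSet.pair_mem_prod.2 ⟨ha, hb⟩
  refine force_ex_set (.mk ((σ.Idx → τ.Idx → Opens ℝ) × Jump σ τ) (fun p => relName σ τ p.1 p.2)
    (fun p => ⟨{y | IsFunAt (relName σ τ p.1 p.2) σ τ y},
      isOpen_iff_mem_nhds.2 fun _ h => IsFunAt.eventually h⟩) S)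
    (.of_forall fun y => ⟨fun d => ?_, fun z d => ?_⟩)
  · rw [force_isFun]
    change _ ↔ IsFunAt d (e 1) (e 0) y
    rw [hσ, hτ]
    constructor
    · rintro ⟨p, hp, hd⟩
      exact IsFunAt.congr hp hd.symm
    · intro h
      obtain ⟨O, g, hd⟩ := h.exists_eqv_relName
      exact ⟨(O, g), h.congr hd, hd⟩
  · rw [force_isFun]
    change _ ↔ IsFunAt d (check ((e 1).settle y)) (check ((e 0).settle y)) z
    rw [hσ, hτ, mem_check]
    constructor
    · rintro ⟨c, hc, hd⟩
      have hc' : ZFun c (σ.settle y) (τ.settle y) := by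
        rcases mem_settle.1 hc with hc | ⟨p, hp, rfl⟩
        · exact (hS y c).1 hc
        · exact IsFunAt.zfun hp
      exact (isFunAt_check.2 hc').congr hd.symm
    · intro h
      refine ⟨d.settle z, mem_settle.2 (Or.inl ((hS y _).2 ?_)), h.eqv_check_settle⟩
      simpa using h.zfun

/-! ### Infinity -/

/-- The von Neumann numerals. -/
noncomputable def nat : ℕ → ZFSet.{0}
  | 0 => ∅
  | n + 1 => insert (nat n) (nat n)

/-- The set of the von Neumann numerals. -/
noncomputable def omega : ZFSet.{0} := ZFSet.range nat

theorem mem_omega {c : ZFSet.{0}} : c ∈ omega ↔ ∃ n, nat n = c := ZFSet.mem_range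

theorem force_bex_check {i : ℕ} {φ : Fml} {x : ℝ} {e : ℕ → Name} {s : ZFSet.{0}}
    (h : e i = check s) :
    Force (bex i φ) x e ↔ ∃ c ∈ s, Force φ x (extend (check c) e) := by
  rw [Force.bex_iff, h]
  exact exists_idx_check (P := fun n => Force φ x (extend n e))

theorem force_isEmpty {i : ℕ} {x : ℝ} {e : ℕ → Name} :
    Force (isEmpty i) x e ↔ Eqv (e i) (check ∅) x := by
  rw [isEmpty, Force.ball_iff]
  constructor
  · intro h
    refine eqv_of_forall_mem (h.mono fun y hy => ⟨?_, fun d => ⟨fun hd => (hy.1 d hd).elim, ?_⟩⟩)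
    · rw [settle_check, ZFSet.eq_empty]
      exact fun c hc => hy.2 0 c hc
    · intro hd
      obtain ⟨c, hc, -⟩ := mem_check.1 hd
      exact absurd hc (ZFSet.notMem_empty c)
  · intro h
    filter_upwards [h.eventually] with y hy
    refine ⟨fun d hd => ?_, fun z c hc => ?_⟩
    · obtain ⟨c, hc, -⟩ := mem_check.1 (hd.congr_right hy)
      exact ZFSet.notMem_empty c hc
    · rw [hy.settle_eq, settle_check] at hc
      exact ZFSet.notMem_empty c hc

theorem boundedAll_isSucc (i j : ℕ) : BoundedAll (isSucc i j) := by
  repeat' constructor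

theorem boundedAll_isEmpty (i : ℕ) : BoundedAll (isEmpty i) := by
  repeat' constructor

theorem zsat_isEmpty {i : ℕ} {v : ℕ → ZFSet.{0}} : ZSat (isEmpty i) v ↔ v i = ∅ := by
  rw [ZFSet.eq_empty]; exact Iff.rfl

theorem eq_insert_self_iff {s c : ZFSet.{0}} :
    s = insert c c ↔ c ∈ s ∧ (∀ c' ∈ c, c' ∈ s) ∧ ∀ c' ∈ s, c' ∈ c ∨ c' = c := by
  constructor
  · rintro rfl
    exact ⟨by simp, fun c hc => by simp [hc], fun c hc => by simpa [or_comm] using hc⟩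
  · rintro ⟨h₁, h₂, h₃⟩
    ext c
    rw [ZFSet.mem_insert_iff]
    exact ⟨fun h => (h₃ c h).symm, fun h => h.elim (fun h => h ▸ h₁) (h₂ c)⟩

theorem zsat_isSucc {i j : ℕ} {v : ℕ → ZFSet.{0}} :
    ZSat (isSucc i j) v ↔ v i = insert (v j) (v j) :=
  eq_insert_self_iff.symm

theorem force_isSucc_check {i j : ℕ} {x : ℝ} {e : ℕ → Name} {c : ZFSet.{0}}
    (hj : e j = check c) : Force (isSucc i j) x e ↔ Eqv (e i) (check (insert c c)) x := by
  constructor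
  · rintro ⟨h₁, h₂, h₃⟩
    rw [isSubset, Force.ball_iff] at h₂
    rw [Force.ball_iff] at h₃
    refine eqv_of_forall_mem ?_
    filter_upwards [Mem.eventually h₁, h₂, h₃] with y h₁ h₂ h₃
    rw [hj] at h₁ h₂
    constructor
    · rw [settle_check]
      refine eq_insert_self_iff.2 ⟨?_, fun c' hc' => ?_, fun c' hc' => ?_⟩
      · simpa [extend] using h₁.settle
      · exact mem_check_check.1 (h₂.2 0 c' (by simpa using hc'))
      · refine (h₃.2 0 c' hc').imp (fun h => ?_) fun h => ?_
        · have : Mem (check c') (check ((e j).settle y)) 0 := h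
          simpa [hj, mem_check_check] using this
        · have : Eqv (check c') (check ((e j).settle y)) 0 := h
          simpa [hj, eqv_check] using this
    · intro d
      constructor
      · intro hd
        rcases h₃.1 d hd with h | h
        · have h : Mem d (e j) y := h
          rw [hj] at h
          obtain ⟨c', hc', h⟩ := mem_check.1 h
          exact mem_check.2 ⟨c', by simp [hc'], h⟩
        · have h : Eqv d (e j) y := h
          exact mem_check.2 ⟨c, by simp, hj ▸ h⟩
      · intro hd
        obtain ⟨c', hc', hd'⟩ := mem_check.1 hd
        rcases ZFSet.mem_insert_iff.1 hc' with rfl | hc'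
        · exact h₁.congr_left hd'.symm
        · exact h₂.1 d (mem_check.2 ⟨c', hc', hd'⟩)
  · intro h
    have hr : isSucc i j = (isSucc 0 1).rename (extend i fun _ => j) := rfl
    rw [hr, Force.rename_iff, extend_comp, hj]
    refine Force.congr_zero ?_ h.symm
    have := force_check (boundedAll_isSucc 0 1) (z := x) (v := extend (insert c c) fun _ => c)
    rw [extend_comp] at this
    exact this.2 (zsat_isSucc.2 rfl)

/-- Members of the constant name of `omega` are near each point equal to a fixed numeral, and zero
and successors of constants are constant. So the standard numerals are the natural numbers of the
model. -/
theorem force_isOmega {w : ℕ} {x : ℝ} {e : ℕ → Name} (hw : e w = check omega) :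
    Force (isOmega w) x e := by
  have key : ∀ (x : ℝ) (d : Name) (e : ℕ → Name), e w = check omega →
      (Force (mem 0 (w + 1)) x (extend d e) ↔
        Force (disj (isEmpty 0) (bex (w + 1) (isSucc 1 0))) x (extend d e)) := by
    intro x d e hw
    have hw' : extend d e (w + 1) = check omega := hw
    rw [Force, Force, force_isEmpty, force_bex_check hw', hw', mem_check]
    have hs : ∀ c, Force (isSucc 1 0) x (extend (check c) (extend d e)) ↔
        Eqv d (check (insert c c)) x := fun c => force_isSucc_check rfl
    simp only [hs, mem_omega]
    constructor
    · rintro ⟨c, ⟨n, rfl⟩, h⟩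
      cases n with
      | zero => exact Or.inl h
      | succ n => exact Or.inr ⟨_, ⟨n, rfl⟩, h⟩
    · rintro (h | ⟨_, ⟨n, rfl⟩, h⟩)
      · exact ⟨_, ⟨0, rfl⟩, h⟩
      · exact ⟨_, ⟨n + 1, rfl⟩, h⟩
  rw [isOmega, Force.all_iff_iff]
  exact .of_forall fun y => ⟨fun d => key y d e hw, fun z d => key z d _ (by simp [ground, hw])⟩

theorem valid_infinity : Valid infinity := fun _ _ => ⟨check omega, force_isOmega rfl⟩

theorem valid_CZFExp {φ : Fml} (h : φ ∈ CZFExp) : Valid φ := by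
  cases h with
  | extensionality => exact valid_extensionality
  | pairing => exact valid_pairing
  | union => exact valid_union
  | infinity => exact valid_infinity
  | setInduction φ => exact valid_setInduction φ
  | boundedSeparation φ h => exact valid_separation h
  | strongCollection φ => exact valid_strongCollection φ
  | exponentiation => exact valid_exponentiation

end CZF

namespace CZF

open Fml Topology Filter TopologicalSpace Name

/-! ### Arithmetic in the universe of sets -/

theorem mem_nat {n : ℕ} {c : ZFSet.{0}} : c ∈ nat n ↔ ∃ m < n, c = nat m := by
  induction n with
  | zero => simp [nat]
  | succ n ih =>
    rw [nat, ZFSet.mem_insert_iff, ih]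
    constructor
    · rintro (rfl | ⟨m, hm, rfl⟩)
      · exact ⟨n, n.lt_succ_self, rfl⟩
      · exact ⟨m, hm.trans n.lt_succ_self, rfl⟩
    · rintro ⟨m, hm, rfl⟩
      rcases Nat.lt_succ_iff_lt_or_eq.1 hm with hm | rfl
      · exact Or.inr ⟨m, hm, rfl⟩
      · exact Or.inl rfl

theorem nat_injective : Function.Injective nat := by
  have h : ∀ {m n : ℕ}, m < n → nat m ≠ nat n := fun {m n} hmn he =>
    ZFSet.mem_irrefl (nat n) (mem_nat.2 ⟨m, hmn, he.symm⟩)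
  intro m n he
  rcases lt_trichotomy m n with hmn | rfl | hmn
  · exact absurd he (h hmn)
  · rfl
  · exact absurd he.symm (h hmn)

theorem nat_mem_nat {m n : ℕ} : nat m ∈ nat n ↔ m < n := by
  simp [mem_nat, nat_injective.eq_iff]

theorem nat_eq_empty {n : ℕ} : nat n = ∅ ↔ n = 0 := nat_injective.eq_iff (b := 0)

theorem exists_mem_omega {P : ZFSet.{0} → Prop} : (∃ c ∈ omega, P c) ↔ ∃ n, P (nat n) := by
  simp [mem_omega]

theorem forall_mem_omega {P : ZFSet.{0} → Prop} : (∀ c ∈ omega, P c) ↔ ∀ n, P (nat n) := by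
  simp [mem_omega]

/-- Any function admitted by the formula agrees with the iteration by induction on the argument;
conversely, the graph of the iteration is admitted. -/
theorem zsat_isRec {w b c : ℕ} {base : ℕ → ℕ → Fml} {step : ℕ → ℕ → ℕ → Fml}
    {v : ℕ → ZFSet.{0}} {k : ℕ} (B : ℕ) (S : ℕ → ℕ) (hw : v w = omega) (hb : v b = nat k)
    (hbase : ∀ h z x, ZSat (base 3 0) (extend (nat x) (extend z (extend h v))) ↔ x = B)
    (hstep : ∀ h i i' x y, ZSat (step 5 1 0)
      (extend (nat y) (extend (nat x) (extend i' (extend i (extend h v))))) ↔ y = S x) :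
    ZSat (isRec w b c base step) v ↔ v c = nat (S^[k] B) := by
  have hsem : ZSat (isRec w b c base step) v ↔ ∃ h, ZFun h omega omega ∧
      (∃ x, ZFSet.pair ∅ (nat x) ∈ h ∧ x = B) ∧
      (∀ i x y, ZFSet.pair (nat i) (nat x) ∈ h → ZFSet.pair (nat (i + 1)) (nat y) ∈ h →
        y = S x) ∧ ZFSet.pair (nat k) (v c) ∈ h := by
    rw [isRec]
    simp only [ZSat, zsat_bex, zsat_ball, zsat_isFun, zsat_isEmpty, zsat_isSucc, zsat_app]
    refine exists_congr fun h => ?_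
    simp only [extend, hw, hb, exists_mem_omega, forall_mem_omega, hbase, hstep]
    refine and_congr_right fun _ => and_congr ?_ (and_congr_left fun _ => ?_)
    · constructor
      · rintro ⟨z, x, hz, h₁, h₂⟩
        exact ⟨x, hz ▸ h₁, h₂⟩
      · rintro ⟨x, h₁, h₂⟩
        exact ⟨0, x, rfl, h₁, h₂⟩
    · constructor
      · exact fun H i x y h₁ h₂ => H i (i + 1) x y ⟨rfl, h₁, h₂⟩
      · rintro H i j x y ⟨hj, h₁, h₂⟩
        exact H i x y h₁ (by rw [nat, ← hj]; exact h₂)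
  rw [hsem]
  constructor
  · rintro ⟨h, hf, ⟨x, h₀, rfl⟩, hs, hk⟩
    have hall : ∀ n, ZFSet.pair (nat n) (nat (S^[n] x)) ∈ h := by
      intro n
      induction n with
      | zero => exact h₀
      | succ n ih =>
        obtain ⟨y, hy, hp⟩ := hf.2.1 (nat (n + 1)) (mem_omega.2 ⟨_, rfl⟩)
        obtain ⟨y, rfl⟩ := mem_omega.1 hy
        rw [Function.iterate_succ_apply', ← hs n _ y ih hp]
        exact hp
    obtain ⟨x', -, y, hy, hp⟩ := hf.1 _ hk
    obtain ⟨-, rfl⟩ := ZFSet.pair_inj.1 hp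
    exact hf.2.2 _ (mem_omega.2 ⟨k, rfl⟩) _ hy _ (mem_omega.2 ⟨_, rfl⟩) hk (hall k)
  · intro hc
    have hmem : ∀ i y, ZFSet.pair (nat i) y ∈
        ZFSet.range (fun n => ZFSet.pair (nat n) (nat (S^[n] B))) ↔ y = nat (S^[i] B) := by
      intro i y
      simp only [ZFSet.mem_range, ZFSet.pair_inj]
      constructor
      · rintro ⟨n, h₁, rfl⟩
        rw [nat_injective h₁]
      · rintro rfl
        exact ⟨i, rfl, rfl⟩
    refine ⟨ZFSet.range fun n => ZFSet.pair (nat n) (nat (S^[n] B)), ⟨?_, ?_, ?_⟩,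
      ⟨B, (hmem 0 _).2 rfl, rfl⟩, ?_, (hmem _ _).2 hc⟩
    · intro p hp
      obtain ⟨n, rfl⟩ := ZFSet.mem_range.1 hp
      exact ⟨_, mem_omega.2 ⟨n, rfl⟩, _, mem_omega.2 ⟨_, rfl⟩, rfl⟩
    · rw [forall_mem_omega]
      exact fun n => ⟨_, mem_omega.2 ⟨_, rfl⟩, (hmem n _).2 rfl⟩
    · rw [forall_mem_omega]
      intro n y _ y' _ h h'
      rw [(hmem n y).1 h, (hmem n y').1 h']
    · intro i x y h h'
      rw [hmem] at h h'
      rw [nat_injective h, nat_injective h', Function.iterate_succ_apply']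

theorem zsat_isAdd {w a b c m n : ℕ} {v : ℕ → ZFSet.{0}} (hw : v w = omega) (ha : v a = nat m)
    (hb : v b = nat n) : ZSat (isAdd w a b c) v ↔ v c = nat (m + n) := by
  rw [isAdd, zsat_isRec m Nat.succ hw hb, Nat.succ_iterate]
  · intro h z x
    change nat x = v a ↔ _
    rw [ha, nat_injective.eq_iff]
  · intro h i i' x y
    rw [zsat_isSucc]
    change nat y = nat (x + 1) ↔ _
    rw [nat_injective.eq_iff]

theorem zsat_isMul {w a b c m n : ℕ} {v : ℕ → ZFSet.{0}} (hw : v w = omega) (ha : v a = nat m)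
    (hb : v b = nat n) : ZSat (isMul w a b c) v ↔ v c = nat (m * n) := by
  have hit : (fun x => x + m)^[n] 0 = m * n := by
    clear hb
    induction n with
    | zero => rfl
    | succ n ih => rw [Function.iterate_succ_apply', ih, Nat.mul_succ]
  rw [isMul, zsat_isRec 0 (fun x => x + m) hw hb, hit]
  · intro h z x
    rw [zsat_isEmpty]
    exact nat_eq_empty
  · intro h i i' x y
    exact Iff.trans (zsat_isAdd (m := x) (n := m) (by exact hw) (by rfl) (by exact ha))
      (nat_injective.eq_iff (a := y))

theorem zsat_isMulAddMul {w a b c d m A B C D : ℕ} {v : ℕ → ZFSet.{0}} (hw : v w = omega)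
    (ha : v a = nat A) (hb : v b = nat B) (hc : v c = nat C) (hd : v d = nat D) :
    ZSat (isMulAddMul w a b c d m) v ↔ v m = nat (A * B + C * D) := by
  have hw₁ : ∀ s : ZFSet.{0}, extend s v (w + 1) = omega := fun s => hw
  simp only [isMulAddMul, zsat_bex, hw, hw₁, exists_mem_omega, ZSat]
  have h₁ : ∀ x y : ℕ, ZSat (isMul (w + 2) (a + 2) (b + 2) 1) (extend (nat y) (extend (nat x) v)) ↔
      x = A * B := fun x y => Iff.trans (zsat_isMul (m := A) (n := B) (by exact hw) (by exact ha)
        (by exact hb)) (nat_injective.eq_iff (a := x))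
  have h₂ : ∀ x y : ℕ, ZSat (isMul (w + 2) (c + 2) (d + 2) 0) (extend (nat y) (extend (nat x) v)) ↔
      y = C * D := fun x y => Iff.trans (zsat_isMul (m := C) (n := D) (by exact hw) (by exact hc)
        (by exact hd)) (nat_injective.eq_iff (a := y))
  have h₃ : ∀ x y : ℕ, ZSat (isAdd (w + 2) 1 0 (m + 2)) (extend (nat y) (extend (nat x) v)) ↔
      v m = nat (x + y) := fun x y => zsat_isAdd (m := x) (n := y) (by exact hw) (by rfl) (by rfl)
  simp only [h₁, h₂, h₃]
  simp

theorem zsat_fracEq {w a b d a' b' d' A B D A' B' D' : ℕ} {v : ℕ → ZFSet.{0}} (hw : v w = omega)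
    (ha : v a = nat A) (hb : v b = nat B) (hd : v d = nat D) (ha' : v a' = nat A')
    (hb' : v b' = nat B') (hd' : v d' = nat D') :
    ZSat (fracEq w a b d a' b' d') v ↔ A * D' + B' * D = A' * D + B * D' := by
  simp only [fracEq, zsat_bex, hw, exists_mem_omega, ZSat]
  have h₁ : ∀ x : ℕ, ZSat (isMulAddMul (w + 1) (a + 1) (d' + 1) (b' + 1) (d + 1) 0)
      (extend (nat x) v) ↔ x = A * D' + B' * D :=
    fun x => Iff.trans (zsat_isMulAddMul (A := A) (B := D') (C := B') (D := D) (by exact hw)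
      (by exact ha) (by exact hd') (by exact hb') (by exact hd)) (nat_injective.eq_iff (a := x))
  have h₂ : ∀ x : ℕ, ZSat (isMulAddMul (w + 1) (a' + 1) (d + 1) (b + 1) (d' + 1) 0)
      (extend (nat x) v) ↔ x = A' * D + B * D' :=
    fun x => Iff.trans (zsat_isMulAddMul (A := A') (B := D) (C := B) (D := D') (by exact hw)
      (by exact ha') (by exact hd) (by exact hb) (by exact hd')) (nat_injective.eq_iff (a := x))
  simp only [h₁, h₂, exists_eq_left]

/-- The set that codes a triple of natural numbers. -/
noncomputable def triple (a b d : ℕ) : ZFSet.{0} :=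
  ZFSet.pair (ZFSet.pair (nat a) (nat b)) (nat d)

theorem triple_inj {a b d a' b' d' : ℕ} :
    triple a b d = triple a' b' d' ↔ a = a' ∧ b = b' ∧ d = d' := by
  simp only [triple, ZFSet.pair_inj, nat_injective.eq_iff, and_assoc]

theorem zsat_isTriple {t a b d : ℕ} {v : ℕ → ZFSet.{0}} : ZSat (isTriple t a b d) v ↔
    v t = ZFSet.pair (ZFSet.pair (v a) (v b)) (v d) := by
  simp only [isTriple, zsat_bex, ZSat, zsat_isPair]
  constructor
  · rintro ⟨x, hx, p, hp, h₁, h₂⟩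
    exact h₁ ▸ h₂
  · intro h
    refine ⟨{ZFSet.pair (v a) (v b)}, ?_, ZFSet.pair (v a) (v b), ?_, rfl, h⟩
    · rw [h]; simp [ZFSet.pair]
    · change _ ∈ ({_} : ZFSet.{0}); simp

/-- The value of a fraction. -/
def fracVal (a b d : ℕ) : ℚ := ((a : ℚ) - b) / d

theorem fracVal_eq_iff {a b d a' b' d' : ℕ} (hd : d ≠ 0) (hd' : d' ≠ 0) :
    fracVal a b d = fracVal a' b' d' ↔ a * d' + b' * d = a' * d + b * d' := by
  have h : (d : ℚ) ≠ 0 := by exact_mod_cast hd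
  have h' : (d' : ℚ) ≠ 0 := by exact_mod_cast hd'
  rw [fracVal, fracVal, div_eq_div_iff h h', ← Nat.cast_inj (R := ℚ)]
  push_cast
  constructor <;> intro H <;> linarith

theorem fracVal_lt_iff {a b d a' b' d' : ℕ} (hd : d ≠ 0) (hd' : d' ≠ 0) :
    fracVal a b d < fracVal a' b' d' ↔ a * d' + b' * d < a' * d + b * d' := by
  have h : (0 : ℚ) < d := by exact_mod_cast Nat.pos_of_ne_zero hd
  have h' : (0 : ℚ) < d' := by exact_mod_cast Nat.pos_of_ne_zero hd'
  rw [fracVal, fracVal, div_lt_div_iff₀ h h', ← Nat.cast_lt (α := ℚ)]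
  push_cast
  constructor <;> intro H <;> linarith

theorem exists_fracVal (q : ℚ) : ∃ a b d, d ≠ 0 ∧ fracVal a b d = q := by
  -- The numerator is split into its positive and negative parts.
  refine ⟨q.num.toNat, (-q.num).toNat, q.den, q.den_nz, ?_⟩
  have h : ((q.num.toNat : ℤ) : ℚ) - (((-q.num).toNat : ℤ) : ℚ) = q.num := by
    exact_mod_cast Int.toNat_sub_toNat_neg q.num
  rw [fracVal]
  conv_rhs => rw [← Rat.num_div_den q]
  exact_mod_cast congrArg (· / (q.den : ℚ)) h

/-- The set that codes a rational number. -/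
noncomputable def ratCode (q : ℚ) : ZFSet.{0} :=
  ZFSet.range fun t : {t : ℕ × ℕ × ℕ // t.2.2 ≠ 0 ∧ fracVal t.1 t.2.1 t.2.2 = q} =>
    triple t.1.1 t.1.2.1 t.1.2.2

theorem mem_ratCode {q : ℚ} {c : ZFSet.{0}} :
    c ∈ ratCode q ↔ ∃ a b d, d ≠ 0 ∧ fracVal a b d = q ∧ triple a b d = c := by
  rw [ratCode, ZFSet.mem_range]
  constructor
  · rintro ⟨⟨⟨a, b, d⟩, h₁, h₂⟩, h₃⟩
    exact ⟨a, b, d, h₁, h₂, h₃⟩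
  · rintro ⟨a, b, d, h₁, h₂, h₃⟩
    exact ⟨⟨⟨a, b, d⟩, h₁, h₂⟩, h₃⟩

theorem triple_mem_ratCode {q : ℚ} {a b d : ℕ} :
    triple a b d ∈ ratCode q ↔ d ≠ 0 ∧ fracVal a b d = q := by
  rw [mem_ratCode]
  constructor
  · rintro ⟨a', b', d', h₁, h₂, h₃⟩
    obtain ⟨rfl, rfl, rfl⟩ := triple_inj.1 h₃
    exact ⟨h₁, h₂⟩
  · rintro ⟨h₁, h₂⟩
    exact ⟨a, b, d, h₁, h₂, rfl⟩

theorem ratCode_injective : Function.Injective ratCode := by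
  intro p q h
  obtain ⟨a, b, d, hd, rfl⟩ := exists_fracVal p
  have := triple_mem_ratCode.2 (⟨hd, rfl⟩ : d ≠ 0 ∧ fracVal a b d = _)
  rw [h] at this
  exact (triple_mem_ratCode.1 this).2

/-- The set of the codes of rational numbers. -/
noncomputable def rationals : ZFSet.{0} := ZFSet.range ratCode

theorem mem_rationals {c : ZFSet.{0}} : c ∈ rationals ↔ ∃ q, ratCode q = c := ZFSet.mem_range

theorem zsat_hasRep {q a b d A B D : ℕ} {v : ℕ → ZFSet.{0}} (ha : v a = nat A) (hb : v b = nat B)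
    (hd : v d = nat D) : ZSat (hasRep q a b d) v ↔ triple A B D ∈ v q := by
  simp only [hasRep, zsat_bex, zsat_isTriple, extend, ha, hb, hd]
  exact exists_eq_right

theorem zsat_ratLt {w q q' : ℕ} {v : ℕ → ZFSet.{0}} {r s : ℚ} (hw : v w = omega)
    (hq : v q = ratCode r) (hq' : v q' = ratCode s) : ZSat (ratLt w q q') v ↔ r < s := by
  have hsem : ZSat (ratLt w q q') v ↔ ∃ a b d a' b' d' : ℕ, triple a b d ∈ ratCode r ∧
      triple a' b' d' ∈ ratCode s ∧ a * d' + b' * d < a' * d + b * d' := by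
    simp only [ratLt, withReps, zsat_bex, ZSat, extend, hw, exists_mem_omega]
    refine exists_congr fun a => exists_congr fun b => exists_congr fun d => exists_congr fun a' =>
      exists_congr fun b' => exists_congr fun d' => ?_
    refine and_congr (Iff.trans (zsat_hasRep (A := a) (B := b) (D := d) (by rfl) (by rfl) (by rfl))
      (iff_of_eq (congrArg (fun c => triple a b d ∈ c) hq))) (and_congr (Iff.trans (zsat_hasRep (A := a') (B := b') (D := d')
        (by rfl) (by rfl) (by rfl)) (iff_of_eq (congrArg (fun c => triple a' b' d' ∈ c) hq'))) ?_)
    have h₁ : ∀ x y : ℕ, ZSat (isMulAddMul (w + 8) 7 2 3 5 1) (extend (nat y) (extend (nat x)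
        (extend (nat d') (extend (nat b') (extend (nat a') (extend (nat d) (extend (nat b)
          (extend (nat a) v)))))))) ↔ x = a * d' + b' * d := fun x y =>
      Iff.trans (zsat_isMulAddMul (A := a) (B := d') (C := b') (D := d) (by exact hw) (by rfl)
        (by rfl) (by rfl) (by rfl)) (nat_injective.eq_iff (a := x))
    have h₂ : ∀ x y : ℕ, ZSat (isMulAddMul (w + 8) 4 5 6 2 0) (extend (nat y) (extend (nat x)
        (extend (nat d') (extend (nat b') (extend (nat a') (extend (nat d) (extend (nat b)
          (extend (nat a) v)))))))) ↔ y = a' * d + b * d' := fun x y =>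
      Iff.trans (zsat_isMulAddMul (A := a') (B := d) (C := b) (D := d') (by exact hw) (by rfl)
        (by rfl) (by rfl) (by rfl)) (nat_injective.eq_iff (a := y))
    simp only [h₁, h₂, nat_mem_nat, exists_and_left, exists_eq_left]
  rw [hsem]
  constructor
  · rintro ⟨a, b, d, a', b', d', h, h', hlt⟩
    obtain ⟨hd, rfl⟩ := triple_mem_ratCode.1 h
    obtain ⟨hd', rfl⟩ := triple_mem_ratCode.1 h'
    exact (fracVal_lt_iff hd hd').2 hlt
  · intro hlt
    obtain ⟨a, b, d, hd, rfl⟩ := exists_fracVal r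
    obtain ⟨a', b', d', hd', rfl⟩ := exists_fracVal s
    exact ⟨a, b, d, a', b', d', triple_mem_ratCode.2 ⟨hd, rfl⟩, triple_mem_ratCode.2 ⟨hd', rfl⟩,
      (fracVal_lt_iff hd hd').1 hlt⟩

end CZF

namespace CZF

open Fml Topology Filter TopologicalSpace Name

/-! ### The rational numbers in the model of names -/

theorem BoundedAll.neg {φ : Fml} (h : BoundedAll φ) : BoundedAll (neg φ) := .imp h .bot

theorem boundedAll_isAdd (w a b c : ℕ) : BoundedAll (isAdd w a b c) := by
  unfold isAdd isRec
  repeat' constructor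

theorem boundedAll_isMul (w a b c : ℕ) : BoundedAll (isMul w a b c) := by
  have h := boundedAll_isAdd (w + 5) 1 (a + 5) 0
  unfold isMul isRec
  repeat' first | exact h | constructor

theorem boundedAll_isMulAddMul (w a b c d m : ℕ) : BoundedAll (isMulAddMul w a b c d m) :=
  .bex _ (.bex _ (.conj (boundedAll_isMul _ _ _ _) (.conj (boundedAll_isMul _ _ _ _)
    (boundedAll_isAdd _ _ _ _))))

theorem boundedAll_fracEq (w a b d a' b' d' : ℕ) : BoundedAll (fracEq w a b d a' b' d') :=
  .bex _ (.conj (boundedAll_isMulAddMul _ _ _ _ _ _) (boundedAll_isMulAddMul _ _ _ _ _ _))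

theorem boundedAll_hasRep (q a b d : ℕ) : BoundedAll (hasRep q a b d) := by
  repeat' constructor

theorem boundedAll_ratLt (w q q' : ℕ) : BoundedAll (ratLt w q q') :=
  .bex _ (.bex _ (.bex _ (.bex _ (.bex _ (.bex _ (.conj (boundedAll_hasRep _ _ _ _)
    (.conj (boundedAll_hasRep _ _ _ _) (.bex _ (.bex _ (.conj (boundedAll_isMulAddMul _ _ _ _ _ _)
      (.conj (boundedAll_isMulAddMul _ _ _ _ _ _) (.mem _ _))))))))))))

/-- Absoluteness needs an assignment that is constant throughout, while the formulas below stand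
under quantifiers over varying names. Writing them as renamings discards the variables that do not
occur. -/
theorem force_rename_check {φ : Fml} (hφ : BoundedAll φ) {ξ : ℕ → ℕ} {x : ℝ} {e : ℕ → Name}
    {v : ℕ → ZFSet.{0}} (h : ∀ n, e (ξ n) = check (v n)) :
    Force (φ.rename ξ) x e ↔ ZSat φ v := by
  rw [Force.rename_iff, ← force_check hφ (z := x)]
  exact iff_of_eq (congrArg _ (funext h))

theorem force_fracEq {w a b d a' b' d' A B D A' B' D' : ℕ} {x : ℝ} {e : ℕ → Name}
    (hw : e w = check omega) (ha : e a = check (nat A)) (hb : e b = check (nat B))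
    (hd : e d = check (nat D)) (ha' : e a' = check (nat A')) (hb' : e b' = check (nat B'))
    (hd' : e d' = check (nat D')) :
    Force (fracEq w a b d a' b' d') x e ↔ A * D' + B' * D = A' * D + B * D' := by
  have hr : fracEq w a b d a' b' d' = (fracEq 0 1 2 3 4 5 6).rename (extend w (extend a (extend b
    (extend d (extend a' (extend b' fun _ => d')))))) := rfl
  rw [hr, force_rename_check (boundedAll_fracEq _ _ _ _ _ _ _) (v := extend omega (extend (nat A)
    (extend (nat B) (extend (nat D) (extend (nat A') (extend (nat B') fun _ => nat D'))))))]
  · exact zsat_fracEq rfl rfl rfl rfl rfl rfl rfl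
  · rintro (_ | _ | _ | _ | _ | _ | n) <;> assumption

theorem force_ratLt {w q q' : ℕ} {x : ℝ} {e : ℕ → Name} {r s : ℚ} (hw : e w = check omega)
    (hq : e q = check (ratCode r)) (hq' : e q' = check (ratCode s)) :
    Force (ratLt w q q') x e ↔ r < s := by
  have hr : ratLt w q q' = (ratLt 0 1 2).rename (extend w (extend q fun _ => q')) := rfl
  rw [hr, force_rename_check (boundedAll_ratLt _ _ _)
    (v := extend omega (extend (ratCode r) fun _ => ratCode s))]
  · exact zsat_ratLt rfl rfl rfl
  · rintro (_ | _ | n) <;> assumption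

theorem force_neg_isEmpty {i n : ℕ} {x : ℝ} {e : ℕ → Name} (h : e i = check (nat n)) :
    Force (neg (isEmpty i)) x e ↔ n ≠ 0 := by
  have hr : neg (isEmpty i) = (neg (isEmpty 0)).rename fun _ => i := rfl
  rw [hr, force_rename_check (boundedAll_isEmpty 0).neg (v := fun _ => nat n) fun _ => h]
  change (ZSat (isEmpty 0) _ → False) ↔ _
  rw [zsat_isEmpty, nat_eq_empty]

theorem force_isTriple {t a b d A B D : ℕ} {x : ℝ} {e : ℕ → Name} (ha : e a = check (nat A))
    (hb : e b = check (nat B)) (hd : e d = check (nat D)) :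
    Force (isTriple t a b d) x e ↔ Eqv (e t) (check (triple A B D)) x := by
  constructor
  · rintro ⟨y, -, p, -, h₁, h₂⟩
    rw [force_isPair] at h₁ h₂
    have h₁ : Eqv p (Name.pair (e a) (e b)) x := h₁
    have h₂ : Eqv (e t) (Name.pair p (e d)) x := h₂
    rw [ha, hb] at h₁
    rw [hd] at h₂
    exact (h₂.trans ((h₁.trans (eqv_check_pair.2 rfl).symm).pair (.refl _ _))).trans
      (eqv_check_pair.2 rfl).symm
  · intro h
    have hr : isTriple t a b d =
      (isTriple 0 1 2 3).rename (extend t (extend a (extend b fun _ => d))) := rfl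
    rw [hr, Force.rename_iff, extend_comp]
    refine Force.congr_zero ?_ h.symm
    have := force_check (φ := isTriple 0 1 2 3) (by repeat' constructor) (z := x)
      (v := extend (triple A B D) (extend (nat A) (extend (nat B) fun _ => nat D)))
    rw [extend_comp, extend_comp, extend_comp] at this
    rw [extend_comp, extend_comp, ha, hb, hd]
    exact this.2 (zsat_isTriple.2 rfl)

/-- The unbounded universal quantifier rules out absoluteness, since `t` and the class itself may
vary. The three numbers and hence the coded triple are still locally constant, so the class is a
constant name. -/
theorem force_isFracClass {w q a b d A B D : ℕ} {x : ℝ} {e : ℕ → Name} (hw : e w = check omega)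
    (ha : e a = check (nat A)) (hb : e b = check (nat B)) (hd : e d = check (nat D))
    (hD : D ≠ 0) :
    Force (isFracClass w q a b d) x e ↔ Eqv (e q) (check (ratCode (fracVal A B D))) x := by
  have key : ∀ (x : ℝ) (t : Name) (e : ℕ → Name), e w = check omega → e a = check (nat A) →
      e b = check (nat B) → e d = check (nat D) →
      (Force (bex (w + 1) (bex (w + 2) (bex (w + 3) (conj (neg (isEmpty 0)) (conj (isTriple 3 2 1 0)
        (fracEq (w + 4) (a + 4) (b + 4) (d + 4) 2 1 0)))))) x (extend t e) ↔
        Mem t (check (ratCode (fracVal A B D))) x) := by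
    intro x t e hw ha hb hd
    rw [force_bex_check (s := omega) (by exact hw), exists_mem_omega, mem_check]
    have h : ∀ a' b' d' : ℕ, Force (conj (neg (isEmpty 0)) (conj (isTriple 3 2 1 0)
        (fracEq (w + 4) (a + 4) (b + 4) (d + 4) 2 1 0))) x
        (extend (check (nat d')) (extend (check (nat b')) (extend (check (nat a')) (extend t e)))) ↔
        d' ≠ 0 ∧ Eqv t (check (triple a' b' d')) x ∧ A * d' + b' * D = a' * D + B * d' := by
      intro a' b' d'
      refine and_congr (force_neg_isEmpty rfl) (and_congr (force_isTriple rfl rfl rfl) ?_)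
      exact force_fracEq (A := A) (B := B) (D := D) (A' := a') (B' := b') (D' := d') (by exact hw)
        (by exact ha) (by exact hb) (by exact hd) rfl rfl rfl
    have h' : ∀ a' : ℕ, Force (bex (w + 2) (bex (w + 3) (conj (neg (isEmpty 0))
        (conj (isTriple 3 2 1 0) (fracEq (w + 4) (a + 4) (b + 4) (d + 4) 2 1 0))))) x
        (extend (check (nat a')) (extend t e)) ↔ ∃ b' d' : ℕ,
        d' ≠ 0 ∧ Eqv t (check (triple a' b' d')) x ∧ A * d' + b' * D = a' * D + B * d' := by
      intro a'
      rw [force_bex_check (s := omega) (by exact hw), exists_mem_omega]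
      refine exists_congr fun b' => ?_
      rw [force_bex_check (s := omega) (by exact hw), exists_mem_omega]
      exact exists_congr fun d' => h a' b' d'
    simp only [h', mem_ratCode]
    constructor
    · rintro ⟨a', b', d', h₁, h₂, h₃⟩
      exact ⟨_, ⟨a', b', d', h₁, ((fracVal_eq_iff hD h₁).2 h₃).symm, rfl⟩, h₂⟩
    · rintro ⟨_, ⟨a', b', d', h₁, h₂, rfl⟩, h₃⟩
      exact ⟨a', b', d', h₁, h₃, (fracVal_eq_iff hD h₁).1 h₂.symm⟩
  rw [isFracClass, Force.all_iff_iff]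
  have hg : ∀ {i : ℕ} {c : ZFSet.{0}} (y : ℝ), e i = check c → ground e y i = check c :=
    fun y h => by simp [ground, h]
  constructor
  · intro h
    refine eqv_of_forall_mem (h.mono fun y hy => ⟨?_, fun t =>
      (hy.1 t).trans (key y t e hw ha hb hd)⟩)
    ext c
    rw [settle_check, ← mem_check_check (x := 0), ← mem_check_check (x := 0)]
    exact (hy.2 0 (check c)).trans (key _ _ _ (hg y hw) (hg y ha) (hg y hb) (hg y hd))
  · intro h
    filter_upwards [h.eventually] with y hy
    refine ⟨fun t => Iff.trans ?_ (key y t e hw ha hb hd).symm, fun z t => Iff.trans ?_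
      (key z t _ (hg y hw) (hg y ha) (hg y hb) (hg y hd)).symm⟩
    · exact ⟨fun h => Mem.congr_right h hy, fun h => Mem.congr_right h hy.symm⟩
    · have hs := hy.settle_eq
      rw [settle_check] at hs
      rw [← hs]
      exact Iff.rfl

theorem force_isRationals {w Q : ℕ} {x : ℝ} {e : ℕ → Name} (hw : e w = check omega)
    (hQ : e Q = check rationals) : Force (isRationals w Q) x e := by
  have key : ∀ (x : ℝ) (d : Name) (e : ℕ → Name), e w = check omega → e Q = check rationals →
      (Force (mem 0 (Q + 1)) x (extend d e) ↔
        Force (bex (w + 1) (bex (w + 2) (bex (w + 3)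
          (conj (neg (isEmpty 0)) (isFracClass (w + 4) 3 2 1 0))))) x (extend d e)) := by
    intro x d e hw hQ
    have hQ' : extend d e (Q + 1) = check rationals := hQ
    have h : ∀ a b c : ℕ, Force (conj (neg (isEmpty 0)) (isFracClass (w + 4) 3 2 1 0)) x
        (extend (check (nat c)) (extend (check (nat b)) (extend (check (nat a)) (extend d e)))) ↔
        c ≠ 0 ∧ Eqv d (check (ratCode (fracVal a b c))) x := by
      intro a b c
      rw [Force, force_neg_isEmpty (n := c) rfl]
      exact and_congr_right fun hc =>
        force_isFracClass (A := a) (B := b) (D := c) (by exact hw) rfl rfl rfl hc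
    have h₁ : ∀ a b : ℕ, Force (bex (w + 3)
        (conj (neg (isEmpty 0)) (isFracClass (w + 4) 3 2 1 0))) x
        (extend (check (nat b)) (extend (check (nat a)) (extend d e))) ↔
        ∃ c : ℕ, c ≠ 0 ∧ Eqv d (check (ratCode (fracVal a b c))) x := by
      intro a b
      rw [force_bex_check (s := omega) (by exact hw), exists_mem_omega]
      exact exists_congr fun c => h a b c
    have h₂ : ∀ a : ℕ, Force (bex (w + 2) (bex (w + 3)
        (conj (neg (isEmpty 0)) (isFracClass (w + 4) 3 2 1 0)))) x
        (extend (check (nat a)) (extend d e)) ↔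
        ∃ b c : ℕ, c ≠ 0 ∧ Eqv d (check (ratCode (fracVal a b c))) x := by
      intro a
      rw [force_bex_check (s := omega) (by exact hw), exists_mem_omega]
      exact exists_congr fun b => h₁ a b
    rw [force_bex_check (s := omega) (by exact hw), exists_mem_omega, Force, hQ', mem_check]
    simp only [h₂, mem_rationals]
    constructor
    · rintro ⟨_, ⟨q, rfl⟩, hd⟩
      obtain ⟨a, b, c, hc, rfl⟩ := exists_fracVal q
      exact ⟨a, b, c, hc, hd⟩
    · rintro ⟨a, b, c, hc, hd⟩
      exact ⟨_, ⟨_, rfl⟩, hd⟩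
  rw [isRationals, Force.all_iff_iff]
  exact .of_forall fun y => ⟨fun d => key y d e hw hQ,
    fun z d => key z d _ (by simp [ground, hw]) (by simp [ground, hQ])⟩

/-! ### The generic Dedekind real -/

/-- The name of the lower cut of the varying point. -/
noncomputable def genericReal : Name :=
  .mk ℚ (fun q => check (ratCode q)) (fun q => ⟨Set.Ioi (q : ℝ), isOpen_Ioi⟩) fun _ => ∅

theorem mem_genericReal {d : Name} {x : ℝ} :
    Mem d genericReal x ↔ ∃ q : ℚ, (q : ℝ) < x ∧ Eqv d (check (ratCode q)) x := Iff.rfl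

theorem mem_settle_genericReal {c : ZFSet.{0}} {x : ℝ} :
    c ∈ genericReal.settle x ↔ ∃ q : ℚ, (q : ℝ) < x ∧ ratCode q = c := by
  rw [mem_settle]
  constructor
  · rintro (h | ⟨q, hq, h⟩)
    · exact absurd h (ZFSet.notMem_empty c)
    · exact ⟨q, hq, (settle_check (ratCode q) x).symm.trans h⟩
  · rintro ⟨q, hq, h⟩
    exact Or.inr ⟨q, hq, (settle_check (ratCode q) x).trans h⟩

theorem ratCode_mem_settle_genericReal {q : ℚ} {x : ℝ} :
    ratCode q ∈ genericReal.settle x ↔ (q : ℝ) < x := by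
  simp [mem_settle_genericReal, ratCode_injective.eq_iff]

theorem check_mem_genericReal {q : ℚ} {x : ℝ} :
    Mem (check (ratCode q)) genericReal x ↔ (q : ℝ) < x := by
  simp [mem_genericReal, eqv_check, ratCode_injective.eq_iff]

/-- Locatedness of a name of a set of rationals. -/
def Located (g : Name) : Prop := ∀ (x : ℝ) (p q : ℚ), p < q → Mem (check (ratCode p)) g x ∨
  ∀ᶠ y in 𝓝 x, ¬ Mem (check (ratCode q)) g y ∧ ratCode q ∉ g.settle y

/-- If `p < x`, then `p` belongs to the cut at `x`. Otherwise `x ≤ p < q`, and on the neighbourhood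
of all points below `q` the rational `q` is outside the cut, settled or not. -/
theorem located_genericReal : Located genericReal := by
  intro x p q hpq
  rcases lt_or_ge (p : ℝ) x with h | h
  · exact Or.inl (check_mem_genericReal.2 h)
  · right
    have hx : x < q := lt_of_le_of_lt h (by exact_mod_cast hpq)
    filter_upwards [Iio_mem_nhds hx] with y hy
    rw [check_mem_genericReal, ratCode_mem_settle_genericReal]
    exact ⟨not_lt.2 (le_of_lt hy), not_lt.2 (le_of_lt hy)⟩

/-- Once the point has settled at `y`, the cut is constant and the comparison of `p` with `y` is
decided classically. -/
theorem located_check_settle_genericReal (y : ℝ) : Located (check (genericReal.settle y)) := by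
  intro x p q hpq
  simp only [mem_check_check, settle_check, ratCode_mem_settle_genericReal]
  rcases lt_or_ge (p : ℝ) y with h | h
  · exact Or.inl h
  · have hy : y ≤ q := h.trans (by exact_mod_cast hpq.le)
    exact Or.inr (.of_forall fun _ => ⟨not_lt.2 hy, not_lt.2 hy⟩)

theorem force_neg_mem {i j : ℕ} {x : ℝ} {e : ℕ → Name} {c : ZFSet.{0}} (hi : e i = check c)
    (h : ∀ᶠ y in 𝓝 x, ¬ Mem (check c) (e j) y ∧ c ∉ (e j).settle y) :
    Force (neg (mem i j)) x e := by
  change ∀ᶠ y in 𝓝 x, (Mem (e i) (e j) y → False) ∧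
    ∀ z, Mem (check ((e i).settle y)) (check ((e j).settle y)) z → False
  filter_upwards [h] with y hy
  rw [hi]
  refine ⟨hy.1, fun z hz => hy.2 ?_⟩
  rwa [settle_check, mem_check_check] at hz

/-- Each quantifier and the implication has a moving half and a settled half. Hence locatedness is
required both of the name and of all its settled values. -/
theorem force_located {x : ℝ} {e : ℕ → Name} {Q : ZFSet.{0}} (hQ : ∀ c ∈ Q, ∃ q, ratCode q = c)
    (h₀ : e 0 = check Q) (h₁ : e 1 = check omega) (h₂ : Located (e 2))
    (h₂' : ∀ y, Located (check ((e 2).settle y))) :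
    Force (ball 0 (ball 1 (imp (ratLt 3 1 0) (disj (mem 1 4) (neg (mem 0 4)))))) x e := by
  have hdisj : ∀ (x : ℝ) (e : ℕ → Name) (p q : ℚ), Located (e 2) → p < q →
      Force (disj (mem 1 4) (neg (mem 0 4))) x
        (extend (check (ratCode q)) (extend (check (ratCode p)) e)) := by
    intro x e p q h hpq
    rcases h x p q hpq with h | h
    · exact Or.inl h
    · exact Or.inr (force_neg_mem rfl h)
  have himp : ∀ (x : ℝ) (e : ℕ → Name) (p q : ℚ), e 1 = check omega → Located (e 2) →
      (∀ y, Located (check ((e 2).settle y))) →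
      Force (imp (ratLt 3 1 0) (disj (mem 1 4) (neg (mem 0 4)))) x
        (extend (check (ratCode q)) (extend (check (ratCode p)) e)) := by
    intro x e p q hw h h'
    refine .of_forall fun y => ⟨fun hlt => hdisj y e p q h ?_, fun z hlt => ?_⟩
    · exact (force_ratLt (by exact hw) rfl rfl).1 hlt
    · rw [ground_extend, ground_extend, settle_check, settle_check] at hlt ⊢
      refine hdisj z _ p q (h' y) ?_
      exact (force_ratLt (by simp [extend, ground, hw]) rfl rfl).1 hlt
  have hball : ∀ (x : ℝ) (e : ℕ → Name) (p : ℚ), e 0 = check Q → e 1 = check omega →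
      Located (e 2) → (∀ y, Located (check ((e 2).settle y))) →
      Force (ball 1 (imp (ratLt 3 1 0) (disj (mem 1 4) (neg (mem 0 4))))) x
        (extend (check (ratCode p)) e) := by
    intro x e p hq hw h h'
    rw [Force.ball_iff]
    refine .of_forall fun y => ⟨fun d hd => ?_, fun z c hc => ?_⟩
    · have hd : Mem d (e 0) y := hd
      rw [hq] at hd
      obtain ⟨c, hc, hd⟩ := mem_check.1 hd
      obtain ⟨q, rfl⟩ := hQ c hc
      exact (himp y e p q hw h h').congr_zero hd.symm
    · have hc : c ∈ (e 0).settle y := hc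
      rw [hq, settle_check] at hc
      obtain ⟨q, rfl⟩ := hQ c hc
      rw [ground_extend, settle_check]
      exact himp z _ p q (by simp [ground, hw]) (h' y) (by simpa [ground] using h' y)
  rw [Force.ball_iff]
  refine .of_forall fun y => ⟨fun d hd => ?_, fun z c hc => ?_⟩
  · rw [h₀] at hd
    obtain ⟨c, hc, hd⟩ := mem_check.1 hd
    obtain ⟨p, rfl⟩ := hQ c hc
    exact (hball y e p h₀ h₁ h₂ h₂').congr_zero hd.symm
  · rw [h₀, settle_check] at hc
    obtain ⟨p, rfl⟩ := hQ c hc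
    exact hball z _ p (by simp [ground, h₀]) (by simp [ground, h₁]) (h₂' y)
      (by simpa [ground] using h₂' y)

theorem force_isDedekindReal_genericReal (x : ℝ) (e : ℕ → Name) :
    Force (isDedekindReal 0) x (extend genericReal e) := by
  refine ⟨check omega, check rationals, force_isOmega rfl, force_isRationals rfl rfl, ?_,
    ⟨?_, ?_⟩, ?_, ?_⟩
  · rw [isSubset, Force.ball_iff]
    refine .of_forall fun y => ⟨fun d hd => ?_, fun z c hc => ?_⟩
    · obtain ⟨q, -, hd⟩ := mem_genericReal.1 hd
      exact mem_check.2 ⟨_, mem_rationals.2 ⟨q, rfl⟩, hd⟩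
    · obtain ⟨q, -, rfl⟩ := mem_settle_genericReal.1 hc
      change Mem (check (ratCode q)) (check ((check rationals).settle y)) z
      rw [settle_check, mem_check_check]
      exact mem_rationals.2 ⟨q, rfl⟩
  · obtain ⟨q, hq⟩ := exists_rat_lt x
    exact ⟨check (ratCode q), mem_check_check.2 (mem_rationals.2 ⟨q, rfl⟩),
      check_mem_genericReal.2 hq⟩
  · obtain ⟨q, hq⟩ := exists_rat_gt x
    refine ⟨check (ratCode q), mem_check_check.2 (mem_rationals.2 ⟨q, rfl⟩),
      force_neg_mem rfl ?_⟩
    filter_upwards [Iio_mem_nhds hq] with y hy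
    exact ⟨mt check_mem_genericReal.1 (not_lt.2 (le_of_lt hy)),
      mt ratCode_mem_settle_genericReal.1 (not_lt.2 (le_of_lt hy))⟩
  · rw [Force.ball_iff]
    refine .of_forall fun y => ⟨fun d hd => ?_, fun z c hc => ?_⟩
    · obtain ⟨q, hq, hd⟩ := mem_genericReal.1 hd
      refine Force.congr_zero ?_ hd.symm
      obtain ⟨q', hq', hy⟩ := exists_rat_btwn hq
      exact ⟨check (ratCode q'), check_mem_genericReal.2 hy,
        (force_ratLt (r := q) (s := q') rfl rfl rfl).2 (by exact_mod_cast hq')⟩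
    · obtain ⟨q, hq, rfl⟩ := mem_settle_genericReal.1 hc
      obtain ⟨q', hq', hy⟩ := exists_rat_btwn hq
      refine ⟨check (ratCode q'), mem_check_check.2 (ratCode_mem_settle_genericReal.2 hy),
        (force_ratLt (r := q) (s := q') ?_ rfl rfl).2 (by exact_mod_cast hq')⟩
      simp [extend, ground]
  · exact force_located (fun c hc => mem_rationals.1 hc) rfl rfl located_genericReal
      located_check_settle_genericReal

/-- The members of a constant set are locally constant, while the cut of the moving point changes on
every interval. -/
theorem not_force_dedekindRealsFormSet (x : ℝ) (e : ℕ → Name) :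
    ¬ Force dedekindRealsFormSet x e := by
  rintro ⟨z, hz⟩
  -- Settling makes the alleged set constant; the generic real of the next moving point is then
  -- tested against it.
  have h := hz.ground 0
  rw [ground_extend, Force.all_iff_iff] at h
  have hG := (h.self_of_nhds.1 genericReal).2 (force_isDedekindReal_genericReal 0 _)
  obtain ⟨c, -, hc⟩ := mem_check.1 hG
  have hev : ∀ᶠ y in 𝓝 (0 : ℝ), genericReal.settle y = c := hc.eventually.mono fun y hy =>
    hy.settle_eq.trans (settle_check c y)
  obtain ⟨ε, hε, hball⟩ := Metric.eventually_nhds_iff_ball.1 hev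
  have h₁ := hball (ε / 2) (by simp [abs_of_pos hε, hε])
  have h₀ := hball 0 (by simpa using hε)
  -- A rational between `0` and `ε / 2` lies in the cut at `ε / 2` and not in the cut at `0`, though
  -- both points are in the ball where the cut is constant.
  obtain ⟨q, hq₀, hq⟩ := exists_rat_btwn (half_pos hε)
  have := ratCode_mem_settle_genericReal.2 hq
  rw [h₁, ← h₀, ratCode_mem_settle_genericReal] at this
  exact lt_asymm this (by exact_mod_cast hq₀)

theorem valid_neg_dedekindRealsFormSet : Valid dedekindRealsFormSet.neg :=
  Valid.imp fun x e h => not_force_dedekindRealsFormSet x e h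

end CZF

namespace CZF

open Fml

universe u v

/-! ### Evaluation of formulas in Kripke models -/

theorem Fml.Bounded.rename {φ : Fml} (h : Bounded φ) (ξ : ℕ → ℕ) : Bounded (φ.rename ξ) := by
  induction h generalizing ξ with
  | bot => exact .bot
  | eq i j => exact .eq _ _
  | mem i j => exact .mem _ _
  | conj _ _ h₁ h₂ => exact .conj (h₁ ξ) (h₂ ξ)
  | disj _ _ h₁ h₂ => exact .disj (h₁ ξ) (h₂ ξ)
  | imp _ _ h₁ h₂ => exact .imp (h₁ ξ) (h₂ ξ)
  | ball y _ h => exact .ball (ξ y) (h (lift ξ))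
  | bex y _ h => exact .bex (ξ y) (h (lift ξ))

namespace KripkeModel

variable {M : KripkeModel.{u, v}}

/-- The transition of an assignment to a later node. -/
def up (M : KripkeModel.{u, v}) {p q : M.Node} (h : p ≤ q) (e : ℕ → M.Dom p) : ℕ → M.Dom q :=
  fun n => M.map h (e n)

theorem up_extend {p q : M.Node} (h : p ≤ q) (d : M.Dom p) (e : ℕ → M.Dom p) :
    M.up h (extend d e) = extend (M.map h d) (M.up h e) := by
  funext n; cases n <;> rfl

theorem up_refl {p : M.Node} (h : p ≤ p) (e : ℕ → M.Dom p) : M.up h e = e :=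
  funext fun n => M.map_refl p (e n)

theorem map_self {p : M.Node} (h : p ≤ p) (x : M.Dom p) : M.map h x = x := M.map_refl p x

theorem up_up {p q r : M.Node} (h : p ≤ q) (k : q ≤ r) (e : ℕ → M.Dom p) :
    M.up k (M.up h e) = M.up (h.trans k) e :=
  funext fun n => M.map_map h k (e n)

theorem up_const {p q : M.Node} (h : p ≤ q) (d : M.Dom p) :
    M.up h (fun _ => d) = fun _ => M.map h d := rfl

theorem Sat.mono {φ : Fml} {p q : M.Node} {e : ℕ → M.Dom p} (hs : M.Sat φ p e) (h : p ≤ q) :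
    M.Sat φ q (M.up h e) := by
  induction φ generalizing p q with
  | bot => exact hs
  | eq i j => exact congrArg (M.map h) hs
  | mem i j => exact M.mem_map h _ _ hs
  | conj φ ψ h₁ h₂ => exact ⟨h₁ hs.1 h, h₂ hs.2 h⟩
  | disj φ ψ h₁ h₂ => exact hs.imp (h₁ · h) (h₂ · h)
  | imp φ ψ h₁ h₂ =>
    intro r k
    have := hs r (h.trans k)
    rw [show (fun n => M.map k (M.up h e n)) = fun n => M.map (h.trans k) (e n) from up_up h k e]
    exact this
  | all φ ih =>
    intro r k
    have := hs r (h.trans k)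
    rw [show (fun n => M.map k (M.up h e n)) = fun n => M.map (h.trans k) (e n) from up_up h k e]
    exact this
  | ex φ ih =>
    obtain ⟨d, hd⟩ := hs
    exact ⟨M.map h d, up_extend h d e ▸ ih hd h⟩

theorem sat_rename {φ : Fml} {p : M.Node} {e : ℕ → M.Dom p} {ξ : ℕ → ℕ} :
    M.Sat (φ.rename ξ) p e ↔ M.Sat φ p fun n => e (ξ n) := by
  have hext : ∀ {q : M.Node} (d : M.Dom q) (e : ℕ → M.Dom q) (ξ : ℕ → ℕ),
      (fun n => extend d e (lift ξ n)) = extend d fun n => e (ξ n) := by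
    intro q d e ξ; funext n; cases n <;> rfl
  induction φ generalizing p ξ with
  | bot => exact Iff.rfl
  | eq i j => exact Iff.rfl
  | mem i j => exact Iff.rfl
  | conj φ ψ h₁ h₂ => exact and_congr h₁ h₂
  | disj φ ψ h₁ h₂ => exact or_congr h₁ h₂
  | imp φ ψ h₁ h₂ => simp only [rename, Sat, h₁, h₂]
  | all φ ih => simp only [rename, Sat, ih, hext]
  | ex φ ih => simp only [rename, Sat, ih, hext]

theorem sat_imp {φ ψ : Fml} {p : M.Node} {e : ℕ → M.Dom p} : M.Sat (imp φ ψ) p e ↔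
    ∀ q (h : p ≤ q), M.Sat φ q (M.up h e) → M.Sat ψ q (M.up h e) := Iff.rfl

theorem sat_all_iff {φ ψ : Fml} {p : M.Node} {e : ℕ → M.Dom p} : M.Sat (all (iff φ ψ)) p e ↔
    ∀ q (h : p ≤ q) d, M.Sat φ q (extend d (M.up h e)) ↔ M.Sat ψ q (extend d (M.up h e)) := by
  constructor
  · intro hs q h d
    have h₁ := (hs q h d).1 q le_rfl
    have h₂ := (hs q h d).2 q le_rfl
    simp only [M.map_refl] at h₁ h₂
    exact ⟨h₁, h₂⟩
  · intro hs q h d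
    have key : ∀ r (k : q ≤ r), M.Sat φ r (M.up k (extend d (M.up h e))) ↔
        M.Sat ψ r (M.up k (extend d (M.up h e))) := by
      intro r k
      rw [up_extend, up_up]
      exact hs r _ _
    exact ⟨fun r k => (key r k).1, fun r k => (key r k).2⟩

theorem sat_ball {φ : Fml} {i : ℕ} {p : M.Node} {e : ℕ → M.Dom p} : M.Sat (ball i φ) p e ↔
    ∀ q (h : p ≤ q) d, M.Mem q d (M.map h (e i)) → M.Sat φ q (extend d (M.up h e)) := by
  constructor
  · intro hs q h d hd
    have := hs q h d q le_rfl
    rw [← up_refl (le_refl q) (extend d (M.up h e))]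
    refine this ?_
    change M.Mem q (M.map _ d) (M.map _ (M.map h (e i)))
    rwa [map_self, map_self]
  · intro hs q h d r k hd
    change M.Mem r (M.map k d) (M.map k (M.map h (e i))) at hd
    change M.Sat φ r (M.up k (extend d (M.up h e)))
    rw [M.map_map] at hd
    rw [up_extend, up_up]
    exact hs r _ _ hd

theorem sat_bex {φ : Fml} {i : ℕ} {p : M.Node} {e : ℕ → M.Dom p} : M.Sat (bex i φ) p e ↔
    ∃ d, M.Mem p d (e i) ∧ M.Sat φ p (extend d e) := Iff.rfl

theorem Models.of_all {φ : Fml} (h : M.Models (all φ)) : M.Models φ := by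
  intro p e
  have := h p (fun n => e (n + 1)) p le_rfl (e 0)
  simp only [M.map_refl] at this
  convert this using 1
  funext n; cases n <;> rfl

theorem Models.of_imp {φ ψ : Fml} (h : M.Models (imp φ ψ)) {p : M.Node} {e : ℕ → M.Dom p}
    (hφ : M.Sat φ p e) : M.Sat ψ p e := by
  have := h p e p le_rfl
  simp only [M.map_refl] at this
  exact this hφ

/-! ### Elementary set theory in a Kripke model -/

/-- Models of CZF with Exponentiation. -/
def ModelsCZF (M : KripkeModel.{u, v}) : Prop := ∀ φ ∈ CZFExp, M.Models φ

/-- A family of elements of the later nodes is a set at the node `p`. -/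
def IsSet (M : KripkeModel.{u, v}) (p : M.Node) (P : ∀ q, p ≤ q → M.Dom q → Prop) : Prop :=
  ∃ z : M.Dom p, ∀ q (h : p ≤ q) y, M.Mem q y (M.map h z) ↔ P q h y

theorem isSet_of_sat {p : M.Node} {φ : Fml} {e : ℕ → M.Dom p}
    (h : M.Sat (ex (all (iff (mem 0 1) φ))) p e) :
    ∃ z, ∀ q (h : p ≤ q) y, M.Mem q y (M.map h z) ↔
      M.Sat φ q (extend y (extend (M.map h z) (M.up h e))) := by
  obtain ⟨z, hz⟩ := h
  refine ⟨z, fun q h y => ?_⟩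
  rw [← up_extend]
  exact sat_all_iff.1 hz q h y

namespace ModelsCZF

variable {p : M.Node}

theorem ext (hM : M.ModelsCZF) {a b : M.Dom p}
    (h : ∀ q (h : p ≤ q) y, M.Mem q y (M.map h a) ↔ M.Mem q y (M.map h b)) : a = b :=
  (hM _ .extensionality).of_all.of_all.of_imp (p := p) (e := extend b (extend a fun _ => a))
    (sat_all_iff.2 h)

theorem isSet_upair (hM : M.ModelsCZF) (a b : M.Dom p) :
    M.IsSet p fun _ h y => y = M.map h a ∨ y = M.map h b :=
  isSet_of_sat ((hM _ .pairing).of_all.of_all p (extend b (extend a fun _ => a)))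

theorem isSet_singleton (hM : M.ModelsCZF) (a : M.Dom p) : M.IsSet p fun _ h y => y = M.map h a := by
  simpa using hM.isSet_upair a a

theorem isSet_sUnion (hM : M.ModelsCZF) (a : M.Dom p) :
    M.IsSet p fun q h y => ∃ s, M.Mem q s (M.map h a) ∧ M.Mem q y s :=
  isSet_of_sat ((hM _ .union).of_all p (extend a fun _ => a))

theorem isSet_sep (hM : M.ModelsCZF) {φ : Fml} (hφ : Bounded φ) (e : ℕ → M.Dom p) (a : M.Dom p) :
    M.IsSet p fun q h y => M.Mem q y (M.map h a) ∧ M.Sat φ q (extend y (M.up h e)) := by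
  obtain ⟨z, hz⟩ := isSet_of_sat ((hM _ (.boundedSeparation φ hφ)).of_all p (extend a e))
  refine ⟨z, fun q h y => (hz q h y).trans (and_congr Iff.rfl ?_)⟩
  rw [sat_rename]
  exact iff_of_eq (congrArg _ (funext fun n => by cases n <;> rfl))

theorem isSet_funs (hM : M.ModelsCZF) (a b : M.Dom p) :
    M.IsSet p fun q h f =>
      M.Sat (isFun 0 1 2) q (extend f (extend (M.map h a) fun _ => M.map h b)) := by
  obtain ⟨z, hz⟩ :=
    isSet_of_sat ((hM _ .exponentiation).of_all.of_all p (extend b (extend a fun _ => a)))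
  refine ⟨z, fun q h f => (hz q h f).trans ?_⟩
  have hr : isFun 0 3 2 = (isFun 0 1 2).rename (extend 0 (extend 3 fun _ => 2)) := rfl
  rw [hr, sat_rename]
  exact iff_of_eq (congrArg _ (funext fun n => by rcases n with _ | _ | n <;> rfl))

theorem collection (hM : M.ModelsCZF) (φ : Fml) (e : ℕ → M.Dom p) (a : M.Dom p)
    (hφ : ∀ q (h : p ≤ q) x, M.Mem q x (M.map h a) →
      ∃ y, M.Sat φ q (extend y (extend x (M.up h e)))) :
    ∃ b : M.Dom p, (∀ q (h : p ≤ q) x, M.Mem q x (M.map h a) →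
      ∃ y, M.Mem q y (M.map h b) ∧ M.Sat φ q (extend y (extend x (M.up h e)))) ∧
      ∀ q (h : p ≤ q) y, M.Mem q y (M.map h b) →
        ∃ x, M.Mem q x (M.map h a) ∧ M.Sat φ q (extend y (extend x (M.up h e))) := by
  obtain ⟨b, h₁, h₂⟩ := (hM _ (.strongCollection φ)).of_all.of_imp (p := p) (e := extend a e) (by
    rw [sat_ball]
    intro q h x hx
    obtain ⟨y, hy⟩ := hφ q h x hx
    refine ⟨y, ?_⟩
    rw [sat_rename]
    convert hy using 1
    funext n; rcases n with _ | _ | n <;> rfl)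
  rw [sat_ball] at h₁ h₂
  refine ⟨b, fun q h x hx => ?_, fun q h y hy => ?_⟩
  · obtain ⟨y, hy, hs⟩ := h₁ q h x hx
    rw [sat_rename] at hs
    refine ⟨y, hy, ?_⟩
    convert hs using 1
    funext n; rcases n with _ | _ | n <;> rfl
  · obtain ⟨x, hx, hs⟩ := h₂ q h y hy
    rw [sat_rename] at hs
    refine ⟨x, hx, ?_⟩
    convert hs using 1
    funext n; rcases n with _ | _ | n <;> rfl

theorem induction (hM : M.ModelsCZF) (φ : Fml) (e : ℕ → M.Dom p)
    (hφ : ∀ q (h : p ≤ q) x, (∀ r (k : q ≤ r) y, M.Mem r y (M.map k x) →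
      M.Sat φ r (extend y (M.up (h.trans k) e))) → M.Sat φ q (extend x (M.up h e)))
    (x : M.Dom p) : M.Sat φ p (extend x e) := by
  have := (hM _ (.setInduction φ)).of_imp (p := p) (e := e) (by
    intro q h x r k hs
    change M.Sat _ r (M.up k (extend x (M.up h e)))
    have hs : M.Sat (ball 0 (φ.rename (sub1 0 2))) r (M.up k (extend x (M.up h e))) := hs
    rw [up_extend, up_up] at hs ⊢
    refine hφ r _ _ fun s l y hy => ?_
    have hs' := sat_ball.1 hs s l y hy
    rw [sat_rename, up_extend, up_up] at hs'
    convert hs' using 1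
    funext n; cases n <;> rfl)
  have h' := this p le_rfl x
  simp only [M.map_refl] at h'
  exact h'

/-- The union of a definable family of sets. -/
theorem isSet_iUnion (hM : M.ModelsCZF) (φ : Fml) (e : ℕ → M.Dom p) (a : M.Dom p)
    (hφ : ∀ q (h : p ≤ q) x, M.Mem q x (M.map h a) → M.IsSet q fun r k y =>
      M.Sat φ r (extend (M.map k x) (extend y (M.up (h.trans k) e)))) :
    M.IsSet p fun q h y => ∃ x, M.Mem q x (M.map h a) ∧
      M.Sat φ q (extend x (extend y (M.up h e))) := by
  have hχ : ∀ {q : M.Node} {z x : M.Dom q} {e : ℕ → M.Dom q},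
      M.Sat (all (iff (mem 0 1) (φ.rename (sub2 2 0 3)))) q (extend z (extend x e)) ↔
      ∀ r (k : q ≤ r) y, M.Mem r y (M.map k z) ↔
        M.Sat φ r (extend (M.map k x) (extend y (M.up k e))) := by
    intro q z x e
    rw [sat_all_iff]
    refine forall_congr' fun r => forall_congr' fun k => forall_congr' fun y => ?_
    rw [sat_rename, up_extend, up_extend]
    refine iff_congr Iff.rfl (iff_of_eq (congrArg _ (funext fun n => ?_)))
    rcases n with _ | _ | n <;> rfl
  -- Collection is applied to "z is the set belonging to x". The second half of Strong Collection
  -- ensures that `b` contains only such sets, so its union has no superfluous elements.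
  obtain ⟨b, h₁, h₂⟩ := hM.collection (all (iff (mem 0 1) (φ.rename (sub2 2 0 3)))) e a
    (fun q h x hx => by
      obtain ⟨z, hz⟩ := hφ q h x hx
      refine ⟨z, hχ.2 fun r k y => ?_⟩
      rw [up_up]
      exact hz r k y)
  have hself : ∀ {q : M.Node} {z x : M.Dom q} {e : ℕ → M.Dom q},
      M.Sat (all (iff (mem 0 1) (φ.rename (sub2 2 0 3)))) q (extend z (extend x e)) → ∀ y,
      (M.Mem q y z ↔ M.Sat φ q (extend x (extend y e))) := by
    intro q z x e h y
    have := hχ.1 h q le_rfl y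
    rwa [map_self, map_self, up_refl] at this
  obtain ⟨U, hU⟩ := hM.isSet_sUnion b
  refine ⟨U, fun q h y => (hU q h y).trans ⟨?_, ?_⟩⟩
  · rintro ⟨s, hs, hy⟩
    obtain ⟨x, hx, hsx⟩ := h₂ q h s hs
    exact ⟨x, hx, (hself hsx y).1 hy⟩
  · rintro ⟨x, hx, hy⟩
    obtain ⟨s, hs, hsx⟩ := h₁ q h x hx
    exact ⟨s, hs, (hself hsx y).2 hy⟩

end ModelsCZF

/-! ### Small formulas -/

/-- A formula is small if its truth value is always a set. -/
def Small (M : KripkeModel.{u, v}) (φ : Fml) : Prop :=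
  ∀ (p : M.Node) (e : ℕ → M.Dom p) (c : M.Dom p),
    M.IsSet p fun q h y => y = M.map h c ∧ M.Sat φ q (M.up h e)

namespace ModelsCZF

variable {p : M.Node} {φ ψ : Fml}

theorem isSet_sep_singleton (hM : M.ModelsCZF) (hφ : Bounded φ) (e : ℕ → M.Dom p) (c : M.Dom p) :
    M.IsSet p fun q h y => y = M.map h c ∧ M.Sat φ q (extend y (M.up h e)) := by
  obtain ⟨s, hs⟩ := hM.isSet_singleton c
  obtain ⟨z, hz⟩ := hM.isSet_sep hφ e s
  refine ⟨z, fun q h y => (hz q h y).trans ?_⟩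
  beta_reduce
  rw [hs]

theorem small_of_bounded (hM : M.ModelsCZF) (hφ : Bounded φ) : M.Small φ := by
  intro p e c
  obtain ⟨z, hz⟩ := hM.isSet_sep_singleton (hφ.rename Nat.succ) e c
  refine ⟨z, fun q h y => ?_⟩
  rw [hz]
  beta_reduce
  rw [sat_rename]
  rfl

/-- The truth values of two small formulas can be combined by a bounded formula. -/
theorem isSet_combine (hM : M.ModelsCZF) (hφ : M.Small φ) (hψ : M.Small ψ) {β : Fml}
    (hβ : Bounded β) (e : ℕ → M.Dom p) (c : M.Dom p) :
    ∃ a b : M.Dom p, (∀ q (h : p ≤ q), M.Mem q (M.map h c) (M.map h a) ↔ M.Sat φ q (M.up h e)) ∧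
      (∀ q (h : p ≤ q), M.Mem q (M.map h c) (M.map h b) ↔ M.Sat ψ q (M.up h e)) ∧
      M.IsSet p fun q h y => y = M.map h c ∧
        M.Sat β q (M.up h (extend c (extend a fun _ => b))) := by
  obtain ⟨a, ha⟩ := hφ p e c
  obtain ⟨b, hb⟩ := hψ p e c
  obtain ⟨z, hz⟩ := hM.isSet_sep_singleton hβ (extend a fun _ => b) c
  refine ⟨a, b, fun q h => by simp [ha], fun q h => by simp [hb], z, fun q h y => ?_⟩
  rw [hz]
  beta_reduce
  rw [up_extend h c]
  exact and_congr_right fun hy => by rw [hy]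

theorem small_conj (hM : M.ModelsCZF) (hφ : M.Small φ) (hψ : M.Small ψ) : M.Small (conj φ ψ) := by
  intro p e c
  obtain ⟨a, b, ha, hb, z, hz⟩ :=
    hM.isSet_combine hφ hψ (β := conj (mem 0 1) (mem 0 2)) (.conj (.mem _ _) (.mem _ _)) e c
  exact ⟨z, fun q h y => (hz q h y).trans (and_congr_right fun _ => and_congr (ha q h) (hb q h))⟩

/-- With the two truth values coded as subsets of a singleton, the implication becomes the bounded
formula `c ∈ a → c ∈ b`, to which Bounded Separation applies. -/
theorem small_imp (hM : M.ModelsCZF) (hφ : M.Small φ) (hψ : M.Small ψ) : M.Small (imp φ ψ) := by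
  intro p e c
  obtain ⟨a, b, ha, hb, z, hz⟩ :=
    hM.isSet_combine hφ hψ (β := imp (mem 0 1) (mem 0 2)) (.imp (.mem _ _) (.mem _ _)) e c
  refine ⟨z, fun q h y => (hz q h y).trans (and_congr_right fun _ => ?_)⟩
  rw [sat_imp, sat_imp]
  refine forall_congr' fun r => forall_congr' fun k => ?_
  rw [up_up, up_up]
  exact imp_congr (ha r _) (hb r _)

/-- Separation for small formulas. -/
theorem isSet_sep_small (hM : M.ModelsCZF) (hφ : M.Small φ) (e : ℕ → M.Dom p) (a : M.Dom p) :
    M.IsSet p fun q h y => M.Mem q y (M.map h a) ∧ M.Sat φ q (extend y (M.up h e)) := by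
  have hren : ∀ {q : M.Node} {x y : M.Dom q} {e : ℕ → M.Dom q},
      M.Sat (conj (eq 1 0) (φ.rename (sub1 0 2))) q (extend x (extend y e)) ↔
        y = x ∧ M.Sat φ q (extend x e) := by
    intro q x y e
    refine and_congr Iff.rfl (sat_rename.trans (iff_of_eq (congrArg _ (funext fun n => ?_))))
    cases n <;> rfl
  -- The separated set is the union over `x ∈ a` of the truth values of `φ(x)`, each coded as a
  -- subset of `{x}`.
  obtain ⟨z, hz⟩ := hM.isSet_iUnion (conj (eq 1 0) (φ.rename (sub1 0 2))) e a
    (fun q h x _ => by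
      obtain ⟨z, hz⟩ := hφ q (extend x (M.up h e)) x
      refine ⟨z, fun r k y => ?_⟩
      rw [hz]
      beta_reduce
      rw [hren, up_extend, up_up])
  refine ⟨z, fun q h y => (hz q h y).trans ?_⟩
  simp only [hren]
  constructor
  · rintro ⟨x, hx, rfl, h⟩
    exact ⟨hx, h⟩
  · rintro ⟨hy, h⟩
    exact ⟨y, hy, rfl, h⟩

theorem isSet_of_bound (hM : M.ModelsCZF) (hφ : M.Small φ) (e : ℕ → M.Dom p) (a : M.Dom p)
    (ha : ∀ q (h : p ≤ q) y, M.Sat φ q (extend y (M.up h e)) → M.Mem q y (M.map h a)) :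
    M.IsSet p fun q h y => M.Sat φ q (extend y (M.up h e)) := by
  obtain ⟨z, hz⟩ := hM.isSet_sep_small hφ e a
  exact ⟨z, fun q h y => (hz q h y).trans (and_iff_right_of_imp (ha q h y))⟩

/-- Separating the elements that satisfy `φ` into a set `s` turns the formula into the bounded
statement that `e i` is contained in `s`. -/
theorem small_ball (hM : M.ModelsCZF) (i : ℕ) (hφ : M.Small φ) : M.Small (ball i φ) := by
  intro p e c
  obtain ⟨s, hs⟩ := hM.isSet_sep_small hφ e (e i)
  obtain ⟨z, hz⟩ := hM.isSet_sep_singleton (φ := ball 1 (mem 0 3)) (.ball _ (.mem _ _))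
    (extend (e i) fun _ => s) c
  refine ⟨z, fun q h y => (hz q h y).trans (and_congr_right fun _ => ?_)⟩
  rw [sat_ball, sat_ball]
  refine forall_congr' fun r => forall_congr' fun k => forall_congr' fun x => ?_
  change (M.Mem r x (M.map k (M.map h (e i))) → M.Mem r x (M.map k (M.map h s))) ↔
    (M.Mem r x (M.map k (M.map h (e i))) → _)
  rw [M.map_map, M.map_map, hs, up_up]
  exact ⟨fun H hx => (H hx).2, fun H hx => ⟨hx, H hx⟩⟩

/-- An existential quantifier that happens to range over a set only. -/
theorem small_ex (hM : M.ModelsCZF) (hφ : M.Small φ)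
    (hb : ∀ (p : M.Node) (e : ℕ → M.Dom p), ∃ a : M.Dom p, ∀ q (h : p ≤ q) x,
      M.Sat φ q (extend x (M.up h e)) → M.Mem q x (M.map h a)) : M.Small (ex φ) := by
  intro p e c
  obtain ⟨a, ha⟩ := hb p e
  have hren : ∀ {q : M.Node} {x y c : M.Dom q} {e : ℕ → M.Dom q},
      M.Sat (conj (eq 1 2) (φ.rename (sub1 0 3))) q (extend x (extend y (extend c e))) ↔
        y = c ∧ M.Sat φ q (extend x e) := by
    intro q x y c e
    refine and_congr Iff.rfl (sat_rename.trans (iff_of_eq (congrArg _ (funext fun n => ?_))))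
    cases n <;> rfl
  -- The truth value of the existential formula is the union of the truth values of its instances,
  -- all coded as subsets of the same `{c}`.
  obtain ⟨z, hz⟩ := hM.isSet_iUnion (conj (eq 1 2) (φ.rename (sub1 0 3))) (extend c e) a
    (fun q h x _ => by
      obtain ⟨z, hz⟩ := hφ q (extend x (M.up h e)) (M.map h c)
      refine ⟨z, fun r k y => ?_⟩
      rw [hz]
      beta_reduce
      rw [up_extend, up_extend, hren, up_up, M.map_map])
  refine ⟨z, fun q h y => (hz q h y).trans ?_⟩
  beta_reduce
  rw [up_extend]
  simp only [hren]
  constructor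
  · rintro ⟨x, -, rfl, h⟩
    exact ⟨rfl, x, h⟩
  · rintro ⟨rfl, x, hx⟩
    exact ⟨x, ha q h x hx, rfl, hx⟩

theorem small_bex (hM : M.ModelsCZF) (i : ℕ) (hφ : M.Small φ) : M.Small (bex i φ) :=
  hM.small_ex (hM.small_conj (hM.small_of_bounded (.mem _ _)) hφ)
    fun _ e => ⟨e i, fun _ _ _ hx => hx.1⟩

end ModelsCZF

end KripkeModel

end CZF

namespace CZF

open Fml

universe u v

namespace KripkeModel

variable {M : KripkeModel.{u, v}} {p : M.Node}

/-! ### Ordered pairs in a Kripke model -/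

/-- `z = {x, y}` at a node. -/
def UPair (M : KripkeModel.{u, v}) (p : M.Node) (z x y : M.Dom p) : Prop :=
  M.Sat (isUPair 0 1 2) p (extend z (extend x fun _ => y))

/-- `t = ⟨x, y⟩` at a node. -/
def Pair (M : KripkeModel.{u, v}) (p : M.Node) (t x y : M.Dom p) : Prop :=
  M.Sat (isPair 0 1 2) p (extend t (extend x fun _ => y))

/-- `f : a → b` at a node. -/
def Fun (M : KripkeModel.{u, v}) (p : M.Node) (f a b : M.Dom p) : Prop :=
  M.Sat (isFun 0 1 2) p (extend f (extend a fun _ => b))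

theorem sat_isUPair {i j k : ℕ} {e : ℕ → M.Dom p} :
    M.Sat (isUPair i j k) p e ↔ M.UPair p (e i) (e j) (e k) := by
  have hr : isUPair i j k = (isUPair 0 1 2).rename (extend i (extend j fun _ => k)) := rfl
  rw [hr, sat_rename, extend_comp, extend_comp]
  exact Iff.rfl

theorem sat_isPair {i j k : ℕ} {e : ℕ → M.Dom p} :
    M.Sat (isPair i j k) p e ↔ M.Pair p (e i) (e j) (e k) := by
  have hr : isPair i j k = (isPair 0 1 2).rename (extend i (extend j fun _ => k)) := rfl
  rw [hr, sat_rename, extend_comp, extend_comp]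
  exact Iff.rfl

theorem sat_isFun {i j k : ℕ} {e : ℕ → M.Dom p} :
    M.Sat (isFun i j k) p e ↔ M.Fun p (e i) (e j) (e k) := by
  have hr : isFun i j k = (isFun 0 1 2).rename (extend i (extend j fun _ => k)) := rfl
  rw [hr, sat_rename, extend_comp, extend_comp]
  exact Iff.rfl

theorem upair_iff {z x y : M.Dom p} : M.UPair p z x y ↔ M.Mem p x z ∧ M.Mem p y z ∧
    ∀ q (h : p ≤ q) u, M.Mem q u (M.map h z) → u = M.map h x ∨ u = M.map h y :=
  and_congr Iff.rfl (and_congr Iff.rfl sat_ball)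

theorem pair_iff {t x y : M.Dom p} : M.Pair p t x y ↔
    (∃ u, M.Mem p u t ∧ M.UPair p u x x) ∧ (∃ u, M.Mem p u t ∧ M.UPair p u x y) ∧
    ∀ q (h : p ≤ q) u, M.Mem q u (M.map h t) →
      M.UPair q u (M.map h x) (M.map h x) ∨ M.UPair q u (M.map h x) (M.map h y) := by
  simp only [Pair, isPair, Sat, sat_ball, sat_bex, sat_isUPair]
  exact Iff.rfl

theorem UPair.mono {z x y : M.Dom p} (h : M.UPair p z x y) {q : M.Node} (k : p ≤ q) :
    M.UPair q (M.map k z) (M.map k x) (M.map k y) := by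
  have := Sat.mono h k
  rwa [up_extend, up_extend, up_const] at this

theorem Pair.mono {t x y : M.Dom p} (h : M.Pair p t x y) {q : M.Node} (k : p ≤ q) :
    M.Pair q (M.map k t) (M.map k x) (M.map k y) := by
  have := Sat.mono h k
  rwa [up_extend, up_extend, up_const] at this

theorem Pair.exists_mem {t x y : M.Dom p} (h : M.Pair p t x y) :
    ∃ s, M.Mem p s t ∧ M.Mem p x s ∧ M.Mem p y s := by
  obtain ⟨-, ⟨s, hs, h⟩, -⟩ := pair_iff.1 h
  exact ⟨s, hs, (upair_iff.1 h).1, (upair_iff.1 h).2.1⟩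

namespace ModelsCZF

theorem exists_upair (hM : M.ModelsCZF) (x y : M.Dom p) : ∃ z, M.UPair p z x y := by
  obtain ⟨z, hz⟩ := hM.isSet_upair x y
  refine ⟨z, upair_iff.2 ⟨?_, ?_, fun q h u => (hz q h u).1⟩⟩
  · have := (hz p le_rfl x).2 (Or.inl (map_self _ _).symm)
    rwa [map_self] at this
  · have := (hz p le_rfl y).2 (Or.inr (map_self _ _).symm)
    rwa [map_self] at this

theorem upair_mem_iff {z x y : M.Dom p} (h : M.UPair p z x y) {q : M.Node} (k : p ≤ q)
    {u : M.Dom q} : M.Mem q u (M.map k z) ↔ u = M.map k x ∨ u = M.map k y := by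
  obtain ⟨h₁, h₂, h₃⟩ := upair_iff.1 h
  refine ⟨h₃ q k u, ?_⟩
  rintro (rfl | rfl)
  · exact M.mem_map k _ _ h₁
  · exact M.mem_map k _ _ h₂

theorem upair_unique (hM : M.ModelsCZF) {z z' x y : M.Dom p} (h : M.UPair p z x y)
    (h' : M.UPair p z' x y) : z = z' :=
  hM.ext fun _ k _ => (upair_mem_iff h k).trans (upair_mem_iff h' k).symm

theorem exists_pair (hM : M.ModelsCZF) (x y : M.Dom p) : ∃ t, M.Pair p t x y := by
  obtain ⟨u, hu⟩ := hM.exists_upair x x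
  obtain ⟨v, hv⟩ := hM.exists_upair x y
  obtain ⟨t, ht⟩ := hM.exists_upair u v
  obtain ⟨h₁, h₂, h₃⟩ := upair_iff.1 ht
  refine ⟨t, pair_iff.2 ⟨⟨u, h₁, hu⟩, ⟨v, h₂, hv⟩, fun q h s hs => ?_⟩⟩
  rcases h₃ q h s hs with rfl | rfl
  · exact Or.inl (hu.mono h)
  · exact Or.inr (hv.mono h)

theorem pair_unique (hM : M.ModelsCZF) {t t' x y : M.Dom p} (h : M.Pair p t x y)
    (h' : M.Pair p t' x y) : t = t' := by
  have key : ∀ {t t' : M.Dom p}, M.Pair p t x y → M.Pair p t' x y → ∀ q (k : p ≤ q) s,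
      M.Mem q s (M.map k t) → M.Mem q s (M.map k t') := by
    intro t t' h h' q k s hs
    obtain ⟨⟨u, hu, hu'⟩, ⟨v, hv, hv'⟩, -⟩ := pair_iff.1 (h'.mono k)
    rcases (pair_iff.1 h).2.2 q k s hs with h | h
    · rwa [hM.upair_unique h hu']
    · rwa [hM.upair_unique h hv']
  exact hM.ext fun q k s => ⟨key h h' q k s, key h' h q k s⟩

theorem isSet_pair (hM : M.ModelsCZF) (x y : M.Dom p) :
    M.IsSet p fun q h t => M.Pair q t (M.map h x) (M.map h y) := by
  obtain ⟨t, ht⟩ := hM.exists_pair x y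
  obtain ⟨z, hz⟩ := hM.isSet_singleton t
  refine ⟨z, fun q h s => (hz q h s).trans ⟨?_, fun hs => hM.pair_unique hs (ht.mono h)⟩⟩
  rintro rfl
  exact ht.mono h

/-- Without Power Set, the product is obtained as a union over `x` of unions over `y` of the
singletons `{⟨x, y⟩}`. -/
theorem isSet_prod (hM : M.ModelsCZF) (a b : M.Dom p) :
    M.IsSet p fun q h t => ∃ x, M.Mem q x (M.map h a) ∧ ∃ y, M.Mem q y (M.map h b) ∧
      M.Pair q t x y := by
  obtain ⟨z, hz⟩ := hM.isSet_iUnion (bex 2 (isPair 2 1 0)) (fun _ => b) a (fun q h x _ => by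
    obtain ⟨z, hz⟩ := hM.isSet_iUnion (isPair 1 2 0) (fun _ => x) (M.map h b) (fun r k y _ => by
      obtain ⟨z, hz⟩ := hM.isSet_pair (M.map k x) y
      refine ⟨z, fun s l t => (hz s l t).trans ?_⟩
      beta_reduce
      rw [sat_isPair, M.map_map]
      exact Iff.rfl)
    refine ⟨z, fun r k t => (hz r k t).trans ?_⟩
    beta_reduce
    simp only [sat_bex, sat_isPair, M.map_map]
    exact Iff.rfl)
  refine ⟨z, fun q h t => (hz q h t).trans ?_⟩
  simp only [sat_bex, sat_isPair]
  exact Iff.rfl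

end ModelsCZF

/-! ### Smallness of the arithmetical formulas -/

namespace ModelsCZF

/-- The formula begins with an unbounded quantifier over functions from `ω` to `ω`. By
Exponentiation these form a set, so `small_ex` applies. -/
theorem small_isRec (hM : M.ModelsCZF) {w b c : ℕ} {base : ℕ → ℕ → Fml}
    {step : ℕ → ℕ → ℕ → Fml} (hbase : M.Small (base 3 0)) (hstep : M.Small (step 5 1 0)) :
    M.Small (isRec w b c base step) := by
  have hF : Bounded (isFun 0 (w + 1) (w + 1)) := by repeat' constructor
  have hE : Bounded (isEmpty 1) := by repeat' constructor
  have h₁ : Bounded (app 2 1 0) := by repeat' constructor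
  have h₂ : Bounded (conj (isSucc 2 3) (conj (app 4 3 1) (app 4 2 0))) := by repeat' constructor
  have h₃ : Bounded (app 0 (b + 1) (c + 1)) := by repeat' constructor
  refine hM.small_ex (hM.small_conj (hM.small_of_bounded hF) (hM.small_conj
    (hM.small_bex _ (hM.small_bex _ (hM.small_conj (hM.small_of_bounded hE)
      (hM.small_conj (hM.small_of_bounded h₁) hbase))))
    (hM.small_conj (hM.small_ball _ (hM.small_ball _ (hM.small_ball _ (hM.small_ball _
      (hM.small_imp (hM.small_of_bounded h₂) hstep))))) (hM.small_of_bounded h₃)))) fun p e => ?_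
  obtain ⟨F, hF⟩ := hM.isSet_funs (e w) (e w)
  exact ⟨F, fun q h x hx => (hF q h x).2 (sat_isFun.1 hx.1)⟩

theorem small_isAdd (hM : M.ModelsCZF) (w a b c : ℕ) : M.Small (isAdd w a b c) :=
  hM.small_isRec (hM.small_of_bounded (.eq _ _)) (hM.small_of_bounded (by repeat' constructor))

theorem small_isMul (hM : M.ModelsCZF) (w a b c : ℕ) : M.Small (isMul w a b c) :=
  hM.small_isRec (hM.small_of_bounded (by repeat' constructor)) (hM.small_isAdd _ _ _ _)

theorem small_isPow2 (hM : M.ModelsCZF) (w b c : ℕ) : M.Small (isPow2 w b c) :=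
  hM.small_isRec (hM.small_of_bounded (by repeat' constructor)) (hM.small_isAdd _ _ _ _)

theorem small_isMulAddMul (hM : M.ModelsCZF) (w a b c d m : ℕ) :
    M.Small (isMulAddMul w a b c d m) :=
  hM.small_bex _ (hM.small_bex _ (hM.small_conj (hM.small_isMul _ _ _ _)
    (hM.small_conj (hM.small_isMul _ _ _ _) (hM.small_isAdd _ _ _ _))))

theorem small_fracEq (hM : M.ModelsCZF) (w a b d a' b' d' : ℕ) :
    M.Small (fracEq w a b d a' b' d') :=
  hM.small_bex _ (hM.small_conj (hM.small_isMulAddMul _ _ _ _ _ _)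
    (hM.small_isMulAddMul _ _ _ _ _ _))

theorem small_withReps (hM : M.ModelsCZF) (w q q' : ℕ) {φ : Fml} (hφ : M.Small φ) :
    M.Small (withReps w q q' φ) := by
  have h : ∀ q a b d, M.Small (hasRep q a b d) := fun q a b d =>
    hM.small_of_bounded (by repeat' constructor)
  exact hM.small_bex _ (hM.small_bex _ (hM.small_bex _ (hM.small_bex _ (hM.small_bex _
    (hM.small_bex _ (hM.small_conj (h _ _ _ _) (hM.small_conj (h _ _ _ _) hφ)))))))

theorem small_mulLt (hM : M.ModelsCZF) (w t u v d d' : ℕ) : M.Small (mulLt w t u v d d') :=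
  hM.small_bex _ (hM.small_bex _ (hM.small_conj (hM.small_isMul _ _ _ _)
    (hM.small_conj (hM.small_isMulAddMul _ _ _ _ _ _) (hM.small_of_bounded (.mem _ _)))))

theorem small_seqClose (hM : M.ModelsCZF) (w Q k r m s n : ℕ) :
    M.Small (seqClose w Q k r m s n) := by
  have h : ∀ i j k, M.Small (app i j k) := fun i j k =>
    hM.small_of_bounded (by repeat' constructor)
  refine hM.small_bex _ (hM.small_bex _ (hM.small_conj (h _ _ _) (hM.small_conj (h _ _ _)
    (hM.small_withReps _ _ _ (hM.small_bex _ (hM.small_bex _ (hM.small_bex _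
      (hM.small_conj (hM.small_isMulAddMul _ _ _ _ _ _) (hM.small_conj
        (hM.small_isMulAddMul _ _ _ _ _ _) (hM.small_conj (hM.small_isPow2 _ _ _)
          (hM.small_conj (hM.small_mulLt _ _ _ _ _ _) (hM.small_mulLt _ _ _ _ _ _))))))))))))

/-- The sequence and its modulus range over the function sets provided by Exponentiation. -/
theorem small_isFundSeq (hM : M.ModelsCZF) (w Q x : ℕ) : M.Small (isFundSeq w Q x) := by
  have h₁ : M.Small (isPair (x + 2) 1 0) := hM.small_of_bounded (by repeat' constructor)
  have h₂ : M.Small (isFun 1 (w + 2) (Q + 2)) := hM.small_of_bounded (by repeat' constructor)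
  have h₃ : M.Small (isFun 0 (w + 2) (w + 2)) := hM.small_of_bounded (by repeat' constructor)
  have h₄ : M.Small (conj (app 4 3 0) (conj (natLe 0 2) (natLe 0 1))) :=
    hM.small_of_bounded (by repeat' constructor)
  refine hM.small_ex (hM.small_ex (hM.small_conj h₁ (hM.small_conj h₂ (hM.small_conj h₃
    (hM.small_ball _ (hM.small_ball _ (hM.small_ball _ (hM.small_ball _
      (hM.small_imp h₄ (hM.small_seqClose _ _ _ _ _ _ _))))))))) fun p e => ?_) fun p e => ?_
  · obtain ⟨F, hF⟩ := hM.isSet_funs (e (w + 1)) (e (w + 1))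
    exact ⟨F, fun q h x hx => (hF q h x).2 (sat_isFun.1 hx.2.2.1)⟩
  · obtain ⟨F, hF⟩ := hM.isSet_funs (e w) (e Q)
    refine ⟨F, fun q h x hx => (hF q h x).2 ?_⟩
    obtain ⟨f, hf⟩ := hx
    exact sat_isFun.1 hf.2.1

/-- Both components of a pair lie in its union, which bounds the quantifiers that unpack the pairs
in `coincide`. -/
theorem exists_components (hM : M.ModelsCZF) (t : M.Dom p) : ∃ a : M.Dom p, ∀ q (h : p ≤ q) x y,
    M.Pair q (M.map h t) x y → M.Mem q x (M.map h a) ∧ M.Mem q y (M.map h a) := by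
  obtain ⟨a, ha⟩ := hM.isSet_sUnion t
  refine ⟨a, fun q h x y hxy => ?_⟩
  obtain ⟨s, hs, hx, hy⟩ := hxy.exists_mem
  exact ⟨(ha q h x).2 ⟨s, hs, hx⟩, (ha q h y).2 ⟨s, hs, hy⟩⟩

theorem small_coincide (hM : M.ModelsCZF) (w Q x y : ℕ) : M.Small (coincide w Q x y) := by
  have h₁ : M.Small (isPair (x + 4) 3 2) := hM.small_of_bounded (by repeat' constructor)
  have h₂ : M.Small (isPair (y + 4) 1 0) := hM.small_of_bounded (by repeat' constructor)
  have h₃ : M.Small (natLe 1 0) := hM.small_of_bounded (by repeat' constructor)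
  refine hM.small_ex (hM.small_ex (hM.small_ex (hM.small_ex (hM.small_conj h₁ (hM.small_conj h₂
    (hM.small_ball _ (hM.small_bex _ (hM.small_ball _
      (hM.small_imp h₃ (hM.small_seqClose _ _ _ _ _ _ _))))))) fun p e => ?_) fun p e => ?_)
        fun p e => ?_) fun p e => ?_
  · obtain ⟨a, ha⟩ := hM.exists_components (e (y + 3))
    exact ⟨a, fun q h d hd => (ha q h _ _ (sat_isPair.1 hd.2.1)).2⟩
  · obtain ⟨a, ha⟩ := hM.exists_components (e (y + 2))
    exact ⟨a, fun q h d ⟨_, hd⟩ => (ha q h _ _ (sat_isPair.1 hd.2.1)).1⟩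
  · obtain ⟨a, ha⟩ := hM.exists_components (e (x + 1))
    exact ⟨a, fun q h d ⟨_, _, hd⟩ => (ha q h _ _ (sat_isPair.1 hd.1)).2⟩
  · obtain ⟨a, ha⟩ := hM.exists_components (e x)
    exact ⟨a, fun q h d ⟨_, _, _, hd⟩ => (ha q h _ _ (sat_isPair.1 hd.1)).1⟩

end ModelsCZF

end KripkeModel

end CZF

namespace CZF

open Fml

universe u v

theorem rename_isFundSeq (w Q x : ℕ) (ξ : ℕ → ℕ) :
    (isFundSeq w Q x).rename ξ = isFundSeq (ξ w) (ξ Q) (ξ x) := rfl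

theorem rename_coincide (w Q x y : ℕ) (ξ : ℕ → ℕ) :
    (coincide w Q x y).rename ξ = coincide (ξ w) (ξ Q) (ξ x) (ξ y) := rfl

theorem rename_isRationals (w Q : ℕ) (ξ : ℕ → ℕ) :
    (isRationals w Q).rename ξ = isRationals (ξ w) (ξ Q) := rfl

namespace KripkeModel

variable {M : KripkeModel.{u, v}} {p : M.Node}

/-! ### Formulas that define sets -/

/-- The class of all `y` with `φ(y)` is a set, `y` being the variable `0` of `φ`. -/
def DefinesSet (M : KripkeModel.{u, v}) (φ : Fml) : Prop :=
  ∀ (p : M.Node) (e : ℕ → M.Dom p), M.IsSet p fun q h y => M.Sat φ q (extend y (M.up h e))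

/-- The renaming that exchanges the variables `0` and `1`. -/
def swap : ℕ → ℕ
  | 0 => 1
  | 1 => 0
  | n + 2 => n + 2

theorem sat_rename_swap {φ : Fml} {x y : M.Dom p} {e : ℕ → M.Dom p} :
    M.Sat (φ.rename swap) p (extend y (extend x e)) ↔ M.Sat φ p (extend x (extend y e)) := by
  rw [sat_rename]
  exact iff_of_eq (congrArg _ (funext fun n => by rcases n with _ | _ | n <;> rfl))

theorem sat_rename_skip {φ : Fml} {x y : M.Dom p} {e : ℕ → M.Dom p} :
    M.Sat (φ.rename (sub1 0 2)) p (extend x (extend y e)) ↔ M.Sat φ p (extend x e) := by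
  rw [sat_rename]
  exact iff_of_eq (congrArg _ (funext fun n => by cases n <;> rfl))

theorem DefinesSet.congr {φ ψ : Fml} (hφ : M.DefinesSet φ)
    (h : ∀ p (e : ℕ → M.Dom p), M.Sat φ p e ↔ M.Sat ψ p e) : M.DefinesSet ψ := by
  intro p e
  obtain ⟨z, hz⟩ := hφ p e
  exact ⟨z, fun q k y => (hz q k y).trans (h _ _)⟩

theorem definesSet_mem (i : ℕ) : M.DefinesSet (mem 0 (i + 1)) :=
  fun _ e => ⟨e i, fun _ _ _ => Iff.rfl⟩

/-- `w = ω` at a node. -/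
theorem sat_isOmega {w : M.Dom p} {e : ℕ → M.Dom p} : M.Sat (isOmega 0) p (extend w e) ↔
    ∀ q (h : p ≤ q) u, M.Mem q u (M.map h w) ↔ M.Sat (isEmpty 0) q (fun _ => u) ∨
      ∃ v, M.Mem q v (M.map h w) ∧ M.Sat (isSucc 0 1) q (extend u fun _ => v) := by
  have h₁ : isEmpty 0 = (isEmpty 0).rename fun _ => 0 := rfl
  have h₂ : isSucc 1 0 = (isSucc 0 1).rename (extend 1 fun _ => 0) := rfl
  rw [isOmega, sat_all_iff]
  refine forall_congr' fun q => forall_congr' fun h => forall_congr' fun u => iff_congr Iff.rfl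
    (or_congr ?_ (exists_congr fun v => and_congr Iff.rfl ?_))
  · rw [h₁, sat_rename]
    exact Iff.rfl
  · rw [h₂, sat_rename, extend_comp]
    exact Iff.rfl

namespace ModelsCZF

variable {φ ψ : Fml}

/-- By set induction: the defining equivalence makes an element of `w` either empty or the successor
of an element of `w`, and the latter is one of its own elements, so the induction hypothesis
applies. -/
theorem omega_subset (hM : M.ModelsCZF) {w w' : M.Dom p} {e e' : ℕ → M.Dom p}
    (hw : M.Sat (isOmega 0) p (extend w e)) (hw' : M.Sat (isOmega 0) p (extend w' e'))
    {x : M.Dom p} (hx : M.Mem p x w) : M.Mem p x w' := by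
  rw [sat_isOmega] at hw hw'
  have := hM.induction (imp (mem 0 1) (mem 0 2)) (extend w fun _ => w') (fun q h x ih => by
    intro r k hx
    change M.Mem r (M.map k x) (M.map k (M.map h w)) at hx
    change M.Mem r (M.map k x) (M.map k (M.map h w'))
    rw [M.map_map] at hx ⊢
    refine (hw' r _ _).2 (((hw r _ _).1 hx).imp_right ?_)
    rintro ⟨v, hv, hs⟩
    refine ⟨v, ?_, hs⟩
    have hi := ih r k v hs.1 r le_rfl
    change M.Mem r (M.map _ v) (M.map _ (M.map _ w)) → M.Mem r (M.map _ v) (M.map _ (M.map _ w'))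
      at hi
    simp only [map_self] at hi
    exact hi hv) x p le_rfl
  change M.Mem p (M.map _ x) (M.map _ w) → M.Mem p (M.map _ x) (M.map _ w') at this
  simp only [map_self] at this
  exact this hx

theorem omega_unique (hM : M.ModelsCZF) {w w' : M.Dom p} {e e' : ℕ → M.Dom p}
    (hw : M.Sat (isOmega 0) p (extend w e)) (hw' : M.Sat (isOmega 0) p (extend w' e')) :
    w = w' := by
  have key : ∀ {w : M.Dom p} {e}, M.Sat (isOmega 0) p (extend w e) → ∀ {q} (h : p ≤ q),
      M.Sat (isOmega 0) q (extend (M.map h w) (M.up h e)) := by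
    intro w e hw q h
    rw [← up_extend]
    exact hw.mono h
  exact hM.ext fun q h x =>
    ⟨hM.omega_subset (key hw h) (key hw' h), hM.omega_subset (key hw' h) (key hw h)⟩

theorem definesSet_isOmega (hM : M.ModelsCZF) : M.DefinesSet (isOmega 0) := by
  intro p e
  obtain ⟨w, hw⟩ := hM _ .infinity p e
  obtain ⟨z, hz⟩ := hM.isSet_singleton w
  have hw' : ∀ q (h : p ≤ q), M.Sat (isOmega 0) q (extend (M.map h w) (M.up h e)) := by
    intro q h
    rw [← up_extend]
    exact hw.mono h
  refine ⟨z, fun q h y => (hz q h y).trans ⟨?_, fun hy => hM.omega_unique hy (hw' q h)⟩⟩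
  rintro rfl
  exact hw' q h

theorem definesSet_conj (hM : M.ModelsCZF) (hψ : M.Small ψ) (hφ : M.DefinesSet φ) :
    M.DefinesSet (conj ψ φ) := by
  intro p e
  obtain ⟨a, ha⟩ := hφ p e
  obtain ⟨z, hz⟩ := hM.isSet_sep_small hψ e a
  refine ⟨z, fun q h y => (hz q h y).trans ?_⟩
  beta_reduce
  rw [ha]
  exact and_comm

/-- The union of a family of sets indexed by the set that `ψ` defines. In `φ` the index is the
variable `0`, so `swap` is needed to make the element the variable `0`. -/
theorem definesSet_ex (hM : M.ModelsCZF) (hψ : M.DefinesSet ψ)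
    (hφ : M.DefinesSet (φ.rename swap)) :
    M.DefinesSet (ex (conj (ψ.rename (sub1 0 2)) φ)) := by
  intro p e
  obtain ⟨a, ha⟩ := hψ p e
  obtain ⟨z, hz⟩ := hM.isSet_iUnion φ e a (fun q h x _ => by
    obtain ⟨z, hz⟩ := hφ q (extend x (M.up h e))
    refine ⟨z, fun r k y => (hz r k y).trans ?_⟩
    beta_reduce
    rw [up_extend, sat_rename_swap, up_up])
  refine ⟨z, fun q h y => (hz q h y).trans (exists_congr fun x => and_congr ?_ Iff.rfl)⟩
  exact (ha q h x).trans sat_rename_skip.symm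

theorem definesSet_bex (hM : M.ModelsCZF) (i : ℕ) (hφ : M.DefinesSet (φ.rename swap)) :
    M.DefinesSet (bex (i + 1) φ) :=
  hM.definesSet_ex (definesSet_mem i) hφ

/-- The singleton of a definable set is definable. -/
theorem definesSet_all_iff (hM : M.ModelsCZF) (hφ : M.DefinesSet φ) :
    M.DefinesSet (all (iff (mem 0 1) (φ.rename (sub1 0 2)))) := by
  intro p e
  obtain ⟨a, ha⟩ := hφ p e
  obtain ⟨z, hz⟩ := hM.isSet_singleton a
  refine ⟨z, fun q h y => (hz q h y).trans ?_⟩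
  beta_reduce
  rw [sat_all_iff]
  have key : ∀ r (k : q ≤ r) x, M.Sat (φ.rename (sub1 0 2)) r
      (extend x (M.up k (extend y (M.up h e)))) ↔ M.Mem r x (M.map k (M.map h a)) := by
    intro r k x
    rw [up_extend, sat_rename_skip, up_up, M.map_map]
    exact (ha r _ x).symm
  constructor
  · rintro rfl r k x
    exact (key r k x).symm
  · exact fun H => hM.ext fun r k x => (H r k x).trans (key r k x)

theorem definesSet_isPair (hM : M.ModelsCZF) (i j : ℕ) :
    M.DefinesSet (isPair 0 (i + 1) (j + 1)) := by
  intro p e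
  obtain ⟨z, hz⟩ := hM.isSet_pair (e i) (e j)
  refine ⟨z, fun q h y => (hz q h y).trans ?_⟩
  beta_reduce
  rw [sat_isPair]
  exact Iff.rfl

theorem sat_isTriple {t a b d : ℕ} {e : ℕ → M.Dom p} : M.Sat (isTriple t a b d) p e ↔
    ∃ s, M.Pair p s (e a) (e b) ∧ M.Pair p (e t) s (e d) := by
  simp only [isTriple, sat_bex, Sat, sat_isPair]
  constructor
  · rintro ⟨u, -, s, -, h⟩
    exact ⟨s, h⟩
  · rintro ⟨s, h₁, h₂⟩
    obtain ⟨u, hu, hs, -⟩ := h₂.exists_mem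
    exact ⟨u, hu, s, hs, h₁, h₂⟩

/-- The inner pair is determined by its components, so the bounds on the quantifiers of `isTriple`
can be dropped and the triple built as a pair over it. -/
theorem definesSet_isTriple (hM : M.ModelsCZF) (i j k : ℕ) :
    M.DefinesSet (isTriple 0 (i + 1) (j + 1) (k + 1)) :=
  DefinesSet.congr (hM.definesSet_ex (hM.definesSet_isPair i j) (φ := isPair 1 0 (k + 2))
    (hM.definesSet_isPair 0 (k + 1))) fun p e => by
      rw [sat_isTriple]
      refine exists_congr fun s => and_congr ?_ sat_isPair
      exact sat_isPair

theorem small_neg_isEmpty (hM : M.ModelsCZF) (i : ℕ) : M.Small (neg (isEmpty i)) :=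
  hM.small_of_bounded (by repeat' constructor)

theorem definesSet_isFracClass (hM : M.ModelsCZF) (w a b d : ℕ) :
    M.DefinesSet (isFracClass (w + 1) 0 (a + 1) (b + 1) (d + 1)) := by
  -- The quantifiers are added from the inside out. Each formula is the body of the next one with
  -- `swap` applied, which accounts for the changing indices.
  have h₀ : M.DefinesSet (conj (neg (isEmpty 1)) (conj (isTriple 0 3 2 1)
      (fracEq (w + 4) (a + 4) (b + 4) (d + 4) 3 2 1))) :=
    hM.definesSet_conj (hM.small_neg_isEmpty _) (DefinesSet.congr
      (hM.definesSet_conj (hM.small_fracEq _ _ _ _ _ _ _) (hM.definesSet_isTriple _ _ _))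
        fun _ _ => and_comm)
  have h₁ : M.DefinesSet (bex (w + 3) (conj (neg (isEmpty 0)) (conj (isTriple 1 3 2 0)
      (fracEq (w + 4) (a + 4) (b + 4) (d + 4) 3 2 0)))) := hM.definesSet_bex _ h₀
  have h₂ : M.DefinesSet (bex (w + 2) (bex (w + 3) (conj (neg (isEmpty 0))
      (conj (isTriple 2 3 1 0) (fracEq (w + 4) (a + 4) (b + 4) (d + 4) 3 1 0))))) :=
    hM.definesSet_bex _ h₁
  have h₃ : M.DefinesSet (bex (w + 1) (bex (w + 2) (bex (w + 3) (conj (neg (isEmpty 0))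
      (conj (isTriple 3 2 1 0) (fracEq (w + 4) (a + 4) (b + 4) (d + 4) 2 1 0)))))) :=
    hM.definesSet_bex _ h₂
  exact hM.definesSet_all_iff h₃

theorem definesSet_isRationals (hM : M.ModelsCZF) (w : ℕ) :
    M.DefinesSet (isRationals (w + 1) 0) := by
  have h₀ : M.DefinesSet (conj (neg (isEmpty 1)) (isFracClass (w + 4) 0 3 2 1)) :=
    hM.definesSet_conj (hM.small_neg_isEmpty _) (hM.definesSet_isFracClass _ _ _ _)
  have h₁ : M.DefinesSet (bex (w + 3) (conj (neg (isEmpty 0))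
      (isFracClass (w + 4) 1 3 2 0))) := hM.definesSet_bex _ h₀
  have h₂ : M.DefinesSet (bex (w + 2) (bex (w + 3) (conj (neg (isEmpty 0))
      (isFracClass (w + 4) 2 3 1 0)))) := hM.definesSet_bex _ h₁
  have h₃ : M.DefinesSet (bex (w + 1) (bex (w + 2) (bex (w + 3) (conj (neg (isEmpty 0))
      (isFracClass (w + 4) 3 2 1 0))))) := hM.definesSet_bex _ h₂
  exact hM.definesSet_all_iff h₃

/-- All fundamental sequences lie in the product of the set of functions from `ω` to `Q` with the
set of functions from `ω` to `ω`; smallness then allows them to be separated out. -/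
theorem definesSet_isFundSeq (hM : M.ModelsCZF) (w Q : ℕ) :
    M.DefinesSet (isFundSeq (w + 1) (Q + 1) 0) := by
  intro p e
  obtain ⟨F, hF⟩ := hM.isSet_funs (e w) (e Q)
  obtain ⟨G, hG⟩ := hM.isSet_funs (e w) (e w)
  obtain ⟨a, ha⟩ := hM.isSet_prod F G
  refine hM.isSet_of_bound (hM.small_isFundSeq _ _ _) e a fun q h x => ?_
  rintro ⟨r, f, hx, hr, hf, -⟩
  exact (ha q h x).2 ⟨r, (hF q h r).2 (sat_isFun.1 hr), f, (hG q h f).2 (sat_isFun.1 hf),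
    sat_isPair.1 hx⟩

/-- The equivalence class of one fundamental sequence is separated from the set of all of them,
since `coincide` is small. Its singleton is then united over all fundamental sequences, and finally
over the only possible `Q` and `ω`. -/
theorem definesSet_isCauchyReal (hM : M.ModelsCZF) : M.DefinesSet (isCauchyReal 0) := by
  have h₀ : M.DefinesSet (conj (isFundSeq 3 2 0) (coincide 3 2 0 1)) :=
    DefinesSet.congr (hM.definesSet_conj (hM.small_coincide _ _ _ _)
      (hM.definesSet_isFundSeq _ _)) fun _ _ => and_comm
  have h₁ : M.DefinesSet
      (all (iff (mem 0 1) (conj (isFundSeq 4 3 0) (coincide 4 3 0 2)))) := by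
    have := hM.definesSet_all_iff h₀
    rwa [rename, rename_isFundSeq, rename_coincide] at this
  have h₂ : M.DefinesSet (ex (conj (isFundSeq 3 2 0)
      (all (iff (mem 0 2) (conj (isFundSeq 4 3 0) (coincide 4 3 0 1)))))) := by
    have := hM.definesSet_ex (hM.definesSet_isFundSeq 1 0)
      (φ := all (iff (mem 0 2) (conj (isFundSeq 4 3 0) (coincide 4 3 0 1)))) (by
        simp only [rename, iff, rename_isFundSeq, rename_coincide]
        exact h₁)
    rwa [rename_isFundSeq] at this
  have h₃ : M.DefinesSet (ex (conj (isRationals 2 0) (ex (conj (isFundSeq 3 1 0)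
      (all (iff (mem 0 3) (conj (isFundSeq 4 2 0) (coincide 4 2 0 1)))))))) := by
    have := hM.definesSet_ex (hM.definesSet_isRationals 0) (φ := ex (conj (isFundSeq 3 1 0)
      (all (iff (mem 0 3) (conj (isFundSeq 4 2 0) (coincide 4 2 0 1)))))) (by
        simp only [rename, iff, rename_isFundSeq, rename_coincide]
        exact h₂)
    rwa [rename_isRationals] at this
  have h₄ : M.DefinesSet (ex (conj (isOmega 0) (ex (conj (isRationals 1 0)
      (ex (conj (isFundSeq 2 1 0)
        (all (iff (mem 0 4) (conj (isFundSeq 3 2 0) (coincide 3 2 0 1)))))))))) :=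
    hM.definesSet_ex hM.definesSet_isOmega (φ := ex (conj (isRationals 1 0)
      (ex (conj (isFundSeq 2 1 0)
        (all (iff (mem 0 4) (conj (isFundSeq 3 2 0) (coincide 3 2 0 1)))))))) (by
        simp only [rename, iff, rename_isRationals, rename_isFundSeq, rename_coincide]
        exact h₃)
  -- In `isCauchyReal` both existential quantifiers come first; `definesSet_ex` needs `isOmega`
  -- directly under its own quantifier, so it is moved past the quantifier for `Q`.
  refine h₄.congr fun p e => exists_congr fun w => ?_
  have hr : isOmega 1 = (isOmega 0).rename Nat.succ := rfl
  have hw : ∀ Q : M.Dom p, M.Sat (isOmega 1) p (extend Q (extend w e)) ↔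
      M.Sat (isOmega 0) p (extend w e) := by
    intro Q
    rw [hr, sat_rename]
    exact Iff.rfl
  constructor
  · rintro ⟨h, Q, hQ⟩
    exact ⟨Q, (hw Q).2 h, hQ⟩
  · rintro ⟨Q, h, hQ⟩
    exact ⟨(hw Q).1 h, Q, hQ⟩

theorem models_cauchyRealsFormSet (hM : M.ModelsCZF) : M.Models cauchyRealsFormSet := by
  intro p e
  obtain ⟨z, hz⟩ := hM.definesSet_isCauchyReal p e
  refine ⟨z, sat_all_iff.2 fun q h y => (hz q h y).trans ?_⟩
  have hr : isCauchyReal 0 = (isCauchyReal 0).rename (sub1 0 2) := rfl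
  beta_reduce
  rw [up_extend, ← sat_rename_skip (y := M.map h z), ← hr]

end ModelsCZF

end KripkeModel

/-! ### The theory `CZFExp` and the conclusion -/

theorem rename_mem_CZFExp {φ : Fml} (h : φ ∈ CZFExp) (ξ : ℕ → ℕ) : φ.rename ξ ∈ CZFExp := by
  cases h with
  | extensionality => exact .extensionality
  | pairing => exact .pairing
  | union => exact .union
  | infinity => exact .infinity
  | exponentiation => exact .exponentiation
  | setInduction φ =>
    have : (setInduction φ).rename ξ = setInduction (φ.rename (lift ξ)) := by
      have h₁ : lift (lift ξ) ∘ sub1 0 2 = sub1 0 2 ∘ lift ξ := by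
        funext n; cases n <;> rfl
      simp only [setInduction, Fml.ball, Fml.rename, rename_rename, h₁]
      rfl
    exact this ▸ .setInduction _
  | boundedSeparation φ hφ =>
    have : (separation φ).rename ξ = separation (φ.rename (lift ξ)) := by
      have h₁ : lift (lift (lift ξ)) ∘ sub1 0 3 = sub1 0 3 ∘ lift ξ := by
        funext n; cases n <;> rfl
      simp only [separation, Fml.iff, Fml.rename, rename_rename, h₁]
      rfl
    exact this ▸ .boundedSeparation _ (hφ.rename _)
  | strongCollection φ =>
    have : (strongCollection φ).rename ξ = strongCollection (φ.rename (lift (lift ξ))) := by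
      have h₁ : lift (lift (lift ξ)) ∘ sub2 0 1 3 = sub2 0 1 3 ∘ lift (lift ξ) := by
        funext n; rcases n with _ | _ | n <;> rfl
      have h₂ : lift (lift (lift (lift ξ))) ∘ sub2 0 1 4 =
          sub2 0 1 4 ∘ lift (lift ξ) := by
        funext n; rcases n with _ | _ | n <;> rfl
      have h₃ : lift (lift (lift (lift ξ))) ∘ sub2 1 0 4 =
          sub2 1 0 4 ∘ lift (lift ξ) := by
        funext n; rcases n with _ | _ | n <;> rfl
      simp only [strongCollection, Fml.ball, Fml.bex, Fml.rename, rename_rename, h₁, h₂, h₃]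
      rfl
    exact this ▸ .strongCollection _

/-- Completeness replaces an explicit derivation: a countermodel would be a Kripke model of the
axioms in which the Cauchy reals are not a set. -/
theorem proves_cauchyRealsFormSet : Proves CZFExp cauchyRealsFormSet := by
  by_contra h
  obtain ⟨M, hM, hφ⟩ := exists_countermodel (fun _ h => rename_mem_CZFExp h) h
  exact hφ (KripkeModel.ModelsCZF.models_cauchyRealsFormSet hM)

theorem not_proves_dedekindRealsFormSet : ¬ Proves CZFExp dedekindRealsFormSet := fun h =>
  not_force_dedekindRealsFormSet 0 (fun _ => Name.check ∅)
    (h.force (fun _ => valid_CZFExp) (by simp))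

/-- The formulas valid in the model of names hold in some Kripke model. -/
theorem exists_model_of_valid :
    ∃ M : KripkeModel.{u, v}, ∀ φ, Valid φ → M.Models φ := by
  -- As `⊥` is never forced, soundness makes the theory of all valid formulas consistent, and a
  -- countermodel to `⊥` satisfies every one of them.
  have h : ¬ Proves {φ | Valid φ} bot := fun h =>
    (h.force (x := 0) (e := fun _ => Name.check ∅) (fun _ h => h) (by simp) : False)
  obtain ⟨M, hM, -⟩ := exists_countermodel (T := {φ | Valid φ}) (fun _ h ξ => Valid.rename h ξ) h
  exact ⟨M.ulift, fun φ hφ => KripkeModel.ulift_models (hM φ hφ)⟩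

end CZF

theorem mainTheorem1 :
    (∃ M : CZF.KripkeModel.{1, 1},
      (∀ φ ∈ CZF.CZFExp, M.Models φ) ∧
      M.Models CZF.cauchyRealsFormSet ∧
      M.Models CZF.dedekindRealsFormSet.neg) ∧
    CZF.Proves CZF.CZFExp CZF.cauchyRealsFormSet ∧
    ¬ CZF.Proves CZF.CZFExp CZF.dedekindRealsFormSet := by
  refine ⟨?_, CZF.proves_cauchyRealsFormSet, CZF.not_proves_dedekindRealsFormSet⟩
  obtain ⟨M, hM⟩ := CZF.exists_model_of_valid.{1, 1}
  have hC : ∀ φ ∈ CZF.CZFExp, M.Models φ := fun φ hφ => hM φ (CZF.valid_CZFExp hφ)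
  exact ⟨M, hC, CZF.KripkeModel.ModelsCZF.models_cauchyRealsFormSet hC,
    hM _ CZF.valid_neg_dedekindRealsFormSet⟩
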